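/- **Definitions.** For a finite set $X$ and $C\subseteq\mathcal P(X)\setminus\{\emptyset\}$, let $L(C)$ be the set of instructions $\langle\mathtt{inc},c\rangle$, $\langle\mathtt{dec},c\rangle$ ($c\in C$) and $\langle\mathtt{transf},f\rangle$ for those $f:C\to\mathcal P(C)$ that are *distributive*: whenever $c\in C$, $c\subseteq\bigcup_{i=1}^k c_i$ with $c_i\in C$, and $c_i'\in f(c_i)$ for all $i$, there is $c'\in f(c)$ with $c'\subseteq\bigcup_{i=1}^k c'_i$. A *safety powerset counter automaton with nondeterministic transfers and incrementing errors* (safety IPCANT) is a tuple $\mathcal C=\langle\Sigma,Q,q_I,X,C,\delta\rangle$ with a finite alphabet $\Sigma$, a finite set $Q$ of states, $q_I\in Q$, a finite *basis* $X$, a set of counters $C\subseteq\mathcal P(X)\setminus\{\emptyset\}$, and $\delta\subseteq Q\times(\Sigma\uplus\{\varepsilon\})\times L(C)\times Q$ without cycles of $\varepsilon$ transitions. A configuration is $\langle q,v\rangle$ with $q\in Q$, $v:C\to\mathbb N$; the initial one is $\langle q_I,\mathbf 0\rangle$. There is an *error-free* transition $\langle q,v\rangle\xrightarrow{w,l}_\surd\langle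 q',v'\rangle$ iff $\langle q,w,l,q'\rangle\in\delta$ and $v'$ is obtained from $v$ by $l$: $\mathtt{inc}$ adds $1$ to $c$; $\mathtt{dec}$ requires $v(c)>0$ and subtracts $1$ from $c$; $\langle\mathtt{transf},f\rangle$ requires numbers $K^c_{c'}\in\mathbb N$ ($c\in C$, $c'\in f(c)$) with $v(c)=\sum_{c'\in f(c)}K^c_{c'}$ for all $c\in C$ and $v'(c')=\sum_{c:\,f(c)\ni c'}K^c_{c'}$ for all $c'\in C$. There is a *transition* $\langle q,v\rangle\xrightarrow{w,l}\langle q',v'\rangle$ iff $\langle q,v_\surd\rangle\xrightarrow{w,l}_\surd\langle q',v'_\surd\rangle$ for some $v_\surd\ge v$ and $v'_\surd\le v'$ (pointwise). It is *lazy* iff it is error-free, or $l=\langle\mathtt{dec},c\rangle$, $v(c)=0$ and $v'=v$. $\mathcal C$ accepts an $\omega$-word $w$ over $\Sigma$ iff there is an infinite sequence of transitions from the initial configuration whose labels concatenate to $w$; $\mathcal C$ is *nonempty* iff it accepts some $\omega$-word. **Theorem.** 1. Nonemptiness of safety IPCANT is decidable in space exponential in basis size and polylogarithmic in alphabet size and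 number of states. Precisely, there is one deterministic Turing machine with a read-only input tape and finitely many work tapes that, given (a standard binary encoding of) a safety IPCANT $\mathcal C$, halts and tells whether $\mathcal C$ is nonempty, using on its work tapes space at most $$2^{O(|X|^2)}\cdot O\bigl((1+\log|\Sigma|+\log|Q|)^2\bigr),$$ where $\log 0$ is read as $0$. 2. For a safety IPCANT $\mathcal C$ put $\alpha_0=|Q|$, $U_0=1$, $\alpha_{i+1}=2(|X|-i)\,\alpha_i U_i^{|C|}$, $U_{i+1}=3\alpha_iU_i^{|C|}$ for $0\le i<|X|$, and $m=2\alpha_{|X|}U_{|X|}^{|C|}$. Then $m<(3|Q|)^{2^{2|X|^2+|X|}}$, and if $\mathcal C$ has a sequence of $m-1$ lazy transitions from the initial configuration, then it has an infinite sequence of lazy transitions from the initial configuration, and $\mathcal C$ is nonempty. -/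

import Mathlib

/-! ## Powerset counter automata -/

namespace IPCANT

/-- `f : C → P(C)` is distributive: whenever `c ⊆ d₁ ∪ ⋯ ∪ d_k` and `d'ᵢ ∈ f(dᵢ)` for every `i`,
some `c' ∈ f(c)` satisfies `c' ⊆ d'₁ ∪ ⋯ ∪ d'_k`. -/
def Distributive {X : Type*} {C : Finset (Finset X)} (f : C → Finset C) : Prop :=
  ∀ (c : C) (k : ℕ) (d d' : Fin k → C),
    (∀ x ∈ c.1, ∃ i, x ∈ (d i).1) → (∀ i, d' i ∈ f (d i)) →
      ∃ c' ∈ f c, ∀ x ∈ c'.1, ∃ i, x ∈ (d' i).1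

/-- The set `L(C)` of instructions over the set of counters `C`. -/
inductive Instr {X : Type*} (C : Finset (Finset X)) where
  | inc (c : C)
  | dec (c : C)
  | transf (f : C → Finset C) (hf : Distributive f)

/-- Transitions `⟨q, w, l, q'⟩`; the label `none` is `ε`. -/
structure Trans (A Q : Type*) {X : Type*} (C : Finset (Finset X)) where
  src : Q
  label : Option A
  instr : Instr C
  tgt : Q

/-- A counter valuation `v : C → ℕ`; the order `≤` is pointwise. -/
abbrev Valuation {X : Type*} (C : Finset (Finset X)) : Type _ := C → ℕ

/-- `v'` can be obtained from `v` (without errors) by the instruction. -/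
def Instr.Obtains {X : Type*} [DecidableEq X] {C : Finset (Finset X)} :
    Instr C → Valuation C → Valuation C → Prop
  | .inc c, v, v' => v' = Function.update v c (v c + 1)
  | .dec c, v, v' => 0 < v c ∧ v' = Function.update v c (v c - 1)
  | .transf f _, v, v' => ∃ K : C → C → ℕ,
      (∀ c, v c = ∑ c' ∈ f c, K c c') ∧
      (∀ c', v' c' = ∑ c : C with c' ∈ f c, K c c')

end IPCANT

open IPCANT in
/-- A safety powerset counter automaton with nondeterministic transfers and incrementing errors,
with alphabet `A`, set of states `Q` and basis `X`. -/
structure SafetyIPCANT (A Q X : Type*) where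
  init : Q
  counters : Finset (Finset X)
  counters_nonempty : ∀ c ∈ counters, c.Nonempty
  trans : Set (Trans A Q counters)
  no_eps_cycle : ∀ q, ¬ Relation.TransGen
    (fun p p' => ∃ t ∈ trans, t.src = p ∧ t.label = none ∧ t.tgt = p') q q

namespace SafetyIPCANT

open IPCANT

variable {A Q X : Type*} [DecidableEq X]

/-- Configurations `⟨q, v⟩`. -/
abbrev Config (M : SafetyIPCANT A Q X) : Type _ := Q × Valuation M.counters

/-- The initial configuration `⟨q_I, 0⟩`. -/
def initConfig (M : SafetyIPCANT A Q X) : M.Config := (M.init, 0)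

/-- Error-free transitions. -/
def ExactStep (M : SafetyIPCANT A Q X) (w : Option A) (l : Instr M.counters)
    (s s' : M.Config) : Prop :=
  (⟨s.1, w, l, s'.1⟩ : Trans A Q M.counters) ∈ M.trans ∧ l.Obtains s.2 s'.2

/-- Transitions that may contain incrementing errors. -/
def Step (M : SafetyIPCANT A Q X) (w : Option A) (l : Instr M.counters)
    (s s' : M.Config) : Prop :=
  ∃ u u' : Valuation M.counters,
    s.2 ≤ u ∧ M.ExactStep w l (s.1, u) (s'.1, u') ∧ u' ≤ s'.2

/-- Lazy transitions: the only errors are those that enable the decrement of a zero counter. -/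
def LazyStep (M : SafetyIPCANT A Q X) (w : Option A) (l : Instr M.counters)
    (s s' : M.Config) : Prop :=
  M.ExactStep w l s s' ∨
    ((⟨s.1, w, l, s'.1⟩ : Trans A Q M.counters) ∈ M.trans ∧
      ∃ c, l = Instr.dec c ∧ s.2 c = 0 ∧ s'.2 = s.2)

/-- The `ω`-word `a` is the concatenation `w₀ w₁ ⋯` of letters and `ε`s: the positions at which
`w` is a letter are enumerated increasingly by `φ`, and the letters there are `a₀, a₁, …`. -/
def IsConcat (w : ℕ → Option A) (a : ℕ → A) : Prop :=
  ∃ φ : ℕ → ℕ, StrictMono φ ∧ (∀ i, w (φ i) = some (a i)) ∧ ∀ j, j ∉ Set.range φ → w j = none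

/-- Acceptance of an `ω`-word. -/
def Accepts (M : SafetyIPCANT A Q X) (a : ℕ → A) : Prop :=
  ∃ (s : ℕ → M.Config) (w : ℕ → Option A) (l : ℕ → Instr M.counters),
    s 0 = M.initConfig ∧ (∀ j, M.Step (w j) (l j) (s j) (s (j + 1))) ∧ IsConcat w a

/-- The language of the automaton. -/
def language (M : SafetyIPCANT A Q X) : Set (ℕ → A) := {a | M.Accepts a}

/-- There is a sequence of `N` lazy transitions from the initial configuration. -/
def HasLazyRun (M : SafetyIPCANT A Q X) (N : ℕ) : Prop :=
  ∃ s : ℕ → M.Config, s 0 = M.initConfig ∧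
    ∀ j < N, ∃ w l, M.LazyStep w l (s j) (s (j + 1))

/-- There is an infinite sequence of lazy transitions from the initial configuration. -/
def HasInfiniteLazyRun (M : SafetyIPCANT A Q X) : Prop :=
  ∃ s : ℕ → M.Config, s 0 = M.initConfig ∧ ∀ j, ∃ w l, M.LazyStep w l (s j) (s (j + 1))

end SafetyIPCANT

namespace IPCANT

/-- The pair `(αᵢ, Uᵢ)` for an automaton with `q` states, basis of size `n` and `k` counters. -/
def bounds (q n k : ℕ) : ℕ → ℕ × ℕ
  | 0 => (q, 1)
  | i + 1 =>
    let p := bounds q n k i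
    (2 * (n - i) * p.1 * p.2 ^ k, 3 * p.1 * p.2 ^ k)

/-- `m = 2 α_n U_n ^ k`. -/
def runBound (q n k : ℕ) : ℕ := 2 * (bounds q n k n).1 * (bounds q n k n).2 ^ k

end IPCANT

/-! ## Automata as inputs of algorithms -/

namespace IPCANT

/-- The alphabet in which automata are written down. -/
inductive Sym where
  | bit (b : Bool)
  | sep
  | ctr
  | trn
  | eps
  | letter
  | inc
  | dec
  | transf

/-- A natural number in binary. -/
def encodeNat (k : ℕ) : List Sym := k.bits.map Sym.bit ++ [Sym.sep]

/-- A set of basis elements, as its characteristic vector. -/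
def encodeSet {n : ℕ} (c : Finset (Fin n)) : List Sym :=
  (List.finRange n).map (fun x => Sym.bit (decide (x ∈ c))) ++ [Sym.sep]

/-- A letter or `ε`. -/
def encodeLabel {a : ℕ} : Option (Fin a) → List Sym
  | none => [Sym.eps]
  | some x => Sym.letter :: encodeNat x

/-- An instruction; `cs` lists the counters, and a transfer is written as its 0-1 matrix. -/
def encodeInstr {n : ℕ} {C : Finset (Finset (Fin n))} (cs : List C) : Instr C → List Sym
  | .inc c => Sym.inc :: encodeSet c.1
  | .dec c => Sym.dec :: encodeSet c.1
  | .transf f _ => Sym.transf ::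
      cs.flatMap (fun c => cs.map (fun c' => Sym.bit (decide (c' ∈ f c))) ++ [Sym.sep])

/-- A transition. -/
def encodeTrans {a s n : ℕ} {C : Finset (Finset (Fin n))} (cs : List C)
    (t : Trans (Fin a) (Fin s) C) : List Sym :=
  Sym.trn :: (encodeNat t.src ++ encodeNat t.tgt ++ encodeLabel t.label ++ encodeInstr cs t.instr)

/-- `x` is the word that describes the automaton, for some listing of its counters and some
listing of its transitions, both without repetitions. -/
def IsEncoding {a s n : ℕ} (M : SafetyIPCANT (Fin a) (Fin s) (Fin n)) (x : List Sym) : Prop :=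
  ∃ (cs : List M.counters) (ts : List (Trans (Fin a) (Fin s) M.counters)),
    cs.Nodup ∧ (∀ c, c ∈ cs) ∧ ts.Nodup ∧ (∀ t, t ∈ ts ↔ t ∈ M.trans) ∧
    x = encodeNat a ++ encodeNat s ++ encodeNat n ++ encodeNat M.init ++
      cs.flatMap (fun c => Sym.ctr :: encodeSet c.1) ++ ts.flatMap (encodeTrans cs)

end IPCANT

/-! ## Deterministic Turing machines with a read-only input tape -/

namespace SpaceTM

/-- Head movements. -/
inductive Move where
  | left
  | stay
  | right

/-- Symbols of the input tape: the input between two end markers. -/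
inductive InSym (I : Type) where
  | leftEnd
  | sym (x : I)
  | rightEnd

/-- A deterministic Turing machine with a two-way read-only input tape over the alphabet `I` and
finitely many work tapes, each infinite to the right. The machine halts in the states `q` with
`verdict q = some b`, accepting if `b = true` and rejecting if `b = false`. -/
structure Machine (I : Type) where
  tapes : ℕ
  Symbol : Type
  State : Type
  finite_symbol : Finite Symbol
  finite_state : Finite State
  blank : Symbol
  start : State
  verdict : State → Option Bool
  next : State → InSym I → (Fin tapes → Symbol) → State × Move × (Fin tapes → Symbol × Move)

variable {I : Type}

/-- Configurations of a machine: state, position of the input head, contents of the work tapes,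
positions of the work heads. -/
structure Machine.Config (M : Machine I) where
  state : M.State
  inHead : ℕ
  tape : Fin M.tapes → ℕ → M.Symbol
  head : Fin M.tapes → ℕ

/-- New position of a head; a head on cell `0` that is to move left stays. -/
def Move.apply : Move → ℕ → ℕ
  | .left, p => p - 1
  | .stay, p => p
  | .right, p => p + 1

/-- The symbol at position `p` of the input tape, which holds the left end marker at position `0`,
the input at positions `1, …, |x|`, and the right end marker at position `|x| + 1`. -/
def readInput (x : List I) (p : ℕ) : InSym I :=
  if p = 0 then .leftEnd else
    match x[p - 1]? with
    | some y => .sym y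
    | none => .rightEnd

/-- The initial configuration. -/
def Machine.initial (M : Machine I) : M.Config where
  state := M.start
  inHead := 0
  tape := fun _ _ => M.blank
  head := fun _ => 0

/-- One step on input `x`; halting configurations do not change, and the input head never leaves
the part of the input tape between the end markers (inclusive). -/
def Machine.step (M : Machine I) (x : List I) (c : M.Config) : M.Config :=
  match M.verdict c.state with
  | some _ => c
  | none =>
    let r := M.next c.state (readInput x c.inHead) (fun i => c.tape i (c.head i))
    { state := r.1
      inHead := min (r.2.1.apply c.inHead) (x.length + 1)
      tape := fun i => Function.update (c.tape i) (c.head i) (r.2.2 i).1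
      head := fun i => (r.2.2 i).2.apply (c.head i) }

/-- The configuration after `t` steps on input `x`. -/
def Machine.run (M : Machine I) (x : List I) (t : ℕ) : M.Config := (M.step x)^[t] M.initial

/-- On input `x` the machine halts with the verdict `b`. -/
def Machine.HaltsWith (M : Machine I) (x : List I) (b : Bool) : Prop :=
  ∃ t, M.verdict (M.run x t).state = some b

/-- On input `x` the machine visits at most `S` cells, the leftmost ones, of each work tape. -/
def Machine.UsesSpace (M : Machine I) (x : List I) (S : ℕ) : Prop :=
  ∀ t i, (M.run x t).head i < S

end SpaceTM

/-! ## Lazy runs -/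

namespace IPCANT

/-! ### Single lazy transitions: covered sets, and tokens outside them -/

section Flow

variable {X : Type*} [DecidableEq X] {C : Finset (Finset X)}

/-! Only lazy runs matter. Instructions are monotone: a smaller valuation can follow a larger one
lazily (`LazyObtains.mono`), so below every run lies a lazy run through the same transitions.
Conversely a lazy step is a step with at most one error, and an infinite lazy run spells an ω-word
because ε transitions form no cycle. Hence nonemptiness means that an infinite lazy run exists.

A long finite lazy run can be pumped to an infinite one (`infiniteLazyFrom_of_cover`). Along the run
one keeps subsets `Y j` of the basis such that whatever lies in counters inside `Y j` can be moved
to counters inside `Y (j + 1)`. The contents of covered counters are then irrelevant: any number of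
tokens there can follow the run. Initially all `Y j` are empty, which is possible because counters
are nonempty. The proof is by induction on the number of basis elements left out. Let `L` be the
length that suffices when one element fewer is left out. If a token can stay outside the cover for
`L` steps, distributivity (`coverStep_union`) permits adding its counters to the cover along that
window, and induction applies there. Otherwise every uncovered token is younger than `L` steps; as a
step creates at most one token, at most `L` of them exist, and by the pigeonhole principle the state
and the uncovered values repeat. The segment between the repetitions can be run for ever
(`infiniteLazyFrom_of_repeat`). Solving the recursion for the lengths gives the bound `m`
(`pumpLength_le`, `three_mul_bounds_le`).

For the algorithm, `m` is rounded up to `2 ^ h` with `h = height s n`, which is linear in the number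
of digits of the number `s` of states and `2 ^ O(n²)` in the basis size `n`. A run of `2 ^ h` lazy
steps creates at most `2 ^ h` tokens, so its configurations are numbers below `V = s * (2 ^ h + 1) ^
|C|`, and the run is a path of length `2 ^ h` in a graph on these numbers. Such a path is found by
recursive bisection, as in Savitch's theorem; the recursion stack is one number with `h` digits in
base `2 V`, so the space is about `h * log V`. Edges are tested by reading the input, whose length
has a sufficiently small logarithm because transitions are listed without repetitions (`length_le`).

The Turing machine is obtained in layers: functions of numbers up to a cap with saturating
arithmetic (`Fn`) are compiled to register programs (`computes_compile`), and these run on binary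
tapes. The machine does not know its space bound beforehand. It tries growing caps until a
saturating evaluation of the bound no longer reaches the cap (`decider_spec`, `eval_boundFn`); all
later evaluations are then exact. -/

/-- `v'` can be obtained from `v` by the instruction, where a zero counter may be decremented. -/
def LazyObtains (l : Instr C) (v v' : Valuation C) : Prop :=
  l.Obtains v v' ∨ ∃ c, l = Instr.dec c ∧ v c = 0 ∧ v' = v

/-- Every counter inside `Y` can be moved by the instruction to a counter inside `Y'`. -/
def CoverStep : Instr C → Finset X → Finset X → Prop
  | .inc _, Y, Y' => Y' = Y
  | .dec _, Y, Y' => Y' = Y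
  | .transf f _, Y, Y' => ∀ c : C, c.1 ⊆ Y → ∃ c' ∈ f c, c'.1 ⊆ Y'

/-- The instruction can move a token from the counter `d` to the counter `d'`. -/
def TokenStep : Instr C → C → C → Prop
  | .inc _, d, d' => d' = d
  | .dec _, d, d' => d' = d
  | .transf f _, d, d' => d' ∈ f d

/-- `r` is at most `w` on the counters that are not inside `Y`. -/
def LeOutside (Y : Finset X) (w r : Valuation C) : Prop := ∀ c : C, ¬ c.1 ⊆ Y → r c ≤ w c

/-- Tokens are dropped from the summands one summand at a time. This thins a row of a transfer
matrix to fit a smaller valuation. -/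
theorem exists_le_sum_eq {ι : Type*} [DecidableEq ι] (F : Finset ι) (K : ι → ℕ) (N : ℕ)
    (h : N ≤ ∑ i ∈ F, K i) : ∃ K' : ι → ℕ, (∀ i, K' i ≤ K i) ∧ N = ∑ i ∈ F, K' i := by
  induction F using Finset.induction_on generalizing N with
  | empty => exact ⟨K, fun _ => le_rfl, by simpa using h⟩
  | insert a F ha ih =>
    rw [Finset.sum_insert ha] at h
    obtain ⟨K', hK', hs⟩ := ih (N - min N (K a)) (by omega)
    refine ⟨Function.update K' a (min N (K a)), fun i => ?_, ?_⟩
    · by_cases hi : i = a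
      · subst hi; simp
      · simpa [hi] using hK' i
    · rw [Finset.sum_insert ha, Finset.sum_congr rfl (g := K'), ← hs]
      · simp
      · intro i hi
        have : i ≠ a := fun e => ha (e ▸ hi)
        simp [this]

theorem LazyObtains.inc_iff {c : C} {v v' : Valuation C} :
    LazyObtains (.inc c) v v' ↔ v' = Function.update v c (v c + 1) := by
  simp [LazyObtains, Instr.Obtains]

/-- Laziness makes decrement a total operation, since truncated subtraction leaves a zero counter at
zero. -/
theorem LazyObtains.dec_iff {c : C} {v v' : Valuation C} :
    LazyObtains (.dec c) v v' ↔ v' = Function.update v c (v c - 1) := by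
  simp only [LazyObtains, Instr.Obtains, Instr.dec.injEq]
  constructor
  · rintro (⟨_, h⟩ | ⟨_, rfl, h0, rfl⟩)
    · exact h
    · simp [h0]
  · intro h
    rcases Nat.eq_zero_or_pos (v c) with h0 | h0
    · right; exact ⟨c, rfl, h0, by rw [h]; simp [h0]⟩
    · left; exact ⟨h0, h⟩

theorem LazyObtains.transf_iff {f : C → Finset C} {hf} {v v' : Valuation C} :
    LazyObtains (.transf f hf) v v' ↔ ∃ K : C → C → ℕ,
      (∀ c, v c = ∑ c' ∈ f c, K c c') ∧ (∀ c', v' c' = ∑ c : C with c' ∈ f c, K c c') := by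
  simp [LazyObtains, Instr.Obtains]

/-- Smaller valuations can follow larger ones. -/
theorem LazyObtains.mono {l : Instr C} {v v' w : Valuation C} (h : LazyObtains l v v')
    (hw : w ≤ v) : ∃ w', w' ≤ v' ∧ LazyObtains l w w' := by
  cases l with
  | inc c =>
    rw [LazyObtains.inc_iff] at h
    refine ⟨_, ?_, LazyObtains.inc_iff.2 rfl⟩
    intro d
    have : w d ≤ v d := hw d
    by_cases hd : d = c
    · subst hd; simp [h, this]
    · simp [h, hd, this]
  | dec c =>
    rw [LazyObtains.dec_iff] at h
    refine ⟨_, ?_, LazyObtains.dec_iff.2 rfl⟩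
    intro d
    have : w d ≤ v d := hw d
    by_cases hd : d = c
    · subst hd; simp only [h, Function.update_self]; omega
    · simp [h, hd, this]
  | transf f hf =>
    obtain ⟨K, hK, hK'⟩ := LazyObtains.transf_iff.1 h
    have : ∀ c, ∃ K' : C → ℕ, (∀ c', K' c' ≤ K c c') ∧ w c = ∑ c' ∈ f c, K' c' :=
      fun c => exists_le_sum_eq _ _ _ ((hw c).trans (hK c).le)
    choose K' h1 h2 using this
    refine ⟨fun c' => ∑ c : C with c' ∈ f c, K' c c', fun c' => ?_,
      LazyObtains.transf_iff.2 ⟨K', h2, fun _ => rfl⟩⟩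
    rw [hK']
    exact Finset.sum_le_sum fun c _ => h1 c c'

/-- The part of a valuation outside the covered set follows a transition in such a way that all
valuations below it can follow as well, and that only one token can appear on counters which do
not continue trajectories from a given set `T` of counters. -/
theorem exists_outside_step {l : Instr C} {v v' w : Valuation C} {Y Y' : Finset X}
    (h : LazyObtains l v v') (hw : w ≤ v) (hY : ∀ c : C, c.1 ⊆ Y → w c = 0)
    (hs : CoverStep l Y Y') :
    ∃ w', w' ≤ v' ∧ (∀ c : C, c.1 ⊆ Y' → w' c = 0) ∧
      (∀ r, LeOutside Y w r → ∃ r', LeOutside Y' w' r' ∧ LazyObtains l r r') ∧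
      (∀ T T' : C → Prop, (∀ c c', T c → TokenStep l c c' → ¬ c'.1 ⊆ Y' → T' c') →
        ∀ [DecidablePred T] [DecidablePred T'],
          ∑ c with ¬ T' c, w' c ≤ (∑ c with ¬ T c, w c) + 1) := by
  -- Increments and decrements move no token, so in both cases the count grows at most by one token
  -- on `c₀`.
  have key : ∀ (T T' : C → Prop) (w' : Valuation C) [DecidablePred T] [DecidablePred T']
      (c₀ : C), (∀ c, T c → ¬ c.1 ⊆ Y → T' c) → (∀ c : C, c.1 ⊆ Y → w' c = 0) →
      (∀ c, w' c ≤ w c + if c = c₀ then 1 else 0) →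
      ∑ c with ¬ T' c, w' c ≤ (∑ c with ¬ T c, w c) + 1 := by
    intro T T' w' _ _ c₀ hT h0 hle
    calc ∑ c with ¬ T' c, w' c ≤ ∑ c with ¬ T c, w' c := by
          simp only [Finset.sum_filter]
          refine Finset.sum_le_sum fun c _ => ?_
          by_cases hc : c.1 ⊆ Y
          · simp [h0 c hc]
          · by_cases hTc : T c
            · simp [hTc, hT c hTc hc]
            · simp only [hTc, not_false_eq_true, if_true]; split_ifs <;> omega
      _ ≤ ∑ c with ¬ T c, (w c + if c = c₀ then 1 else 0) := Finset.sum_le_sum fun c _ => hle c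
      _ ≤ _ := by
          rw [Finset.sum_add_distrib]
          gcongr
          rw [Finset.sum_ite_eq']
          split_ifs <;> omega
  cases l with
  | inc c₀ =>
    obtain rfl : Y' = Y := hs
    rw [LazyObtains.inc_iff] at h
    refine ⟨fun c => if c.1 ⊆ Y' then 0 else w c + if c = c₀ then 1 else 0, fun c => ?_,
      fun c hc => by simp [hc], fun r hr => ⟨_, fun c hc => ?_, LazyObtains.inc_iff.2 rfl⟩, ?_⟩
    · have : w c ≤ v c := hw c
      by_cases hc : c = c₀
      · subst hc; simp only [h, Function.update_self]; split_ifs <;> omega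
      · simp only [h, hc, if_false]; rw [Function.update_of_ne hc]; split_ifs <;> omega
    · have := hr c hc
      by_cases hcc : c = c₀
      · subst hcc; simp [hc, this]
      · simp [hc, hcc, this]
    · intro T T' hT _ _
      refine key T T' _ c₀ (fun c h1 h2 => hT c c h1 rfl h2) (fun c hc => by simp [hc])
        fun c => ?_
      split_ifs <;> omega
  | dec c₀ =>
    obtain rfl : Y' = Y := hs
    rw [LazyObtains.dec_iff] at h
    refine ⟨fun c => w c - if c = c₀ then 1 else 0, fun c => ?_,
      fun c hc => by simp [hY c hc], fun r hr => ⟨_, fun c hc => ?_, LazyObtains.dec_iff.2 rfl⟩, ?_⟩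
    · have : w c ≤ v c := hw c
      by_cases hc : c = c₀
      · subst hc; simp only [h, Function.update_self, if_true]; omega
      · simp only [h, hc, if_false]; rw [Function.update_of_ne hc]; omega
    · have := hr c hc
      by_cases hcc : c = c₀
      · subst hcc; simp only [Function.update_self, if_true]; omega
      · simp [hcc, this]
    · intro T T' hT _ _
      refine key T T' _ c₀ (fun c h1 h2 => hT c c h1 rfl h2) (fun c hc => by simp [hY c hc])
        fun c => ?_
      split_ifs <;> omega
  | transf f hf =>
    obtain ⟨K, hK, hK'⟩ := LazyObtains.transf_iff.1 h
    have h1 : ∀ c, ∃ K' : C → ℕ, (∀ c', K' c' ≤ K c c') ∧ w c = ∑ c' ∈ f c, K' c' :=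
      fun c => exists_le_sum_eq _ _ _ ((hw c).trans (hK c).le)
    -- `κ` is the matrix of the run thinned to `w`; below, the entries that lead into `Y'` are
    -- dropped as well.
    choose κ hκ hκw using h1
    refine ⟨fun c' => if c'.1 ⊆ Y' then 0 else ∑ c : C with c' ∈ f c, κ c c', fun c' => ?_,
      fun c hc => by simp [hc], fun r hr => ?_, ?_⟩
    · rw [hK']
      dsimp only
      split_ifs
      · exact Nat.zero_le _
      · exact Finset.sum_le_sum fun c _ => hκ c c'
    · have h2 : ∀ c, ∃ ρ : C → ℕ, r c = ∑ c' ∈ f c, ρ c' ∧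
          ∀ c' : C, ¬ c'.1 ⊆ Y' → ρ c' ≤ κ c c' := by
        intro c
        -- Row `c` of the matrix for `r`: a covered counter sends everything, however much, to one
        -- counter inside `Y'`; any other row is a thinning of `κ`, as `r c ≤ w c`.
        by_cases hc : c.1 ⊆ Y
        · obtain ⟨d, hd, hdY⟩ := hs c hc
          refine ⟨fun c' => if c' = d then r c else 0, ?_, fun c' hc' => ?_⟩
          · rw [Finset.sum_ite_eq' (f c) d]; simp [hd]
          · have : c' ≠ d := by rintro rfl; exact hc' hdY
            simp [this]
        · obtain ⟨ρ, hρ, hsum⟩ := exists_le_sum_eq (f c) (κ c) (r c) ((hr c hc).trans (hκw c).le)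
          exact ⟨ρ, hsum, fun c' _ => hρ c'⟩
      choose ρ hρ hρκ using h2
      refine ⟨_, fun c' hc' => ?_, LazyObtains.transf_iff.2 ⟨ρ, hρ, fun _ => rfl⟩⟩
      simp only [hc', if_false]
      exact Finset.sum_le_sum fun c _ => hρκ c c' hc'
    · intro T T' hT _ _
      refine le_trans ?_ (Nat.le_succ _)
      calc ∑ c' with ¬ T' c', (if c'.1 ⊆ Y' then 0 else ∑ c : C with c' ∈ f c, κ c c')
          ≤ ∑ c' : C, ∑ c with ¬ T c, if c' ∈ f c then κ c c' else 0 := by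
            rw [Finset.sum_filter]
            refine Finset.sum_le_sum fun c' _ => ?_
            by_cases hT' : T' c'
            · simp [hT']
            by_cases hc' : c'.1 ⊆ Y'
            · simp [hc']
            simp only [hT', hc', not_false_eq_true, if_true, if_false, Finset.sum_filter]
            refine Finset.sum_le_sum fun c _ => ?_
            by_cases hTc : T c
            · have : c' ∉ f c := fun hh => hT' (hT c c' hTc hh hc')
              simp [this]
            · simp [hTc]
        _ = ∑ c with ¬ T c, w c := by
            rw [Finset.sum_comm]
            refine Finset.sum_congr rfl fun c _ => ?_
            rw [hκw c, ← Finset.sum_filter, Finset.filter_univ_mem]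

end Flow

end IPCANT


namespace SafetyIPCANT

open IPCANT

/-! ### Pumping long lazy runs -/

section Pumping

variable {A Q X : Type*} [DecidableEq X] {M : SafetyIPCANT A Q X}

theorem lazyStep_iff {w : Option A} {l : Instr M.counters} {s s' : M.Config} :
    M.LazyStep w l s s' ↔
      (⟨s.1, w, l, s'.1⟩ : Trans A Q M.counters) ∈ M.trans ∧ LazyObtains l s.2 s'.2 := by
  unfold LazyStep ExactStep LazyObtains
  tauto

variable (M) in
/-- There is an infinite sequence of lazy transitions from `s₀`. -/
def InfiniteLazyFrom (s₀ : M.Config) : Prop :=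
  ∃ s : ℕ → M.Config, s 0 = s₀ ∧ ∀ j, ∃ w l, M.LazyStep w l (s j) (s (j + 1))

theorem InfiniteLazyFrom.of_invariant (P : M.Config → Prop) {s₀ : M.Config} (h₀ : P s₀)
    (h : ∀ s, P s → ∃ s', P s' ∧ ∃ w l, M.LazyStep w l s s') : M.InfiniteLazyFrom s₀ := by
  choose! g hg using h
  have hP : ∀ j, P (g^[j] s₀) := by
    intro j
    induction j with
    | zero => exact h₀
    | succ j ih => rw [Function.iterate_succ_apply']; exact (hg _ ih).1
  exact ⟨fun j => g^[j] s₀, rfl, fun j => by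
    simp only [Function.iterate_succ_apply']; exact (hg _ (hP j)).2⟩

theorem InfiniteLazyFrom.cons {s s' : M.Config} {w l} (h : M.LazyStep w l s s')
    (h' : M.InfiniteLazyFrom s') : M.InfiniteLazyFrom s := by
  obtain ⟨t, ht, hstep⟩ := h'
  refine ⟨fun j => Nat.casesOn j s t, rfl, fun j => ?_⟩
  cases j with
  | zero => exact ⟨w, l, by subst ht; exact h⟩
  | succ j => exact hstep j

theorem InfiniteLazyFrom.of_prefix {s : ℕ → M.Config} {N : ℕ}
    (h : ∀ j < N, ∃ w l, M.LazyStep w l (s j) (s (j + 1))) (a : ℕ) (ha : a ≤ N)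
    (h' : M.InfiniteLazyFrom (s a)) : M.InfiniteLazyFrom (s 0) := by
  induction a with
  | zero => exact h'
  | succ a ih =>
    obtain ⟨w, l, hw⟩ := h a (by omega)
    exact ih (by omega) (h'.cons hw)

/-- The invariant is indexed by a time below `j`; on reaching `j` the time is reset to `i`, which
`hP` permits. -/
theorem InfiniteLazyFrom.of_loop (P : ℕ → M.Config → Prop) {N i j : ℕ} {s₀ : M.Config}
    (h₀ : P 0 s₀) (h : ∀ t < N, ∀ s, P t s → ∃ s', P (t + 1) s' ∧ ∃ w l, M.LazyStep w l s s')
    (hij : i < j) (hj : j ≤ N) (hP : ∀ s, P j s → P i s) : M.InfiniteLazyFrom s₀ := by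
  refine InfiniteLazyFrom.of_invariant (fun s => ∃ t < j, P t s) ⟨0, by omega, h₀⟩ ?_
  rintro s ⟨t, ht, hs⟩
  obtain ⟨s', hs', hstep⟩ := h t (by omega) s hs
  rcases Nat.lt_or_ge (t + 1) j with h1 | h1
  · exact ⟨s', ⟨t + 1, h1, hs'⟩, hstep⟩
  · obtain rfl : j = t + 1 := by omega
    exact ⟨s', ⟨i, hij, hP _ hs'⟩, hstep⟩

/-- `Y` is a union of counters. -/
def IsUnionOf (C : Finset (Finset X)) (Y : Finset X) : Prop :=
  ∀ x ∈ Y, ∃ c ∈ C, x ∈ c ∧ c ⊆ Y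

variable {s : ℕ → M.Config} {w : ℕ → Option A} {l : ℕ → Instr M.counters} {N : ℕ}
  {Y : ℕ → Finset X}

/-- A token can move along the run from time `a` to the counter `c` at time `t` without ever
entering the covered sets. -/
def OutsidePath {A Q X : Type*} {M : SafetyIPCANT A Q X} (l : ℕ → Instr M.counters) (Y : ℕ → Finset X) (a t : ℕ) (c : M.counters) : Prop :=
  ∃ d : ℕ → M.counters, d t = c ∧ (∀ j, a ≤ j → j ≤ t → ¬ (d j).1 ⊆ Y j) ∧
    ∀ j, a ≤ j → j < t → TokenStep (l j) (d j) (d (j + 1))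

theorem OutsidePath.succ {A Q X : Type*} {M : SafetyIPCANT A Q X} {l : ℕ → Instr M.counters}
    {Y : ℕ → Finset X} {a t : ℕ} {c c' : M.counters} (h : OutsidePath l Y a t c) (ha : a ≤ t)
    (hc : TokenStep (l t) c c') (hY : ¬ c'.1 ⊆ Y (t + 1)) : OutsidePath l Y a (t + 1) c' := by
  obtain ⟨d, rfl, h1, h2⟩ := h
  refine ⟨fun j => if j = t + 1 then c' else d j, by simp, fun j hj hj' => ?_, fun j hj hj' => ?_⟩
  · by_cases h : j = t + 1
    · subst h; simpa using hY
    · simp only [h, if_false]; exact h1 j hj (by omega)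
  · rcases Nat.lt_or_ge j t with h | h
    · have e1 : j ≠ t + 1 := by omega
      have e2 : j + 1 ≠ t + 1 := by omega
      simp only [e1, e2, if_false]
      exact h2 j hj h
    · obtain rfl : j = t := by omega
      simpa using hc

/-- The parts of the valuations outside the covered sets along a run. -/
theorem exists_outside_valuations (hrun : ∀ j < N, M.LazyStep (w j) (l j) (s j) (s (j + 1)))
    (hstep : ∀ j < N, CoverStep (l j) (Y j) (Y (j + 1))) :
    ∃ v : ℕ → Valuation M.counters, LeOutside (Y 0) (v 0) (s 0).2 ∧
      (∀ j < N, ∀ r, LeOutside (Y j) (v j) r →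
        ∃ r', LeOutside (Y (j + 1)) (v (j + 1)) r' ∧ LazyObtains (l j) r r') ∧
      (∀ a t, a ≤ t → t ≤ N → (∀ c, ¬ OutsidePath l Y a t c) → ∑ c, v t c ≤ t - a) := by
  classical
  -- One step as a total function of `j` and `v`, so that the sequence can be defined by recursion;
  -- where the premises fail its value is irrelevant.
  have hex : ∀ (j : ℕ) (v : Valuation M.counters), ∃ v' : Valuation M.counters,
      j < N → v ≤ (s j).2 → (∀ c : M.counters, c.1 ⊆ Y j → v c = 0) →
      v' ≤ (s (j + 1)).2 ∧ (∀ c : M.counters, c.1 ⊆ Y (j + 1) → v' c = 0) ∧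
      (∀ r, LeOutside (Y j) v r → ∃ r', LeOutside (Y (j + 1)) v' r' ∧ LazyObtains (l j) r r') ∧
      (∀ T T' : M.counters → Prop,
        (∀ c c', T c → TokenStep (l j) c c' → ¬ c'.1 ⊆ Y (j + 1) → T' c') →
        ∑ c with ¬ T' c, v' c ≤ (∑ c with ¬ T c, v c) + 1) := by
    intro j v
    by_cases h : j < N ∧ v ≤ (s j).2 ∧ ∀ c : M.counters, c.1 ⊆ Y j → v c = 0
    · obtain ⟨v', h1, h2, h3, h4⟩ := exists_outside_step (lazyStep_iff.1 (hrun j h.1)).2 h.2.1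
        h.2.2 (hstep j h.1)
      exact ⟨v', fun _ _ _ => ⟨h1, h2, h3, fun T T' hT => h4 T T' hT⟩⟩
    · exact ⟨v, fun h1 h2 h3 => absurd ⟨h1, h2, h3⟩ h⟩
  choose g hg using hex
  let v : ℕ → Valuation M.counters := fun j =>
    Nat.rec (fun c => if c.1 ⊆ Y 0 then 0 else (s 0).2 c) (fun j v => g j v) j
  have hv : ∀ j ≤ N, v j ≤ (s j).2 ∧ ∀ c : M.counters, c.1 ⊆ Y j → v j c = 0 := by
    intro j
    induction j with
    | zero =>
      refine fun _ => ⟨fun c => ?_, fun c hc => by simp [v, hc]⟩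
      change (if c.1 ⊆ Y 0 then 0 else (s 0).2 c) ≤ (s 0).2 c
      split_ifs <;> simp
    | succ j ih =>
      intro hj
      have := ih (by omega)
      have := hg j (v j) (by omega) this.1 this.2
      exact ⟨this.1, this.2.1⟩
  have hv' : ∀ j < N, _ := fun j hj =>
    (hg j (v j) hj (hv j hj.le).1 (hv j hj.le).2).2.2
  refine ⟨v, fun c hc => by simp [v, hc], fun j hj => (hv' j hj).1, fun a t hat htN hno => ?_⟩
  -- The token count is applied with `T` the set of counters reachable outside the cover since time
  -- `a`. It is `0` at time `a`, where every uncovered counter is trivially reachable, and grows at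
  -- most by one per step.
  have hcount : ∀ t, a ≤ t → t ≤ N → ∑ c with ¬ OutsidePath l Y a t c, v t c ≤ t - a := by
    intro t hat
    induction t, hat using Nat.le_induction with
    | base =>
      intro ha
      rw [Finset.sum_eq_zero]
      · exact Nat.zero_le _
      intro c hc
      refine (hv a ha).2 c ?_
      by_contra hcY
      refine (Finset.mem_filter.1 hc).2 ⟨fun _ => c, rfl, fun j h1 h2 => ?_, fun j h1 h2 => ?_⟩
      · obtain rfl : j = a := by omega
        exact hcY
      · omega
    | succ t hat ih =>
      intro ht
      have h1 := (hv' t (by omega)).2 (OutsidePath l Y a t) (OutsidePath l Y a (t + 1))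
        (fun c c' h h' h'' => h.succ hat h' h'')
      have h2 := ih (by omega)
      have h3 : v (t + 1) = g t (v t) := rfl
      rw [h3]
      omega
  have := hcount t hat htN
  rwa [Finset.filter_true_of_mem (fun c _ => hno c)] at this

/-- A length after which a run with covered sets that leave out at most `i` of the basis elements
can be pumped, for `q` states and `k` counters. -/
def pumpLength (q k : ℕ) : ℕ → ℕ
  | 0 => q
  | i + 1 => pumpLength q k i + q * (pumpLength q k i + 2) ^ k

theorem isUnionOf_union {C : Finset (Finset X)} {Y : Finset X} (h : IsUnionOf C Y) {c : Finset X}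
    (hc : c ∈ C) : IsUnionOf C (Y ∪ c) := by
  intro x hx
  rcases Finset.mem_union.1 hx with hx | hx
  · obtain ⟨d, hd, hxd, hdY⟩ := h x hx
    exact ⟨d, hd, hxd, hdY.trans Finset.subset_union_left⟩
  · exact ⟨c, hc, hx, Finset.subset_union_right⟩

/-- Distributivity: a covered set together with a token can be carried along a transition. -/
theorem coverStep_union {C : Finset (Finset X)} {l : Instr C} {Y Y' : Finset X} {d d' : C}
    (h : CoverStep l Y Y') (hY : IsUnionOf C Y) (hd : TokenStep l d d') :
    CoverStep l (Y ∪ d.1) (Y' ∪ d'.1) := by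
  cases l with
  | inc c => obtain rfl : Y' = Y := h; obtain rfl : d' = d := hd; rfl
  | dec c => obtain rfl : Y' = Y := h; obtain rfl : d' = d := hd; rfl
  | transf f hf =>
    intro c hc
    -- Each point of `c` lies in a counter with an image inside `Y' ∪ d'`: either a covered counter,
    -- because `Y` is a union of counters, or `d` itself. Distributivity is applied to the family of
    -- these counters, one for each point of `c`.
    have hex : ∀ x : c.1, ∃ e e' : C, x.1 ∈ e.1 ∧ e' ∈ f e ∧ e'.1 ⊆ Y' ∪ d'.1 := by
      rintro ⟨x, hx⟩
      rcases Finset.mem_union.1 (hc hx) with hxY | hxd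
      · obtain ⟨e, he, hxe, heY⟩ := hY x hxY
        obtain ⟨e', he', heY'⟩ := h ⟨e, he⟩ heY
        exact ⟨⟨e, he⟩, e', hxe, he', heY'.trans Finset.subset_union_left⟩
      · exact ⟨d, d', hxd, hd, Finset.subset_union_right⟩
    choose e e' h1 h2 h3 using hex
    obtain ⟨c', hc', hsub⟩ := hf c c.1.card (fun i => e (c.1.equivFin.symm i))
      (fun i => e' (c.1.equivFin.symm i))
      (fun x hx => ⟨c.1.equivFin ⟨x, hx⟩, by simpa using h1 ⟨x, hx⟩⟩) (fun i => h2 _)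
    refine ⟨c', hc', fun x hx => ?_⟩
    obtain ⟨i, hi⟩ := hsub x hx
    exact h3 _ hi

/-- What is uncovered at time `i` is uncovered at time `j` too, with no larger bound there, so
domination outside the cover at time `j` implies domination at time `i`. Covered counters never
enter the invariant. -/
theorem infiniteLazyFrom_of_repeat {v : ℕ → Valuation M.counters}
    (hrun : ∀ j < N, M.LazyStep (w j) (l j) (s j) (s (j + 1)))
    (h₀ : LeOutside (Y 0) (v 0) (s 0).2)
    (hsim : ∀ j < N, ∀ r, LeOutside (Y j) (v j) r →
        ∃ r', LeOutside (Y (j + 1)) (v (j + 1)) r' ∧ LazyObtains (l j) r r')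
    {i j : ℕ} (hij : i < j) (hj : j ≤ N) (hq : (s i).1 = (s j).1)
    (hY : ∀ c : M.counters, ¬ c.1 ⊆ Y i → ¬ c.1 ⊆ Y j ∧ v j c ≤ v i c) :
    M.InfiniteLazyFrom (s 0) := by
  refine InfiniteLazyFrom.of_loop (fun t r => r.1 = (s t).1 ∧ LeOutside (Y t) (v t) r.2)
    ⟨rfl, h₀⟩ ?_ hij hj ?_
  · rintro t ht ⟨q, r⟩ ⟨rfl, hr⟩
    obtain ⟨r', hr', hl⟩ := hsim t ht r hr
    exact ⟨((s (t + 1)).1, r'), ⟨rfl, hr'⟩, w t, l t,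
      lazyStep_iff.2 ⟨(lazyStep_iff.1 (hrun t ht)).1, hl⟩⟩
  · rintro ⟨q, r⟩ ⟨rfl, hr⟩
    exact ⟨hq.symm, fun c hc => (hr c (hY c hc).1).trans (hY c hc).2⟩

/-- Induction on the number `i` of basis elements that the cover may miss. A long-lived uncovered
token enlarges the cover on a window of the run; without such tokens the uncovered values are
bounded, and some combination of them with a state repeats. -/
theorem infiniteLazyFrom_of_cover [Fintype Q] [Fintype X] (i : ℕ) :
    ∀ (s : ℕ → M.Config) (w : ℕ → Option A) (l : ℕ → Instr M.counters) (N : ℕ)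
      (Y : ℕ → Finset X), (∀ j < N, M.LazyStep (w j) (l j) (s j) (s (j + 1))) →
      (∀ j ≤ N, IsUnionOf M.counters (Y j)) →
      (∀ j < N, CoverStep (l j) (Y j) (Y (j + 1))) →
      (∀ j ≤ N, Fintype.card X ≤ (Y j).card + i) →
      pumpLength (Fintype.card Q) M.counters.card i ≤ N → M.InfiniteLazyFrom (s 0) := by
  induction i with
  | zero =>
    intro s w l N Y hrun _ hstep hcard hN
    obtain ⟨v, h₀, hsim, -⟩ := exists_outside_valuations hrun hstep
    obtain ⟨a, b, hab, hq⟩ := Fintype.exists_ne_map_eq_of_card_lt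
      (fun t : Fin (Fintype.card Q + 1) => (s t).1) (by simp)
    wlog h : a < b generalizing a b
    · exact this b a hab.symm hq.symm (lt_of_le_of_ne (not_lt.1 h) hab.symm)
    have hN' : Fintype.card Q ≤ N := hN
    have hb := b.2
    refine infiniteLazyFrom_of_repeat hrun h₀ hsim h (by omega) hq fun c hc => ?_
    -- Everything is covered at time `a`, so equality of the states is enough.
    have : Y a = Finset.univ :=
      Finset.eq_univ_of_card _ (le_antisymm (Finset.card_le_univ _) (by
        have h1 : (a : ℕ) < b := h
        simpa using hcard a (by omega)))
    exact absurd (this ▸ Finset.subset_univ _) hc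
  | succ i ih =>
    intro s w l N Y hrun hU hstep hcard hN
    set L := pumpLength (Fintype.card Q) M.counters.card i with hL
    have hN' : L + Fintype.card Q * (L + 2) ^ M.counters.card ≤ N := hN
    -- The alternative: a token can stay uncovered for `L` steps up to some time `t`, or none can.
    by_cases hpath : ∃ t c, L ≤ t ∧ t ≤ N ∧ OutsidePath l Y (t - L) t c
    · obtain ⟨t, c, hLt, htN, d, -, hd, hd'⟩ := hpath
      refine InfiniteLazyFrom.of_prefix (fun j hj => ⟨_, _, hrun j hj⟩) (t - L) (by omega) ?_
      refine ih (fun j => s (t - L + j)) (fun j => w (t - L + j)) (fun j => l (t - L + j)) L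
        (fun j => Y (t - L + j) ∪ (d (t - L + j)).1) (fun j hj => hrun _ (by omega))
        (fun j hj => isUnionOf_union (hU _ (by omega)) (d _).2) (fun j hj => ?_) (fun j hj => ?_)
        le_rfl
      · exact coverStep_union (hstep (t - L + j) (by omega)) (hU _ (by omega)) (hd' _ (by omega) (by omega))
      · have h1 := hcard (t - L + j) (by omega)
        -- The path avoids the cover, so its counter contributes a new basis element.
        have h2 : (Y (t - L + j)).card < (Y (t - L + j) ∪ (d (t - L + j)).1).card := by
          refine Finset.card_lt_card ⟨Finset.subset_union_left, fun h => ?_⟩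
          exact hd (t - L + j) (by omega) (by omega) (Finset.subset_union_right.trans h)
        omega
    · push Not at hpath
      obtain ⟨v, h₀, hsim, hsum⟩ := exists_outside_valuations hrun hstep
      have hle : ∀ t, L ≤ t → t ≤ N → ∀ c, v t c ≤ L := by
        intro t h1 h2 c
        have h3 := hsum (t - L) t (by omega) h2 (fun c => hpath t c h1 h2)
        have h4 := Finset.single_le_sum (f := v t) (fun c _ => Nat.zero_le _) (Finset.mem_univ c)
        omega
      -- The values `0, …, L` and an extra one for covered counters make `L + 2`. The times from `L`
      -- to `L + q * (L + 2) ^ k` are one more than there are codes.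
      let code : Fin (Fintype.card Q * (L + 2) ^ M.counters.card + 1) →
          Q × (M.counters → Fin (L + 2)) := fun t =>
        ((s (L + t)).1, fun c => if c.1 ⊆ Y (L + t) then Fin.last _ else
          Fin.ofNat (L + 2) (v (L + t) c))
      obtain ⟨a, b, hab, hq⟩ := Fintype.exists_ne_map_eq_of_card_lt code (by simp)
      wlog h : a < b generalizing a b
      · exact this b a hab.symm hq.symm (lt_of_le_of_ne (not_lt.1 h) hab.symm)
      have h' : (a : ℕ) < b := h
      have hb := b.2
      refine infiniteLazyFrom_of_repeat hrun h₀ hsim (i := L + a) (j := L + b) (by omega)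
        (by omega) (congrArg (fun p => p.1) hq) fun c hc => ?_
      have hcode := congrFun (congrArg Prod.snd hq) c
      have hva := hle (L + a) (by omega) (by omega) c
      have hvb := hle (L + b) (by omega) (by omega) c
      simp only [code, hc, if_false] at hcode
      have h2 := congrArg Fin.val hcode
      split_ifs at h2 with h3
      · simp only [Fin.val_ofNat, Fin.val_last] at h2
        rw [Nat.mod_eq_of_lt (by omega)] at h2
        omega
      · simp only [Fin.val_ofNat] at h2
        rw [Nat.mod_eq_of_lt (by omega), Nat.mod_eq_of_lt (by omega)] at h2
        exact ⟨h3, h2.ge⟩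

end Pumping

/-! ### Estimates for the length of the run -/

section Bounds

/-- Write `T = αᵢ Uᵢ ^ k`. The next such product is `2 (n - i) T (3 T) ^ k`, which dominates `L + q
(L + 2) ^ k` because `n - i ≥ 1` and `L + 2 ≤ 3 T`. The bound `q ≤ T` is carried along to absorb the
factor `q` and to keep `T` positive. -/
theorem pumpLength_le (q n k : ℕ) (hq : 0 < q) (i : ℕ) (hi : i ≤ n) :
    pumpLength q k i ≤ (bounds q n k i).1 * (bounds q n k i).2 ^ k ∧
      q ≤ (bounds q n k i).1 * (bounds q n k i).2 ^ k := by
  induction i with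
  | zero => simp [pumpLength, bounds]
  | succ i ih =>
    obtain ⟨h1, h2⟩ := ih (by omega)
    simp only [pumpLength, bounds]
    set L := pumpLength q k i
    set T := (bounds q n k i).1 * (bounds q n k i).2 ^ k with hT
    have e1 : 2 * (n - i) * (bounds q n k i).1 * (bounds q n k i).2 ^ k = 2 * (n - i) * T := by
      rw [hT]; ring
    have e2 : 3 * (bounds q n k i).1 * (bounds q n k i).2 ^ k = 3 * T := by
      rw [hT]; ring
    rw [e1, e2]
    have hpow : 1 ≤ (3 * T) ^ k := Nat.one_le_pow _ _ (by omega)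
    have hni : 2 ≤ 2 * (n - i) := by omega
    have h3 : 2 * T * (3 * T) ^ k ≤ 2 * (n - i) * T * (3 * T) ^ k := by gcongr
    have h4 : q * (L + 2) ^ k ≤ T * (3 * T) ^ k := by gcongr; omega
    have h5 : T ≤ T * (3 * T) ^ k := Nat.le_mul_of_pos_right _ hpow
    have h6 : 2 * T * (3 * T) ^ k = T * (3 * T) ^ k + T * (3 * T) ^ k := by ring
    constructor <;> omega

/-- In each round `3 T` is raised at most to the power `n + k + 1 ≤ 2 ^ (n + 1)`: the factor `2 (n -
i)` is at most `2 ^ n`, hence at most `(3 T) ^ n`. -/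
theorem three_mul_bounds_le (q n k : ℕ) (hq : 0 < q) (hk : k + 1 ≤ 2 ^ n) (i : ℕ) (hi : i ≤ n) :
    3 * ((bounds q n k i).1 * (bounds q n k i).2 ^ k) ≤ (3 * q) ^ (2 ^ (n + 1)) ^ i := by
  induction i with
  | zero => simp [bounds]
  | succ i ih =>
    have ih := ih (by omega)
    have hT := (pumpLength_le q n k hq i (by omega)).2
    simp only [bounds]
    set T := (bounds q n k i).1 * (bounds q n k i).2 ^ k with hT
    have e1 : 2 * (n - i) * (bounds q n k i).1 * (bounds q n k i).2 ^ k = 2 * (n - i) * T := by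
      rw [hT]; ring
    have e2 : 3 * (bounds q n k i).1 * (bounds q n k i).2 ^ k = 3 * T := by
      rw [hT]; ring
    rw [e1, e2]
    have h2n : 2 * n ≤ 2 ^ n := by
      have := Nat.lt_two_pow_self (n := n - 1)
      obtain ⟨m, rfl⟩ : ∃ m, n = m + 1 := ⟨n - 1, by omega⟩
      rw [pow_succ]
      simp only [Nat.add_sub_cancel] at this
      omega
    have hZ : 3 ≤ 3 * T := by omega
    calc 3 * (2 * (n - i) * T * (3 * T) ^ k) = 2 * (n - i) * (3 * T) ^ (k + 1) := by ring
      _ ≤ 2 ^ n * (3 * T) ^ (k + 1) := by gcongr; omega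
      _ ≤ (3 * T) ^ n * (3 * T) ^ (k + 1) := by gcongr; omega
      _ = (3 * T) ^ (n + (k + 1)) := (pow_add _ _ _).symm
      _ ≤ (3 * T) ^ (2 ^ (n + 1)) := by
          refine Nat.pow_le_pow_right (by omega) ?_
          have := Nat.lt_two_pow_self (n := n)
          rw [pow_succ]
          omega
      _ ≤ ((3 * q) ^ (2 ^ (n + 1)) ^ i) ^ (2 ^ (n + 1)) := by gcongr
      _ = _ := by rw [← pow_mul, ← pow_succ]

/-- The exponent reached is `(2 ^ (n + 1)) ^ n = 2 ^ (n² + n)`, which leaves room; strictness comes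
from `2 T < 3 T`. -/
theorem runBound_lt (q n k : ℕ) (hq : 0 < q) (hk : k + 1 ≤ 2 ^ n) :
    runBound q n k < (3 * q) ^ 2 ^ (2 * n ^ 2 + n) := by
  have h1 := three_mul_bounds_le q n k hq hk n le_rfl
  have h2 := (pumpLength_le q n k hq n le_rfl).2
  have h3 : (3 * q) ^ (2 ^ (n + 1)) ^ n ≤ (3 * q) ^ 2 ^ (2 * n ^ 2 + n) := by
    refine Nat.pow_le_pow_right (by omega) ?_
    rw [← pow_mul]
    refine Nat.pow_le_pow_right (by omega) ?_
    nlinarith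
  unfold runBound
  rw [mul_assoc]
  omega

end Bounds

/-! ### Lazy runs and acceptance -/

section Language

variable {A Q X : Type*} [DecidableEq X] {M : SafetyIPCANT A Q X}

theorem card_counters_lt {A Q X : Type*} (M : SafetyIPCANT A Q X) [Fintype X] :
    M.counters.card + 1 ≤ 2 ^ Fintype.card X := by
  have h : M.counters ⊂ Finset.univ := by
    refine Finset.ssubset_univ_iff.2 fun h => ?_
    exact Finset.not_nonempty_empty (M.counters_nonempty ∅ (h ▸ Finset.mem_univ _))
  have := Finset.card_lt_card h
  rwa [Finset.card_univ, Fintype.card_finset] at this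

/-- The cover is empty at all times. The run has `2 T - 1 ≥ T` steps, where `T ≥ 1` is at least the
pumping length for `i = n`. -/
theorem hasInfiniteLazyRun_of_hasLazyRun [Fintype Q] [Fintype X]
    (h : M.HasLazyRun (runBound (Fintype.card Q) (Fintype.card X) M.counters.card - 1)) :
    M.HasInfiniteLazyRun := by
  obtain ⟨s, hs, hrun⟩ := h
  have hq : 0 < Fintype.card Q := Fintype.card_pos_iff.2 ⟨M.init⟩
  have hlen := pumpLength_le (Fintype.card Q) (Fintype.card X) M.counters.card hq _ le_rfl
  have hrun' : ∀ j, ∃ w l, j < runBound (Fintype.card Q) (Fintype.card X) M.counters.card - 1 →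
      M.LazyStep w l (s j) (s (j + 1)) := by
    intro j
    by_cases hj : j < runBound (Fintype.card Q) (Fintype.card X) M.counters.card - 1
    · obtain ⟨w, l, h⟩ := hrun j hj
      exact ⟨w, l, fun _ => h⟩
    -- Beyond the run any label and instruction will do; its first step shows that some exist.
    · obtain ⟨w, l, h⟩ := hrun 0 (by unfold runBound; rw [mul_assoc]; omega)
      exact ⟨w, l, fun h => absurd h hj⟩
  choose w l hwl using hrun'
  have := infiniteLazyFrom_of_cover (Fintype.card X) s w l _ (fun _ => ∅) hwl
    (fun j _ x hx => absurd hx (Finset.notMem_empty x)) (fun j _ => ?_) (fun j _ => by simp)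
    (by unfold runBound; rw [mul_assoc]; omega)
  · obtain ⟨t, ht, h⟩ := this
    exact ⟨t, ht.trans hs, h⟩
  · cases l j with
    | inc c => rfl
    | dec c => rfl
    | transf f hf =>
      intro c hc
      have := M.counters_nonempty c.1 c.2
      rw [Finset.subset_empty.1 hc] at this
      exact absurd this Finset.not_nonempty_empty

/-- The error is an increment of the zero counter just before it is decremented. -/
theorem LazyStep.step {w : Option A} {l : Instr M.counters} {s s' : M.Config}
    (h : M.LazyStep w l s s') : M.Step w l s s' := by
  rcases h with h | ⟨h, c, rfl, h0, hs⟩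
  · exact ⟨s.2, s'.2, le_rfl, h, le_rfl⟩
  · refine ⟨Function.update s.2 c 1, s.2, ?_, ⟨h, ?_⟩, hs.ge⟩
    · intro d
      by_cases hd : d = c
      · subst hd; simp [h0]
      · simp [hd]
    · simp only [Instr.Obtains, Function.update_self, Function.update_idem,
        Nat.sub_self, zero_lt_one, true_and]
      rw [← h0, Function.update_eq_self]

/-- With finitely many letters the run would end in ε transitions only, and a repeated state among
them would close an ε cycle. -/
theorem nonempty_language_of_hasInfiniteLazyRun [Finite Q] (h : M.HasInfiniteLazyRun) :
    M.language.Nonempty := by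
  classical
  obtain ⟨s, hs, h⟩ := h
  choose w l hstep using h
  have hinf : {j | (w j).isSome}.Infinite := by
    rw [Set.infinite_iff_exists_gt]
    intro a
    by_contra! hcon
    have heps : ∀ j, w (a + 1 + j) = none := by
      intro j
      by_contra hne
      exact absurd (hcon (a + 1 + j) (Option.isSome_iff_ne_none.2 hne)) (by omega)
    obtain ⟨i, j, hij, hq⟩ := Finite.exists_ne_map_eq_of_infinite fun j => (s (a + 1 + j)).1
    wlog hlt : i < j generalizing i j
    · exact this j i hij.symm hq.symm (lt_of_le_of_ne (not_lt.1 hlt) hij.symm)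
    have hgen : ∀ k, i < k → Relation.TransGen (fun p p' => ∃ t ∈ M.trans, t.src = p ∧
        t.label = none ∧ t.tgt = p') (s (a + 1 + i)).1 (s (a + 1 + k)).1 := by
      have h1 : ∀ k, ∃ t ∈ M.trans, t.src = (s (a + 1 + k)).1 ∧ t.label = none ∧
          t.tgt = (s (a + 1 + (k + 1))).1 := fun k =>
        ⟨_, (lazyStep_iff.1 (hstep (a + 1 + k))).1, rfl, heps k, rfl⟩
      intro k hk
      induction k, hk using Nat.le_induction with
      | base => exact Relation.TransGen.single (h1 i)
      | succ k _ ih => exact ih.tail (h1 k)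
    have := hgen j hlt
    rw [← hq] at this
    exact M.no_eps_cycle _ this
  have hnth := Nat.nth_mem_of_infinite hinf
  refine ⟨fun i => (w (Nat.nth (fun j => (w j).isSome) i)).get (hnth i), s, w, l, hs,
    fun j => (hstep j).step, Nat.nth (fun j => (w j).isSome), Nat.nth_strictMono hinf,
    fun i => by simp, fun j hj => ?_⟩
  rw [Nat.range_nth_of_infinite hinf] at hj
  simpa using hj

theorem Step.exists_lazyStep {w : Option A} {l : Instr M.counters} {s s' r : M.Config}
    (h : M.Step w l s s') (hq : r.1 = s.1) (hr : r.2 ≤ s.2) :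
    ∃ r' : M.Config, r'.1 = s'.1 ∧ r'.2 ≤ s'.2 ∧ M.LazyStep w l r r' := by
  obtain ⟨u, u', h1, h2, h3⟩ := h
  obtain ⟨r', h4, h5⟩ := LazyObtains.mono (Or.inl h2.2) (hr.trans h1)
  exact ⟨(s'.1, r'), rfl, h4.trans h3, lazyStep_iff.2 ⟨hq ▸ h2.1, h5⟩⟩

/-- The lazy run takes the same transitions and is kept pointwise below the given run, whose errors
only increase counters. -/
theorem hasInfiniteLazyRun_of_nonempty_language (h : M.language.Nonempty) :
    M.HasInfiniteLazyRun := by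
  obtain ⟨a, s, w, l, hs, hstep, -⟩ := h
  have hex : ∀ (j : ℕ) (r : M.Config), ∃ r' : M.Config, r.1 = (s j).1 → r.2 ≤ (s j).2 →
      r'.1 = (s (j + 1)).1 ∧ r'.2 ≤ (s (j + 1)).2 ∧ M.LazyStep (w j) (l j) r r' := by
    intro j r
    by_cases h : r.1 = (s j).1 ∧ r.2 ≤ (s j).2
    · obtain ⟨r', h'⟩ := (hstep j).exists_lazyStep h.1 h.2
      exact ⟨r', fun _ _ => h'⟩
    · exact ⟨r, fun h1 h2 => absurd ⟨h1, h2⟩ h⟩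
  choose g hg using hex
  let r : ℕ → M.Config := fun j => Nat.rec (s 0) (fun j r => g j r) j
  have hr : ∀ j, (r j).1 = (s j).1 ∧ (r j).2 ≤ (s j).2 := by
    intro j
    induction j with
    | zero => exact ⟨rfl, le_rfl⟩
    | succ j ih => exact ⟨(hg j _ ih.1 ih.2).1, (hg j _ ih.1 ih.2).2.1⟩
  exact ⟨r, hs, fun j => ⟨w j, l j, (hg j _ (hr j).1 (hr j).2).2.2⟩⟩

/-- Every length from `runBound` on will do; bisection needs a power of two. -/
theorem nonempty_language_iff_hasLazyRun [Fintype Q] [Fintype X] {N : ℕ}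
    (hN : runBound (Fintype.card Q) (Fintype.card X) M.counters.card ≤ N) :
    M.language.Nonempty ↔ M.HasLazyRun N := by
  constructor
  · intro h
    obtain ⟨s, hs, h⟩ := hasInfiniteLazyRun_of_nonempty_language h
    exact ⟨s, hs, fun j _ => h j⟩
  · rintro ⟨s, hs, h⟩
    exact nonempty_language_of_hasInfiniteLazyRun
      (hasInfiniteLazyRun_of_hasLazyRun ⟨s, hs, fun j hj => h j (by omega)⟩)

end Language

end SafetyIPCANT


/-! ## Structured programs for Turing machines -/

namespace SpaceTM

/-- Structured programs over `T` work tapes with symbols in `Γ`. -/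
inductive Prog (I Γ : Type) (T : ℕ) where
  | act (f : InSym I → (Fin T → Γ) → Move × (Fin T → Γ × Move))
  | seq (p q : Prog I Γ T)
  | ite (b : InSym I → (Fin T → Γ) → Bool) (p q : Prog I Γ T)
  | loop (b : InSym I → (Fin T → Γ) → Bool) (p : Prog I Γ T)

/-- Contents of the tapes and positions of the heads. -/
@[ext] structure Mem (Γ : Type) (T : ℕ) where
  inHead : ℕ
  tape : Fin T → ℕ → Γ
  head : Fin T → ℕ

variable {I Γ : Type} {T : ℕ}

/-- The symbols under the work heads. -/
def Mem.syms (m : Mem Γ T) : Fin T → Γ := fun i => m.tape i (m.head i)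

/-- The effect of writing and moving on an input of length `n`. -/
def Mem.apply (n : ℕ) (m : Mem Γ T) (r : Move × (Fin T → Γ × Move)) : Mem Γ T where
  inHead := min (r.1.apply m.inHead) (n + 1)
  tape := fun i => Function.update (m.tape i) (m.head i) (r.2 i).1
  head := fun i => (r.2 i).2.apply (m.head i)

namespace Prog

/-- The control states of a program. -/
def St : Prog I Γ T → Type
  | act _ => Unit
  | seq p q => p.St ⊕ q.St
  | ite _ p q => Option (p.St ⊕ q.St)
  | loop _ p => Option p.St

theorem finite_St (p : Prog I Γ T) : Finite p.St := by
  induction p with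
  | act f => exact inferInstanceAs (Finite Unit)
  | seq p q hp hq => exact inferInstanceAs (Finite (p.St ⊕ q.St))
  | ite b p q hp hq => exact inferInstanceAs (Finite (Option (p.St ⊕ q.St)))
  | loop b p hp => exact inferInstanceAs (Finite (Option p.St))

/-- The control state in which a program starts. -/
def entry : (p : Prog I Γ T) → p.St
  | act _ => ()
  | seq p _ => Sum.inl p.entry
  | ite _ _ _ => none
  | loop _ _ => none

/-- The action that changes nothing. -/
def idle (g : Fin T → Γ) : Move × (Fin T → Γ × Move) := (.stay, fun i => (g i, .stay))

/-- One step of a program; the next control state `none` means that the program has ended. -/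
def next : (p : Prog I Γ T) → p.St → InSym I → (Fin T → Γ) →
    Option p.St × (Move × (Fin T → Γ × Move))
  | act f, _, i, g => (none, f i g)
  | seq p q, Sum.inl s, i, g =>
    (some (((p.next s i g).1.map Sum.inl).getD (Sum.inr q.entry)), (p.next s i g).2)
  | seq _ q, Sum.inr s, i, g => ((q.next s i g).1.map Sum.inr, (q.next s i g).2)
  | ite b p q, none, i, g =>
    (some (some (if b i g then Sum.inl p.entry else Sum.inr q.entry)), idle g)
  | ite _ p _, some (Sum.inl s), i, g =>
    ((p.next s i g).1.map (some ∘ Sum.inl), (p.next s i g).2)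
  | ite _ _ q, some (Sum.inr s), i, g =>
    ((q.next s i g).1.map (some ∘ Sum.inr), (q.next s i g).2)
  | loop b p, none, i, g => (if b i g then some (some p.entry) else none, idle g)
  | loop _ p, some s, i, g => (some (p.next s i g).1, (p.next s i g).2)

/-- The step of a program on input `x`. -/
def nextOn (p : Prog I Γ T) (x : List I) (s : p.St) (m : Mem Γ T) : Option p.St × Mem Γ T :=
  ((p.next s (readInput x m.inHead) m.syms).1,
    m.apply x.length (p.next s (readInput x m.inHead) m.syms).2)

/-- The program, started in the control state `s` and with memory `m`, ends with memory `m'`, and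
all heads stay on the leftmost `S` cells. -/
inductive Run (p : Prog I Γ T) (x : List I) (S : ℕ) : p.St → Mem Γ T → Mem Γ T → Prop
  | exit {s m m'} : p.nextOn x s m = (none, m') → (∀ i, m'.head i < S) → Run p x S s m m'
  | step {s m s' m₁ m'} : p.nextOn x s m = (some s', m₁) → (∀ i, m₁.head i < S) →
      Run p x S s' m₁ m' → Run p x S s m m'

/-- The program takes the memory `m` to `m'` on the leftmost `S` cells. -/
def Exec (p : Prog I Γ T) (x : List I) (S : ℕ) (m m' : Mem Γ T) : Prop := p.Run x S p.entry m m'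

variable {x : List I} {S : ℕ} {m m₁ m' : Mem Γ T}

theorem Exec.act {f : InSym I → (Fin T → Γ) → Move × (Fin T → Γ × Move)}
    (h : ∀ i, (m.apply x.length (f (readInput x m.inHead) m.syms)).head i < S) :
    (Prog.act f).Exec x S m (m.apply x.length (f (readInput x m.inHead) m.syms)) :=
  Run.exit rfl h

theorem Run.head_lt {p : Prog I Γ T} {s : p.St} (h : p.Run x S s m m') (i : Fin T) :
    m'.head i < S := by
  induction h with
  | exit _ h => exact h i
  | step _ _ _ ih => exact ih

theorem Run.seq_right {p q : Prog I Γ T} {s : q.St} (h : q.Run x S s m m') :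
    (Prog.seq p q).Run x S (Sum.inr s) m m' := by
  induction h with
  | exit h1 h2 => exact Run.exit (by simp_all [nextOn, next]; rfl) h2
  | @step s m s' m₁ m' h1 h2 _ ih =>
    exact Run.step (p := Prog.seq p q) (s' := Sum.inr s') (by simp_all [nextOn, next]; rfl) h2 ih

theorem Run.seq_left {p q : Prog I Γ T} {s : p.St} (h : p.Run x S s m m₁)
    (h' : q.Exec x S m₁ m') : (Prog.seq p q).Run x S (Sum.inl s) m m' := by
  induction h with
  | exit h1 h2 =>
    exact Run.step (p := Prog.seq p q) (s' := Sum.inr q.entry) (by simp_all [nextOn, next]) h2 (Run.seq_right h')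
  | @step s m s' m₁ m' h1 h2 _ ih =>
    exact Run.step (p := Prog.seq p q) (s' := Sum.inl s') (by simp_all [nextOn, next]) h2 (ih h')

theorem Exec.seq {p q : Prog I Γ T} (h : p.Exec x S m m₁) (h' : q.Exec x S m₁ m') :
    (Prog.seq p q).Exec x S m m' :=
  Run.seq_left h h'

/-- The hypothesis is needed because `Mem.apply` cuts the input position off at the right end
marker. -/
theorem apply_idle (m : Mem Γ T) (hm : m.inHead ≤ x.length + 1) :
    m.apply x.length (idle m.syms) = m := by
  ext i
  · simp [Mem.apply, idle, Move.apply, hm]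
  · simp [Mem.apply, idle, Mem.syms]
  · simp [Mem.apply, idle, Move.apply]

theorem Run.ite_inl {b : InSym I → (Fin T → Γ) → Bool} {p q : Prog I Γ T} {s : p.St}
    (h : p.Run x S s m m') : (Prog.ite b p q).Run x S (some (Sum.inl s)) m m' := by
  induction h with
  | exit h1 h2 => exact Run.exit (by simp_all [nextOn, next]) h2
  | @step s m s' m₁ m' h1 h2 _ ih =>
    exact Run.step (p := Prog.ite b p q) (s' := some (Sum.inl s')) (by simp_all [nextOn, next]; rfl) h2 ih

theorem Run.ite_inr {b : InSym I → (Fin T → Γ) → Bool} {p q : Prog I Γ T} {s : q.St}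
    (h : q.Run x S s m m') : (Prog.ite b p q).Run x S (some (Sum.inr s)) m m' := by
  induction h with
  | exit h1 h2 => exact Run.exit (by simp_all [nextOn, next]) h2
  | @step s m s' m₁ m' h1 h2 _ ih =>
    exact Run.step (p := Prog.ite b p q) (s' := some (Sum.inr s')) (by simp_all [nextOn, next]; rfl) h2 ih

theorem Exec.ite {b : InSym I → (Fin T → Γ) → Bool} {p q : Prog I Γ T}
    (hm : m.inHead ≤ x.length + 1) (hS : ∀ i, m.head i < S)
    (h : if b (readInput x m.inHead) m.syms then p.Exec x S m m' else q.Exec x S m m') :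
    (Prog.ite b p q).Exec x S m m' := by
  by_cases hb : b (readInput x m.inHead) m.syms
  · rw [if_pos hb] at h
    exact Run.step (p := Prog.ite b p q) (s' := some (Sum.inl p.entry)) (m₁ := m)
      (by simp [nextOn, entry, next, hb, apply_idle m hm]) hS (Run.ite_inl h)
  · rw [if_neg hb] at h
    exact Run.step (p := Prog.ite b p q) (s' := some (Sum.inr q.entry)) (m₁ := m)
      (by simp [nextOn, entry, next, hb, apply_idle m hm]) hS (Run.ite_inr h)

theorem Exec.loop_exit {b : InSym I → (Fin T → Γ) → Bool} {p : Prog I Γ T}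
    (hm : m.inHead ≤ x.length + 1) (hS : ∀ i, m.head i < S)
    (hb : b (readInput x m.inHead) m.syms = false) : (Prog.loop b p).Exec x S m m :=
  Run.exit (by simp [nextOn, entry, next, hb, apply_idle m hm]) hS

theorem Run.loop_body {b : InSym I → (Fin T → Γ) → Bool} {p : Prog I Γ T} {s : p.St}
    (h : p.Run x S s m m₁) (h' : (Prog.loop b p).Exec x S m₁ m') :
    (Prog.loop b p).Run x S (some s) m m' := by
  induction h with
  | exit h1 h2 => exact Run.step (p := Prog.loop b p) (s' := none) (by simp_all [nextOn, next]) h2 h'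
  | @step s m s' m₁ m' h1 h2 _ ih =>
    exact Run.step (p := Prog.loop b p) (s' := some s') (by simp_all [nextOn, next]) h2 (ih h')

theorem Exec.loop_step {b : InSym I → (Fin T → Γ) → Bool} {p : Prog I Γ T}
    (hm : m.inHead ≤ x.length + 1) (hS : ∀ i, m.head i < S)
    (hb : b (readInput x m.inHead) m.syms = true) (h : p.Exec x S m m₁)
    (h' : (Prog.loop b p).Exec x S m₁ m') : (Prog.loop b p).Exec x S m m' :=
  Run.step (p := Prog.loop b p) (s' := some p.entry) (m₁ := m)
    (by simp [nextOn, entry, next, hb, apply_idle m hm]) hS (Run.loop_body h h')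

/-- The machine that runs a program and then decides according to the symbols under its heads. -/
def toMachine [Finite Γ] (p : Prog I Γ T) (blank : Γ) (ver : (Fin T → Γ) → Bool) : Machine I where
  tapes := T
  Symbol := Γ
  State := Option p.St ⊕ Bool
  finite_symbol := inferInstance
  finite_state := have := p.finite_St; inferInstance
  blank := blank
  start := Sum.inl (some p.entry)
  verdict := Sum.elim (fun _ => none) some
  next := fun s i g => match s with
    | Sum.inl (some s) => (Sum.inl (p.next s i g).1, (p.next s i g).2)
    | Sum.inl none => (Sum.inr (ver g), idle g)
    | Sum.inr b => (Sum.inr b, idle g)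

/-- The initial memory. -/
def initMem (blank : Γ) : Mem Γ T := ⟨0, fun _ _ => blank, fun _ => 0⟩

variable [Finite Γ] {p : Prog I Γ T} {blank : Γ} {ver : (Fin T → Γ) → Bool}

/-- The configuration of the machine of a program. -/
def toConfig (s : Option p.St ⊕ Bool) (m : Mem Γ T) : (p.toMachine blank ver).Config :=
  ⟨s, m.inHead, m.tape, m.head⟩

theorem step_toConfig_some (s : p.St) (m : Mem Γ T) :
    (p.toMachine blank ver).step x (toConfig (Sum.inl (some s)) m) =
      toConfig (Sum.inl (p.nextOn x s m).1) (p.nextOn x s m).2 := rfl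

theorem step_toConfig_none (m : Mem Γ T) (hm : m.inHead ≤ x.length + 1) :
    (p.toMachine blank ver).step x (toConfig (Sum.inl none) m) =
      toConfig (Sum.inr (ver m.syms)) m :=
  congrArg (toConfig (p := p) (blank := blank) (ver := ver) (Sum.inr (ver m.syms)))
    (apply_idle m hm)

theorem step_toConfig_inr (b : Bool) (m : Mem Γ T) :
    (p.toMachine blank ver).step x (toConfig (Sum.inr b) m) = toConfig (Sum.inr b) m := rfl

theorem Run.exists_iterate {s : p.St} (h : p.Run x S s m m') :
    ∃ t, ((p.toMachine blank ver).step x)^[t] (toConfig (Sum.inl (some s)) m) =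
      toConfig (Sum.inl none) m' := by
  induction h with
  | exit h1 _ => exact ⟨1, by rw [Function.iterate_one, step_toConfig_some, h1]⟩
  | step h1 _ _ ih =>
    obtain ⟨t, ht⟩ := ih
    exact ⟨t + 1, by rw [Function.iterate_succ_apply, step_toConfig_some, h1, ht]⟩

theorem Exec.haltsWith (h : p.Exec x S (initMem blank) m') (hm : m'.inHead ≤ x.length + 1) :
    (p.toMachine blank ver).HaltsWith x (ver m'.syms) := by
  obtain ⟨t, ht⟩ := Run.exists_iterate (blank := blank) (ver := ver) h
  refine ⟨t + 1, ?_⟩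
  have : (p.toMachine blank ver).run x (t + 1) = toConfig (Sum.inr (ver m'.syms)) m' := by
    rw [Machine.run, Function.iterate_succ_apply', ← step_toConfig_none m' hm, ← ht]
    rfl
  rw [this]
  rfl

/-- `Run` records the space bound at every memory it passes, and the machine passes no others: after
the end of the program its heads stay in place. -/
theorem Exec.usesSpace (h : p.Exec x S (initMem blank) m') (hm : m'.inHead ≤ x.length + 1) :
    (p.toMachine blank ver).UsesSpace x S := by
  have hm' : ∀ i, m'.head i < S := h.head_lt
  have key : ∀ t, ∃ s m, (p.toMachine blank ver).run x t = toConfig s m ∧ (∀ i, m.head i < S) ∧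
      ((∃ s', s = Sum.inl (some s') ∧ p.Run x S s' m m') ∨ (s = Sum.inl none ∧ m = m') ∨
        (∃ b, s = Sum.inr b)) := by
    intro t
    induction t with
    | zero =>
      refine ⟨_, initMem blank, rfl, fun i => ?_, Or.inl ⟨_, rfl, h⟩⟩
      exact lt_of_le_of_lt (Nat.zero_le _) (hm' i)
    | succ t ih =>
      obtain ⟨s, m, h1, h2, h3⟩ := ih
      have h4 : (p.toMachine blank ver).run x (t + 1) =
          (p.toMachine blank ver).step x (toConfig s m) := by
        rw [← h1, Machine.run, Function.iterate_succ_apply']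
        rfl
      rw [h4]
      rcases h3 with ⟨s', rfl, hrun⟩ | ⟨rfl, rfl⟩ | ⟨b, rfl⟩
      · rw [step_toConfig_some]
        cases hrun with
        | exit h5 h6 => rw [h5]; exact ⟨_, _, rfl, h6, Or.inr (Or.inl ⟨rfl, rfl⟩)⟩
        | step h5 h6 h7 => rw [h5]; exact ⟨_, _, rfl, h6, Or.inl ⟨_, rfl, h7⟩⟩
      · rw [step_toConfig_none m hm]
        exact ⟨_, _, rfl, h2, Or.inr (Or.inr ⟨_, rfl⟩)⟩
      · rw [step_toConfig_inr]
        exact ⟨_, _, rfl, h2, Or.inr (Or.inr ⟨_, rfl⟩)⟩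
  intro t i
  obtain ⟨s, m, h1, h2, -⟩ := key t
  rw [h1]
  exact h2 i

end Prog

end SpaceTM


/-! ## Binary registers on work tapes -/

namespace SpaceTM

/-- Symbols of the work tapes: blank `none`, the marker `some none` of the leftmost cell, bits. -/
abbrev Cell : Type := Option (Option Bool)

/-- The tape with the marker in cell `0`, followed by `l` and then blanks. -/
def cells (l : List Cell) : ℕ → Cell
  | 0 => some none
  | j + 1 => l.getD j none

/-- The tape that holds a list of bits. -/
def bitTape (l : List Bool) : ℕ → Cell := cells (l.map (some ∘ some))

theorem cells_length_succ (pre : List Cell) (a : Cell) (l : List Cell) :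
    cells (pre ++ a :: l) (pre.length + 1) = a := by
  simp [cells]

theorem update_cells (pre : List Cell) (a b : Cell) (l : List Cell) :
    Function.update (cells (pre ++ a :: l)) (pre.length + 1) b = cells (pre ++ b :: l) := by
  funext j
  rcases j with _ | j
  · simp [cells]
  rcases lt_trichotomy j pre.length with h | rfl | h
  · rw [Function.update_of_ne (by omega)]
    simp [cells, List.getElem?_append_left h]
  · simp [cells]
  · rw [Function.update_of_ne (by omega)]
    obtain ⟨k, rfl⟩ : ∃ k, j = pre.length + (k + 1) := ⟨j - pre.length - 1, by omega⟩
    simp [cells, List.getElem?_append_right]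

theorem update_cells_nil (pre : List Cell) (b : Cell) :
    Function.update (cells pre) (pre.length + 1) b = cells (pre ++ [b]) := by
  funext j
  rcases j with _ | j
  · simp [cells]
  rcases lt_trichotomy j pre.length with h | rfl | h
  · rw [Function.update_of_ne (by omega)]
    simp [cells, List.getElem?_append_left h]
  · simp [cells]
  · rw [Function.update_of_ne (by omega)]
    obtain ⟨k, rfl⟩ : ∃ k, j = pre.length + (k + 1) := ⟨j - pre.length - 1, by omega⟩
    simp [cells]

/-- Trailing blanks are invisible, so an erased tape equals an empty register. -/
theorem cells_replicate_none (n : ℕ) : cells (List.replicate n none) = cells [] := by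
  funext j
  rcases j with _ | j
  · rfl
  · simp only [cells, List.getD_eq_getElem?_getD, List.getElem?_replicate]
    split_ifs <;> simp

theorem bitTape_succ (l : List Bool) (j : ℕ) : bitTape l (j + 1) = l[j]?.map some := by
  simp only [bitTape, cells, List.getD_eq_getElem?_getD, List.getElem?_map]
  cases l[j]? <;> rfl

theorem bitTape_succ_ne (l : List Bool) (j : ℕ) : bitTape l (j + 1) ≠ some none := by
  rw [bitTape_succ]
  cases l[j]? <;> simp

/-- Adding one to a binary number, the least significant bit first. -/
def incBits : List Bool → List Bool
  | [] => [true]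
  | false :: l => true :: l
  | true :: l => false :: incBits l

theorem bits_succ (k : ℕ) : (k + 1).bits = incBits k.bits := by
  induction k using Nat.binaryRec' with
  | zero => rfl
  | bit b n h ih =>
    rw [Nat.bits_append_bit n b h]
    cases b with
    | false =>
      have hn : n ≠ 0 := fun h0 => by simpa using h h0
      have : Nat.bit false n + 1 = Nat.bit true n := by simp [Nat.bit_val]
      rw [this, Nat.bits_append_bit n true (fun _ => rfl)]
      rfl
    | true =>
      have : Nat.bit true n + 1 = Nat.bit false (n + 1) := by simp [Nat.bit_val]; ring
      rw [this, Nat.bits_append_bit (n + 1) false (fun h => by omega), ih]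
      rfl

theorem bits_injective : Function.Injective Nat.bits := by
  intro a b h
  have h2 := congrArg (List.map fun b => cond b 1 0) h
  rw [← Nat.digits_two_eq_bits, ← Nat.digits_two_eq_bits] at h2
  exact Nat.digits_inj_iff.1 h2

namespace Prog

variable {I : Type} {T : ℕ}

/-- Replacing the contents and the head position of a tape. -/
def _root_.SpaceTM.Mem.set (m : Mem Cell T) (r : Fin T) (t : ℕ → Cell) (h : ℕ) : Mem Cell T :=
  ⟨m.inHead, Function.update m.tape r t, Function.update m.head r h⟩

/-- The input head and the work heads are where they may be. -/
structure Fits (x : List I) (S : ℕ) (m : Mem Cell T) : Prop where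
  inHead : m.inHead ≤ x.length + 1
  head : ∀ i, m.head i < S

variable {x : List I} {S : ℕ} {m : Mem Cell T} {r : Fin T} {t : ℕ → Cell} {h : ℕ}

theorem Fits.set (hm : Fits x S m) (hh : h < S) : Fits x S (m.set r t h) := by
  refine ⟨hm.1, fun i => ?_⟩
  by_cases hi : i = r
  · subst hi; simpa [Mem.set] using hh
  · simpa [Mem.set, hi] using hm.2 i

/-- An action on one tape. -/
def onTape (r : Fin T) (g : Cell → Cell × Move) : Prog I Cell T :=
  act fun _ s => (.stay, fun i => if i = r then g (s i) else (s i, .stay))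

theorem exec_onTape (hm : Fits x S m) (g : Cell → Cell × Move) (hg : (g (t h)).2.apply h < S) :
    (onTape r g).Exec x S (m.set r t h)
      (m.set r (Function.update t h (g (t h)).1) ((g (t h)).2.apply h)) := by
  have key : m.set r (Function.update t h (g (t h)).1) ((g (t h)).2.apply h) =
      (m.set r t h).apply x.length (.stay, fun i => if i = r then g ((m.set r t h).syms i)
        else ((m.set r t h).syms i, .stay)) := by
    have := hm.1
    ext i j
    · simp [Mem.set, Mem.apply, Move.apply, this]
    · by_cases hi : i = r
      · subst hi; simp [Mem.set, Mem.apply, Mem.syms]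
      · simp [Mem.set, Mem.apply, Mem.syms, hi]
    · by_cases hi : i = r
      · subst hi; simp [Mem.set, Mem.apply, Mem.syms]
      · simp [Mem.set, Mem.apply, hi, Move.apply]
  have hfit := hm.set (r := r) (t := Function.update t h (g (t h)).1) hg
  rw [key] at hfit ⊢
  exact Exec.act hfit.2

theorem syms_set : (m.set r t h).syms r = t h := by simp [Mem.set, Mem.syms]

/-- Moving the head of a tape back to the marker. -/
def rewind (r : Fin T) : Prog I Cell T :=
  loop (fun _ s => decide (s r ≠ some none)) (onTape r fun a => (a, .left))

/-- A head cannot sense that it is on cell `0`; the marker there, which occurs nowhere else, stops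
the loop. -/
theorem exec_rewind (hm : Fits x S m) (h0 : t 0 = some none) (h1 : ∀ j, t (j + 1) ≠ some none)
    (hh : h < S) : (rewind r).Exec x S (m.set r t h) (m.set r t 0) := by
  induction h with
  | zero => exact Exec.loop_exit (hm.set hh).1 (hm.set hh).2 (by simp [syms_set, h0])
  | succ h ih =>
    refine Exec.loop_step (hm.set hh).1 (hm.set hh).2 (by simp [syms_set, h1]) ?_
      (ih (by omega))
    have := exec_onTape (r := r) (t := t) (h := h + 1) hm (fun a => (a, Move.left))
      (by simp only [Move.apply]; omega)
    simpa [Move.apply] using this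

/-- Adding one to the number on a tape. -/
def incTape (r : Fin T) : Prog I Cell T :=
  seq (onTape r fun a => (a, .right))
    (seq (loop (fun _ s => decide (s r = some (some true)))
        (onTape r fun _ => (some (some false), .right)))
      (seq (onTape r fun _ => (some (some true), .stay)) (rewind r)))

/-- The cells `pre` have been passed already. The loop stops at the first cell that is not `true`,
which is a `false` or the blank behind the number; writing `true` there completes the addition. -/
theorem exec_carry (hm : Fits x S m) (l : List Bool) (pre : List Bool)
    (hl : pre.length + l.length + 1 < S) :
    ∃ t h, h < S ∧ Function.update t h (some (some true)) = bitTape (pre ++ incBits l) ∧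
      (loop (fun _ s => decide (s r = some (some true)))
        (onTape r fun _ => (some (some false), .right))).Exec x S
        (m.set r (bitTape (pre ++ l)) (pre.length + 1)) (m.set r t h) := by
  have hfit : Fits x S (m.set r (bitTape (pre ++ l)) (pre.length + 1)) := hm.set (by omega)
  induction l generalizing pre with
  | nil =>
    refine ⟨_, pre.length + 1, by omega, ?_, Exec.loop_exit hfit.1 hfit.2 ?_⟩
    · have := update_cells_nil (pre.map (some ∘ some)) (some (some true))
      simpa [bitTape, incBits] using this
    · simp [syms_set, bitTape_succ]
  | cons b l ih =>
    simp only [List.length_cons] at hl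
    cases b with
    | false =>
      refine ⟨_, pre.length + 1, by omega, ?_, Exec.loop_exit hfit.1 hfit.2 ?_⟩
      · have := update_cells (pre.map (some ∘ some)) (some (some false)) (some (some true))
          (l.map (some ∘ some))
        simpa [bitTape, incBits] using this
      · simp [syms_set, bitTape_succ]
    | true =>
      have hupd : Function.update (bitTape (pre ++ true :: l)) (pre.length + 1)
          (some (some false)) = bitTape ((pre ++ [false]) ++ l) := by
        have := update_cells (pre.map (some ∘ some)) (some (some true)) (some (some false))
          (l.map (some ∘ some))
        simpa [bitTape] using this
      have hact := exec_onTape (r := r) (t := bitTape (pre ++ true :: l)) (h := pre.length + 1) hm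
        (fun _ => (some (some false), Move.right)) (by simp only [Move.apply]; omega)
      rw [hupd] at hact
      obtain ⟨t, h, h1, h2, h3⟩ := ih (pre ++ [false]) (by simp; omega)
        (hm.set (by simp; omega))
      refine ⟨t, h, h1, by simpa [incBits] using h2,
        Exec.loop_step hfit.1 hfit.2 (by simp [syms_set, bitTape_succ]) hact ?_⟩
      simpa [Move.apply] using h3

theorem exec_incTape (hm : Fits x S m) (k : ℕ) (hk : k.size + 1 < S) :
    (incTape r).Exec x S (m.set r (bitTape k.bits) 0) (m.set r (bitTape (k + 1).bits) 0) := by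
  have h1 := exec_onTape (r := r) (t := bitTape k.bits) (h := 0) hm (fun a => (a, Move.right))
    (by simp only [Move.apply]; omega)
  simp only [Function.update_eq_self, Move.apply] at h1
  obtain ⟨t, h, hh, ht, h2⟩ := exec_carry (r := r) hm k.bits []
    (by rw [Nat.size_eq_bits_len]; simpa using hk)
  have h3 := exec_onTape (r := r) (t := t) (h := h) hm (fun _ => (some (some true), Move.stay)) hh
  rw [ht] at h3
  rw [bits_succ]
  exact Exec.seq h1 (Exec.seq h2 (Exec.seq h3 (exec_rewind hm rfl (bitTape_succ_ne _) hh)))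

/-- Erasing the number on a tape. -/
def clearTape (r : Fin T) : Prog I Cell T :=
  seq (onTape r fun a => (a, .right))
    (seq (loop (fun _ s => decide (s r ≠ none)) (onTape r fun _ => (none, .right))) (rewind r))

/-- The erased cells are kept as `n` explicit blanks in order to tie the list to the position of the
head. -/
theorem exec_erase (hm : Fits x S m) (l : List Bool) (n : ℕ) (hl : n + l.length + 1 < S) :
    ∃ h < S, (loop (fun _ s => decide (s r ≠ none)) (onTape r fun _ => (none, .right))).Exec x S
      (m.set r (cells (List.replicate n none ++ l.map (some ∘ some))) (n + 1))
      (m.set r (bitTape []) h) := by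
  have hfit : Fits x S (m.set r (cells (List.replicate n none ++ l.map (some ∘ some))) (n + 1)) :=
    hm.set (by omega)
  induction l generalizing n with
  | nil =>
    refine ⟨n + 1, by omega, ?_⟩
    have : cells (List.replicate n none ++ ([] : List Bool).map (some ∘ some)) = bitTape [] := by
      simpa [bitTape] using cells_replicate_none n
    rw [this] at hfit ⊢
    exact Exec.loop_exit hfit.1 hfit.2 (by simp [syms_set, bitTape_succ])
  | cons b l ih =>
    simp only [List.length_cons] at hl
    have hsym := cells_length_succ (List.replicate n none) (some (some b)) (l.map (some ∘ some))
    have hupd := update_cells (List.replicate n none) (some (some b)) none (l.map (some ∘ some))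
    simp only [List.length_replicate] at hsym hupd
    have hact := exec_onTape (r := r)
      (t := cells (List.replicate n none ++ some (some b) :: l.map (some ∘ some)))
      (h := n + 1) hm (fun _ => (none, Move.right)) (by simp only [Move.apply]; omega)
    rw [hupd] at hact
    obtain ⟨h, hh, h2⟩ := ih (n + 1) (by omega) (hm.set (by omega))
    refine ⟨h, hh, Exec.loop_step hfit.1 hfit.2 (by simp [syms_set, hsym]) hact ?_⟩
    rw [List.replicate_succ', List.append_assoc] at h2
    exact h2

theorem exec_clearTape (hm : Fits x S m) (k : ℕ) (hk : k.size + 1 < S) :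
    (clearTape r).Exec x S (m.set r (bitTape k.bits) 0) (m.set r (bitTape (0 : ℕ).bits) 0) := by
  have h1 := exec_onTape (r := r) (t := bitTape k.bits) (h := 0) hm (fun a => (a, Move.right))
    (by simp only [Move.apply]; omega)
  simp only [Function.update_eq_self, Move.apply] at h1
  obtain ⟨h, hh, h2⟩ := exec_erase (r := r) hm k.bits 0
    (by rw [Nat.size_eq_bits_len]; simpa using hk)
  rw [Nat.zero_bits]
  exact Exec.seq h1 (Exec.seq h2 (exec_rewind hm rfl (bitTape_succ_ne _) hh))

/-- Moving two heads to the right. -/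
def bothRight (r r' : Fin T) : Prog I Cell T :=
  act fun _ s => (.stay, fun i => (s i, if i = r ∨ i = r' then .right else .stay))

variable {r' : Fin T} {t' : ℕ → Cell}

theorem exec_bothRight (hm : Fits x S m) (hr : r ≠ r') (hh : h + 1 < S) :
    (bothRight r r').Exec x S ((m.set r t h).set r' t' h)
      ((m.set r t (h + 1)).set r' t' (h + 1)) := by
  have key : (m.set r t (h + 1)).set r' t' (h + 1) = ((m.set r t h).set r' t' h).apply x.length
      (.stay, fun i => (((m.set r t h).set r' t' h).syms i,
        if i = r ∨ i = r' then .right else .stay)) := by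
    have := hm.1
    ext i j
    · simp [Mem.set, Mem.apply, Move.apply, this]
    · simp [Mem.set, Mem.apply, Mem.syms]
    · by_cases hi : i = r'
      · subst hi; simp [Mem.set, Mem.apply, Move.apply]
      · by_cases hi' : i = r
        · subst hi'; simp [Mem.set, Mem.apply, Move.apply, hr]
        · simp [Mem.set, Mem.apply, hi, hi', Move.apply]
  have hfit := (hm.set (r := r) (t := t) hh).set (r := r') (t := t') hh
  rw [key] at hfit ⊢
  exact Exec.act hfit.2

/-- Comparing the numbers on two tapes and writing the result to the tape `f`. -/
def eqTape (f r r' : Fin T) : Prog I Cell T :=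
  seq (bothRight r r')
    (seq (loop (fun _ s => decide (s r = s r' ∧ s r ≠ none)) (bothRight r r'))
      (seq (act fun _ s => (.stay, fun i => (if i = f then some (some (decide (s r = s r')))
          else s i, .stay)))
        (seq (rewind r) (rewind r'))))

theorem syms_set_set_left (hr : r ≠ r') {h' : ℕ} :
    ((m.set r t h).set r' t' h').syms r = t h := by
  simp [Mem.set, Mem.syms, hr]

theorem set_comm (hr : r ≠ r') {h' : ℕ} :
    (m.set r t h).set r' t' h' = (m.set r' t' h').set r t h := by
  simp [Mem.set, Function.update_comm hr]

/-- The two tapes are read in parallel up to the first position where they differ or are both blank;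
the symbols there decide. This happens at the end of `l` at the latest, so only its length matters
for the space. -/
theorem exec_scan {h : ℕ} (hm : Fits x S m) (hr : r ≠ r') (l l' : List Bool)
    (ht : ∀ j, t (h + j) = l[j]?.map some) (ht' : ∀ j, t' (h + j) = l'[j]?.map some)
    (hS : h + l.length < S) :
    ∃ h' < S, (t h' = t' h' ↔ l = l') ∧
      (loop (fun _ s => decide (s r = s r' ∧ s r ≠ none)) (bothRight r r')).Exec x S
        ((m.set r t h).set r' t' h) ((m.set r t h').set r' t' h') := by
  have hfit : Fits x S ((m.set r t h).set r' t' h) := (hm.set (by omega)).set (by omega)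
  have h0 := ht 0
  have h0' := ht' 0
  rw [Nat.add_zero] at h0 h0'
  by_cases hcond : t h = t' h ∧ t h ≠ none
  · cases l with
    | nil => simp [h0] at hcond
    | cons b l =>
      cases l' with
      | nil => simp [h0, h0'] at hcond
      | cons b' l' =>
        have hb : b = b' := by simpa [h0, h0'] using hcond
        simp only [List.length_cons] at hS
        obtain ⟨h', hh', h1, h2⟩ := exec_scan (h := h + 1) hm hr l l'
          (fun j => by rw [Nat.add_right_comm, Nat.add_assoc, ht]; simp)
          (fun j => by rw [Nat.add_right_comm, Nat.add_assoc, ht']; simp) (by omega)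
        refine ⟨h', hh', by rw [h1]; simp [hb], Exec.loop_step hfit.1 hfit.2 ?_
          (exec_bothRight hm hr (by omega)) h2⟩
        simpa [syms_set, syms_set_set_left hr] using hcond
  · refine ⟨h, by omega, ?_, Exec.loop_exit hfit.1 hfit.2 ?_⟩
    · rw [h0, h0'] at hcond ⊢
      cases l with
      | nil => cases l' <;> simp
      | cons b l =>
        cases l' with
        | nil => simp
        | cons b' l' =>
          have hb : b ≠ b' := by simpa using hcond
          simp [hb]
    · simpa [syms_set, syms_set_set_left hr] using hcond

theorem exec_eqTape {f : Fin T} (hm : Fits x S m) (hr : r ≠ r') (hf : f ≠ r) (hf' : f ≠ r')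
    (k k' : ℕ) (hk : k.size + 1 < S) :
    (eqTape f r r').Exec x S ((m.set r (bitTape k.bits) 0).set r' (bitTape k'.bits) 0)
      (((m.set f (Function.update (m.tape f) (m.head f) (some (some (decide (k = k')))))
        (m.head f)).set r (bitTape k.bits) 0).set r' (bitTape k'.bits) 0) := by
  obtain ⟨h, hh, heq, h2⟩ := exec_scan (h := 1) hm hr k.bits k'.bits
    (t := bitTape k.bits) (t' := bitTape k'.bits)
    (fun j => by rw [Nat.add_comm, bitTape_succ]) (fun j => by rw [Nat.add_comm, bitTape_succ])
    (by rw [Nat.size_eq_bits_len]; omega)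
  -- Equal numerals mean equal numbers.
  rw [bits_injective.eq_iff] at heq
  have hm' : Fits x S (m.set f (Function.update (m.tape f) (m.head f)
      (some (some (decide (k = k'))))) (m.head f)) := hm.set (hm.2 f)
  refine Exec.seq (exec_bothRight hm hr (by omega)) (Exec.seq h2 (Exec.seq (m₁ :=
    ((m.set f (Function.update (m.tape f) (m.head f) (some (some (decide (k = k')))))
        (m.head f)).set r (bitTape k.bits) h).set r' (bitTape k'.bits) h) ?_ (Exec.seq (m₁ :=
    ((m.set f (Function.update (m.tape f) (m.head f) (some (some (decide (k = k')))))
        (m.head f)).set r (bitTape k.bits) 0).set r' (bitTape k'.bits) h) ?_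
      (exec_rewind (hm'.set (by omega)) rfl (bitTape_succ_ne _) hh))))
  · set m₂ := (m.set r (bitTape k.bits) h).set r' (bitTape k'.bits) h with hm₂
    have hs1 : m₂.syms r = bitTape k.bits h := syms_set_set_left hr
    have hs2 : m₂.syms r' = bitTape k'.bits h := syms_set
    have key : ((m.set f (Function.update (m.tape f) (m.head f) (some (some (decide (k = k')))))
        (m.head f)).set r (bitTape k.bits) h).set r' (bitTape k'.bits) h = m₂.apply x.length
        (.stay, fun i => (if i = f then some (some (decide (m₂.syms r = m₂.syms r')))
          else m₂.syms i, .stay)) := by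
      have := hm.1
      rw [hs1, hs2]
      simp only [heq]
      ext i j
      · simp [hm₂, Mem.set, Mem.apply, Move.apply, this]
      · by_cases hi : i = f
        · subst hi; simp [hm₂, Mem.set, Mem.apply, hf, hf']
        · by_cases hi1 : i = r'
          · subst hi1; simp [hm₂, Mem.set, Mem.apply, Mem.syms, hi]
          · by_cases hi2 : i = r
            · subst hi2; simp [hm₂, Mem.set, Mem.apply, Mem.syms, hi, hr]
            · simp [hm₂, Mem.set, Mem.apply, Mem.syms, hi, hi1, hi2]
      · by_cases hi : i = f
        · subst hi; simp [hm₂, Mem.set, Mem.apply, hf, hf', Move.apply]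
        · by_cases hi1 : i = r'
          · subst hi1; simp [hm₂, Mem.set, Mem.apply, Move.apply]
          · by_cases hi2 : i = r
            · subst hi2; simp [hm₂, Mem.set, Mem.apply, hr, Move.apply]
            · simp [hm₂, Mem.set, Mem.apply, hi1, hi2, Move.apply]
    have hfit := (hm'.set (r := r) (t := bitTape k.bits) hh).set (r := r')
      (t := bitTape k'.bits) hh
    rw [key] at hfit ⊢
    exact Exec.act hfit.2
  · rw [set_comm hr, set_comm hr]
    exact exec_rewind (hm'.set hh) rfl (bitTape_succ_ne _) hh

end Prog

end SpaceTM


/-! ## Register programs -/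

namespace SpaceTM

namespace Prog

variable {I : Type} {T : ℕ}

/-- The tape with a single bit in cell `0`. -/
def flagTape (b : Bool) : ℕ → Cell := Function.update (fun _ => none) 0 (some (some b))

/-- The memory in which tape `0` holds the flag `fl`, tape `r > 0` the number `σ r`, and the input
head is at position `st.2`. -/
def regMem (T : ℕ) (st : (ℕ → ℕ) × ℕ) (fl : Bool) : Mem Cell (T + 1) where
  inHead := st.2
  tape := fun i => if i = 0 then flagTape fl else bitTape (st.1 i).bits
  head := fun _ => 0

/-- The tape of a register. -/
def tapeOf (T r : ℕ) : Fin (T + 1) := Fin.ofNat (T + 1) r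

theorem val_tapeOf {r : ℕ} (hr : r ≤ T) : (tapeOf T r : ℕ) = r := by
  simp only [tapeOf, Fin.val_ofNat]
  exact Nat.mod_eq_of_lt (by omega)

theorem tapeOf_ne_zero {r : ℕ} (h0 : 0 < r) (hr : r ≤ T) : tapeOf T r ≠ 0 := by
  intro h
  have := congrArg Fin.val h
  rw [val_tapeOf hr] at this
  simp at this
  omega

theorem tapeOf_ne {r r' : ℕ} (hr : r ≤ T) (hr' : r' ≤ T) (h : r ≠ r') :
    tapeOf T r ≠ tapeOf T r' := by
  intro e
  have := congrArg Fin.val e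
  rw [val_tapeOf hr, val_tapeOf hr'] at this
  exact h this

variable {σ : ℕ → ℕ} {pos : ℕ} {fl : Bool} {r r' : ℕ}

theorem regMem_update (h0 : 0 < r) (hr : r ≤ T) (v : ℕ) :
    regMem T (Function.update σ r v, pos) fl =
      (regMem T (σ, pos) fl).set (tapeOf T r) (bitTape v.bits) 0 := by
  ext i j
  · rfl
  · by_cases hi : i = tapeOf T r
    · subst hi; simp [regMem, Mem.set, tapeOf_ne_zero h0 hr, val_tapeOf hr]
    · have : (i : ℕ) ≠ r := fun h => hi (Fin.ext (by rw [val_tapeOf hr, h]))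
      simp [regMem, Mem.set, hi, this]
  · simp [regMem, Mem.set]

theorem regMem_eq_set (h0 : 0 < r) (hr : r ≤ T) :
    regMem T (σ, pos) fl = (regMem T (σ, pos) fl).set (tapeOf T r) (bitTape (σ r).bits) 0 := by
  rw [← regMem_update h0 hr, Function.update_eq_self]

theorem regMem_flag (b : Bool) : regMem T (σ, pos) b =
    (regMem T (σ, pos) fl).set 0 (Function.update ((regMem T (σ, pos) fl).tape 0)
      ((regMem T (σ, pos) fl).head 0) (some (some b))) ((regMem T (σ, pos) fl).head 0) := by
  ext i j
  · rfl
  · by_cases hi : i = 0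
    · subst hi; simp [regMem, Mem.set, flagTape]
    · simp [regMem, Mem.set, hi]
  · simp [regMem, Mem.set]

theorem fits_regMem {x : List I} {S : ℕ} (hpos : pos ≤ x.length + 1) (hS : 0 < S) :
    Fits x S (regMem T (σ, pos) fl) := ⟨hpos, fun _ => hS⟩

/-- All registers are at most `B`, and the input head is between the end markers. -/
structure Valid (B : ℕ) (x : List I) (st : (ℕ → ℕ) × ℕ) : Prop where
  reg : ∀ r, st.1 r ≤ B
  pos : st.2 ≤ x.length + 1

/-- The program takes the registers and the input position `st` to `st'`, within the bound `B` for
the registers and on the leftmost `S` cells. -/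
def RegExec (x : List I) (S B : ℕ) (p : Prog I Cell (T + 1)) (st st' : (ℕ → ℕ) × ℕ) : Prop :=
  Valid B x st' ∧ ∀ fl, ∃ fl', p.Exec x S (regMem T st fl) (regMem T st' fl')

variable {x : List I} {S B : ℕ} {p q : Prog I Cell (T + 1)} {st st₁ st' : (ℕ → ℕ) × ℕ}

theorem RegExec.seq (h : RegExec x S B p st st₁) (h' : RegExec x S B q st₁ st') :
    RegExec x S B (Prog.seq p q) st st' := by
  refine ⟨h'.1, fun fl => ?_⟩
  obtain ⟨fl₁, h1⟩ := h.2 fl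
  obtain ⟨fl', h2⟩ := h'.2 fl₁
  exact ⟨fl', Exec.seq h1 h2⟩

/-- Doing nothing. -/
def skip : Prog I Cell T := act fun _ s => idle s

theorem regExec_skip (hv : Valid B x st) (hS : 0 < S) : RegExec x S B (skip (T := T + 1)) st st := by
  refine ⟨hv, fun fl => ⟨fl, ?_⟩⟩
  have h := Exec.act (x := x) (S := S) (m := regMem T st fl) (f := fun _ s => idle s)
  rw [apply_idle _ hv.2] at h
  exact h fun _ => hS

theorem valid_update (hv : Valid B x (σ, pos)) {v : ℕ} (h : v ≤ B) :
    Valid B x (Function.update σ r v, pos) := by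
  refine ⟨fun i => ?_, hv.2⟩
  by_cases hi : i = r
  · subst hi; simpa using h
  · simpa [hi] using hv.1 i

theorem size_lt (hB : B.size + 1 < S) {v : ℕ} (h : v ≤ B) : v.size + 1 < S := by
  have := Nat.size_le_size h
  omega

/-- Adding one to a register. -/
def inc (T r : ℕ) : Prog I Cell (T + 1) := incTape (tapeOf T r)

theorem regExec_inc (hB : B.size + 1 < S) (hv : Valid B x (σ, pos)) (h0 : 0 < r) (hr : r ≤ T)
    (h : σ r + 1 ≤ B) :
    RegExec x S B (inc T r) (σ, pos) (Function.update σ r (σ r + 1), pos) := by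
  refine ⟨valid_update hv h, fun fl => ⟨fl, ?_⟩⟩
  rw [regMem_update h0 hr]
  have := exec_incTape (r := tapeOf T r) (fits_regMem (σ := σ) (fl := fl) hv.2 (by omega)) (σ r)
    (size_lt hB (hv.1 r))
  rwa [← regMem_eq_set h0 hr] at this

/-- Setting a register to zero. -/
def clear (T r : ℕ) : Prog I Cell (T + 1) := clearTape (tapeOf T r)

theorem regExec_clear (hB : B.size + 1 < S) (hv : Valid B x (σ, pos)) (h0 : 0 < r) (hr : r ≤ T) :
    RegExec x S B (clear T r) (σ, pos) (Function.update σ r 0, pos) := by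
  refine ⟨valid_update hv (Nat.zero_le _), fun fl => ⟨fl, ?_⟩⟩
  rw [regMem_update h0 hr]
  have := exec_clearTape (r := tapeOf T r) (fits_regMem (σ := σ) (fl := fl) hv.2 (by omega)) (σ r)
    (size_lt hB (hv.1 r))
  rwa [← regMem_eq_set h0 hr] at this

/-- Comparing two registers. -/
def eqReg (T r r' : ℕ) : Prog I Cell (T + 1) := eqTape 0 (tapeOf T r) (tapeOf T r')

theorem exec_eqReg (hB : B.size + 1 < S) (hv : Valid B x (σ, pos)) (h0 : 0 < r) (hr : r ≤ T)
    (h0' : 0 < r') (hr' : r' ≤ T) (hne : r ≠ r') :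
    (eqReg T r r').Exec x S (regMem T (σ, pos) fl)
      (regMem T (σ, pos) (decide (σ r = σ r'))) := by
  have := exec_eqTape (f := 0) (r := tapeOf T r) (r' := tapeOf T r')
    (fits_regMem (T := T) (σ := σ) (fl := fl) hv.2 (show 0 < S by omega)) (tapeOf_ne hr hr' hne)
    (tapeOf_ne_zero h0 hr).symm (tapeOf_ne_zero h0' hr').symm (σ r) (σ r')
    (size_lt hB (hv.1 r))
  rwa [← regMem_flag, ← regMem_eq_set h0 hr, ← regMem_eq_set h0 hr, ← regMem_eq_set h0' hr',
    ← regMem_eq_set h0' hr'] at this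

theorem syms_regMem_zero : (regMem T st fl).syms 0 = some (some fl) := by
  simp [regMem, Mem.syms, flagTape]

/-- Branching on the equality of two registers. -/
def ifEq (r r' : ℕ) (p q : Prog I Cell (T + 1)) : Prog I Cell (T + 1) :=
  seq (eqReg T r r') (ite (fun _ s => decide (s 0 = some (some true))) p q)

theorem regExec_ifEq (hB : B.size + 1 < S) (hv : Valid B x (σ, pos)) (h0 : 0 < r) (hr : r ≤ T)
    (h0' : 0 < r') (hr' : r' ≤ T) (hne : r ≠ r')
    (h : if σ r = σ r' then RegExec x S B p (σ, pos) st' else RegExec x S B q (σ, pos) st') :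
    RegExec x S B (ifEq r r' p q) (σ, pos) st' := by
  have hfit := fun fl => fits_regMem (T := T) (σ := σ) (fl := fl) hv.2 (show 0 < S by omega)
  by_cases hσ : σ r = σ r'
  · rw [if_pos hσ] at h
    refine ⟨h.1, fun fl => ?_⟩
    obtain ⟨fl', h'⟩ := h.2 (decide (σ r = σ r'))
    refine ⟨fl', Exec.seq (exec_eqReg hB hv h0 hr h0' hr' hne)
      (Exec.ite (hfit _).1 (hfit _).2 ?_)⟩
    simpa [syms_regMem_zero, hσ] using h'
  · rw [if_neg hσ] at h
    refine ⟨h.1, fun fl => ?_⟩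
    obtain ⟨fl', h'⟩ := h.2 (decide (σ r = σ r'))
    refine ⟨fl', Exec.seq (exec_eqReg hB hv h0 hr h0' hr' hne)
      (Exec.ite (hfit _).1 (hfit _).2 ?_)⟩
    simpa [syms_regMem_zero, hσ] using h'

/-- Repeating `p` as long as the equality of the two registers has the truth value `b`. -/
def whileReg (b : Bool) (r r' : ℕ) (p : Prog I Cell (T + 1)) : Prog I Cell (T + 1) :=
  seq (eqReg T r r') (loop (fun _ s => decide (s 0 = some (some b))) (seq p (eqReg T r r')))

/-- The bound `Bd j` may change from round to round, as it must when the loop increments the cap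
itself. -/
theorem regExec_whileReg (b : Bool) (h0 : 0 < r) (hr : r ≤ T) (h0' : 0 < r') (hr' : r' ≤ T)
    (hne : r ≠ r') (N : ℕ) (st : ℕ → (ℕ → ℕ) × ℕ) (Bd : ℕ → ℕ)
    (hBd : ∀ j ≤ N, (Bd j).size + 1 < S) (hv : ∀ j ≤ N, Valid (Bd j) x (st j))
    (hstep : ∀ j < N, decide ((st j).1 r = (st j).1 r') = b ∧
      RegExec x S (Bd (j + 1)) p (st j) (st (j + 1)))
    (hend : decide ((st N).1 r = (st N).1 r') ≠ b) :
    RegExec x S (Bd N) (whileReg b r r' p) (st 0) (st N) := by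
  have heq : ∀ j ≤ N, ∀ fl, (eqReg T r r').Exec x S (regMem T (st j) fl)
      (regMem T (st j) (decide ((st j).1 r = (st j).1 r'))) := fun j hj fl =>
    exec_eqReg (hBd j hj) (hv j hj) h0 hr h0' hr' hne
  have hS : 0 < S := by have := hBd N le_rfl; omega
  have hfit := fun j (hj : j ≤ N) fl =>
    fits_regMem (T := T) (σ := (st j).1) (fl := fl) (hv j hj).2 hS
  have key : ∀ i j, i + j = N → (loop (fun _ s => decide (s 0 = some (some b)))
      (seq p (eqReg T r r'))).Exec x S
      (regMem T (st j) (decide ((st j).1 r = (st j).1 r')))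
      (regMem T (st N) (decide ((st N).1 r = (st N).1 r'))) := by
    intro i
    induction i with
    | zero =>
      intro j hj
      obtain rfl : j = N := by omega
      exact Exec.loop_exit (hfit j le_rfl _).1 (hfit j le_rfl _).2
        (by simpa [syms_regMem_zero] using hend)
    | succ i ih =>
      intro j hj
      obtain ⟨h1, -, h2⟩ := hstep j (by omega)
      obtain ⟨fl', h3⟩ := h2 (decide ((st j).1 r = (st j).1 r'))
      exact Exec.loop_step (hfit j (by omega) _).1 (hfit j (by omega) _).2
        (by simpa [syms_regMem_zero] using h1) (Exec.seq h3 (heq (j + 1) (by omega) fl'))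
        (ih (j + 1) (by omega))
  exact ⟨hv N le_rfl, fun fl => ⟨_, Exec.seq (heq 0 (by omega) fl) (key N 0 (by omega))⟩⟩

/-- Copying register `r` to register `d`. -/
def copy (T r d : ℕ) : Prog I Cell (T + 1) := seq (clear T d) (whileReg false d r (inc T d))

/-- Register `d` is counted up from zero until it equals register `r`. This is slow, but only space
is limited. -/
theorem regExec_copy {d : ℕ} (hB : B.size + 1 < S) (hv : Valid B x (σ, pos)) (h0 : 0 < r)
    (hr : r ≤ T) (h0' : 0 < d) (hd : d ≤ T) (hne : d ≠ r) :
    RegExec x S B (copy T r d) (σ, pos) (Function.update σ d (σ r), pos) := by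
  refine RegExec.seq (regExec_clear hB hv h0' hd) ?_
  have hv' : ∀ j ≤ σ r, Valid B x (Function.update σ d j, pos) := fun j hj =>
    valid_update hv (hj.trans (hv.1 r))
  refine regExec_whileReg false h0' hd h0 hr hne (σ r) (fun j => (Function.update σ d j, pos))
    (fun _ => B) (fun _ _ => hB) hv' (fun j hj => ⟨by simp [hne.symm]; omega, ?_⟩)
    (by simp [hne.symm])
  have := regExec_inc (T := T) (r := d) hB (hv' j hj.le) h0' hd
    (by have := hv.1 r; simp only [Function.update_self] at this ⊢; omega)
  simpa using this

/-- Moving the input head. -/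
def inMove (v : Move) : Prog I Cell T := act fun _ s => (v, fun i => (s i, .stay))

theorem exec_inMove (v : Move) (hS : 0 < S) :
    (inMove v).Exec x S (regMem T (σ, pos) fl)
      (regMem T (σ, min (v.apply pos) (x.length + 1)) fl) := by
  have h := Exec.act (x := x) (S := S) (m := regMem T (σ, pos) fl)
    (f := fun _ s => (v, fun i => (s i, .stay)))
  have key : (regMem T (σ, pos) fl).apply x.length (v, fun i =>
      ((regMem T (σ, pos) fl).syms i, .stay)) =
      regMem T (σ, min (v.apply pos) (x.length + 1)) fl := by
    ext i j
    · simp [regMem, Mem.apply]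
    · simp [regMem, Mem.apply, Mem.syms]
    · simp [regMem, Mem.apply, Move.apply]
  rw [key] at h
  exact h fun _ => hS

theorem regExec_right (hv : Valid B x (σ, pos)) (hS : 0 < S) :
    RegExec x S B (inMove (T := T + 1) .right) (σ, pos) (σ, min (pos + 1) (x.length + 1)) :=
  ⟨⟨hv.1, min_le_right _ _⟩, fun _ => ⟨_, exec_inMove .right hS⟩⟩

/-- Moving the input head to the left end marker. -/
def home : Prog I Cell T :=
  loop (fun i _ => match i with | .leftEnd => false | _ => true) (inMove .left)

theorem exec_home (hpos : pos ≤ x.length + 1) (hS : 0 < S) :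
    home.Exec x S (regMem T (σ, pos) fl) (regMem T (σ, 0) fl) := by
  induction pos with
  | zero =>
    exact Exec.loop_exit hpos (fun _ => hS) (by simp [regMem, readInput])
  | succ pos ih =>
    refine Exec.loop_step (m₁ := regMem T (σ, pos) fl) hpos (fun _ => hS) ?_ ?_ (ih (by omega))
    · simp only [regMem, readInput]
      simp only [Nat.add_eq_zero_iff, one_ne_zero, and_false, if_false]
      rcases x[pos + 1 - 1]? <;> rfl
    · have := exec_inMove (T := T) (x := x) (σ := σ) (pos := pos + 1) (fl := fl) .left hS
      simp only [Move.apply, Nat.add_sub_cancel] at this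
      rwa [min_eq_left (by omega)] at this

theorem regExec_home (hv : Valid B x (σ, pos)) (hS : 0 < S) :
    RegExec x S B (home (T := T + 1)) (σ, pos) (σ, 0) :=
  ⟨⟨hv.1, Nat.zero_le _⟩, fun _ => ⟨_, exec_home hv.2 hS⟩⟩

/-- Adding `min n (code a)` to register `d`, where `a` is the symbol under the input head. -/
def addCode (T d : ℕ) (code : InSym I → ℕ) : ℕ → Prog I Cell (T + 1)
  | 0 => skip
  | n + 1 => seq (addCode T d code n) (ite (fun a _ => decide (n < code a)) (inc T d) skip)

/-- The code of the symbol is compared with the constants below `n` by unrolled branches, so that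
the finite control carries it into a register. -/
theorem regExec_addCode {d : ℕ} (code : InSym I → ℕ) (n : ℕ) (hB : B.size + 1 < S)
    (hv : Valid B x (σ, pos)) (h0 : 0 < d) (hd : d ≤ T) (h : σ d + n ≤ B) :
    RegExec x S B (addCode T d code n) (σ, pos)
      (Function.update σ d (σ d + min n (code (readInput x pos))), pos) := by
  induction n with
  | zero => simpa [addCode] using regExec_skip hv (by omega)
  | succ n ih =>
    have ih := ih (by omega)
    refine RegExec.seq ih ?_
    have hfit := fun fl => fits_regMem (T := T)
      (σ := Function.update σ d (σ d + min n (code (readInput x pos)))) (fl := fl) hv.2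
      (show 0 < S by omega)
    have hv' := ih.1
    by_cases hc : n < code (readInput x pos)
    · have h1 := regExec_inc (T := T) hB hv' h0 hd (by simp; omega)
      refine ⟨valid_update hv (by omega), fun fl => ?_⟩
      obtain ⟨fl', h2⟩ := h1.2 fl
      refine ⟨fl', Exec.ite (hfit _).1 (hfit _).2 ?_⟩
      have e : min (n + 1) (code (readInput x pos)) = n + 1 := by omega
      have e' : min n (code (readInput x pos)) = n := by omega
      simpa [regMem, hc, e, e', Nat.add_assoc] using h2
    · have h1 := regExec_skip (T := T) (S := S) hv' (by omega)
      refine ⟨valid_update hv (by omega), fun fl => ?_⟩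
      obtain ⟨fl', h2⟩ := h1.2 fl
      refine ⟨fl', Exec.ite (hfit _).1 (hfit _).2 ?_⟩
      have e : min (n + 1) (code (readInput x pos)) = min n (code (readInput x pos)) := by
        omega
      simpa [regMem, hc, e] using h2

/-- Writing the markers of the registers and clearing the flag. -/
def init (T : ℕ) : Prog I Cell (T + 1) :=
  act fun _ _ => (.stay, fun i => (if i = 0 then some (some false) else some none, .stay))

theorem exec_init (hS : 0 < S) :
    (init T).Exec x S (initMem none) (regMem T (fun _ => 0, 0) false) := by
  have h := Exec.act (x := x) (S := S) (m := initMem (T := T + 1) (none : Cell)) (f := fun _ _ =>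
    (.stay, fun i => (if i = 0 then some (some false) else some none, .stay)))
  have key : (initMem (T := T + 1) (none : Cell)).apply x.length
      (.stay, fun i => (if i = 0 then some (some false) else some none, .stay)) =
      regMem T (fun _ => 0, 0) false := by
    ext i j
    · simp [regMem, Mem.apply, initMem, Move.apply]
    · by_cases hi : i = 0
      · subst hi; simp [regMem, Mem.apply, initMem, flagTape]
      · rcases j with _ | j
        · simp [regMem, Mem.apply, initMem, hi, bitTape, cells]
        · simp [regMem, Mem.apply, initMem, hi, bitTape, cells]
    · simp [regMem, Mem.apply, initMem, Move.apply]
  rw [key] at h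
  exact h fun _ => hS

end Prog

end SpaceTM


/-! ## Functions with saturating arithmetic -/

namespace SpaceTM

/-- Descriptions of functions of `k` numbers that are at most a cap. -/
inductive Fn : ℕ → Type
  | var {k : ℕ} (i : Fin k) : Fn k
  | zero {k : ℕ} : Fn k
  | succ {k : ℕ} (e : Fn k) : Fn k
  | cap {k : ℕ} : Fn k
  | inp {k : ℕ} (e : Fn k) : Fn k
  | ifEq {k : ℕ} (a b c d : Fn k) : Fn k
  | loop {k : ℕ} (n a : Fn k) (b : Fn (k + 2)) : Fn k
  | comp {k m : ℕ} (f : Fn m) (g : Fin m → Fn k) : Fn k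

namespace Fn

variable {I : Type}

/-- The value of a function with cap `B` on the input `x`, the symbols of which have number codes.
The body of a loop refers to the number of finished rounds and to the current value. -/
def eval (code : InSym I → ℕ) (x : List I) (B : ℕ) : {k : ℕ} → Fn k → (Fin k → ℕ) → ℕ
  | _, var i, ρ => ρ i
  | _, zero, _ => 0
  | _, succ e, ρ => min (e.eval code x B ρ + 1) B
  | _, cap, _ => B
  | _, inp e, ρ => code (readInput x (e.eval code x B ρ + 1))
  | _, ifEq a b c d, ρ =>
    if a.eval code x B ρ = b.eval code x B ρ then c.eval code x B ρ else d.eval code x B ρ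
  | _, loop n a b, ρ => Nat.rec (a.eval code x B ρ)
      (fun j v => b.eval code x B (Matrix.vecCons j (Matrix.vecCons v ρ))) (n.eval code x B ρ)
  | _, comp f g, ρ => f.eval code x B fun i => (g i).eval code x B ρ

/-- The number of registers that are needed. -/
def width : {k : ℕ} → Fn k → ℕ
  | _, var _ => 1
  | _, zero => 1
  | _, succ e => e.width
  | _, cap => 1
  | _, inp e => e.width + 1
  | _, ifEq a b c d => a.width + b.width + c.width + d.width
  | _, loop n a b => n.width + a.width + b.width + 3
  | _, comp (m := m) f g => (∑ i, (g i).width) + m + f.width + 1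

theorem width_pos {k : ℕ} (e : Fn k) : 0 < e.width := by
  induction e with
  | var _ => simp [width]
  | zero => simp [width]
  | succ e ih => simpa [width] using ih
  | cap => simp [width]
  | inp e ih => simp [width]
  | ifEq a b c d _ _ _ _ => simp only [width]; omega
  | loop n a b _ _ _ => simp only [width]; omega
  | comp f g ih _ => simp only [width]; omega

open Prog

/-- Executing finitely many programs one after the other. -/
def seqAll {T : ℕ} : (n : ℕ) → (Fin n → Prog I Cell (T + 1)) → Prog I Cell (T + 1)
  | 0, _ => skip
  | n + 1, f => seq (seqAll n fun i => f i.castSucc) (f (Fin.last n))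

/-- The program that computes the function of the registers `loc` into the register `d`, using the
cap in register `1` and changing no register below `d`. -/
def compile (code : InSym I → ℕ) (T : ℕ) : {k : ℕ} → Fn k → (Fin k → ℕ) → ℕ → Prog I Cell (T + 1)
  | _, var i, loc, d => copy T (loc i) d
  | _, zero, _, d => clear T d
  | _, succ e, loc, d => seq (e.compile code T loc d) (Prog.ifEq d 1 skip (inc T d))
  | _, cap, _, d => copy T 1 d
  | _, inp e, loc, d => seq (e.compile code T loc d) (seq home (seq (inMove .right)
      (seq (clear T (d + 1)) (seq (whileReg false (d + 1) d (seq (inMove .right) (inc T (d + 1))))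
        (seq (clear T d) (addCode T d code 16))))))
  | _, ifEq a b c e, loc, d => seq (a.compile code T loc d) (seq (b.compile code T loc (d + 1))
      (Prog.ifEq d (d + 1) (c.compile code T loc d) (e.compile code T loc d)))
  | _, loop n a b, loc, d => seq (n.compile code T loc d) (seq (a.compile code T loc (d + 2))
      (seq (clear T (d + 1)) (seq (whileReg false (d + 1) d
        (seq (b.compile code T (Matrix.vecCons (d + 1) (Matrix.vecCons (d + 2) loc)) (d + 3))
          (seq (copy T (d + 3) (d + 2)) (inc T (d + 1)))))
        (copy T (d + 2) d))))
  | _, comp (m := m) f g, loc, d =>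
    seq (seqAll m fun i => (g i).compile code T loc (d + 1 + i))
      (seq (f.compile code T (fun i => d + 1 + i) (d + 1 + m)) (copy T (d + 1 + m) d))

variable {x : List I} {S B T : ℕ}

/-- The loop rule with an invariant in place of a known sequence of memories, since subprograms
leave unspecified values in scratch registers. -/
theorem exists_regExec_whileReg {p : Prog I Cell (T + 1)} {r r' : ℕ} (b : Bool) (h0 : 0 < r)
    (hr : r ≤ T) (h0' : 0 < r') (hr' : r' ≤ T) (hne : r ≠ r') (N : ℕ) (Bd : ℕ → ℕ)
    (Inv : ℕ → (ℕ → ℕ) × ℕ → Prop) {st₀ : (ℕ → ℕ) × ℕ} (h₀ : Inv 0 st₀)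
    (hBd : ∀ j ≤ N, (Bd j).size + 1 < S) (hv : ∀ j ≤ N, ∀ st, Inv j st → Valid (Bd j) x st)
    (hstep : ∀ j < N, ∀ st, Inv j st → decide (st.1 r = st.1 r') = b ∧
      ∃ st', RegExec x S (Bd (j + 1)) p st st' ∧ Inv (j + 1) st')
    (hend : ∀ st, Inv N st → decide (st.1 r = st.1 r') ≠ b) :
    ∃ st', RegExec x S (Bd N) (whileReg b r r' p) st₀ st' ∧ Inv N st' := by
  have hex : ∀ j st, ∃ st', j < N → Inv j st → RegExec x S (Bd (j + 1)) p st st' ∧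
      Inv (j + 1) st' := by
    intro j st
    by_cases h : j < N ∧ Inv j st
    · obtain ⟨-, st', h'⟩ := hstep j h.1 st h.2
      exact ⟨st', fun _ _ => h'⟩
    · exact ⟨st, fun h1 h2 => absurd ⟨h1, h2⟩ h⟩
  choose g hg using hex
  let s : ℕ → (ℕ → ℕ) × ℕ := fun j => Nat.rec st₀ (fun j st => g j st) j
  have hs : ∀ j ≤ N, Inv j (s j) := by
    intro j
    induction j with
    | zero => exact fun _ => h₀
    | succ j ih => exact fun hj => (hg j (s j) (by omega) (ih (by omega))).2
  refine ⟨s N, ?_, hs N le_rfl⟩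
  exact regExec_whileReg b h0 hr h0' hr' hne N s Bd hBd (fun j hj => hv j hj _ (hs j hj))
    (fun j hj => ⟨(hstep j hj _ (hs j hj.le)).1, (hg j (s j) hj (hs j hj.le)).1⟩)
    (hend _ (hs N le_rfl))

/-- Started with the registers below `d` as in `σ₀`, the program computes `v` into register `d` and
changes no register below `d`. -/
def Computes (x : List I) (S B : ℕ) (p : Prog I Cell (T + 1)) (d : ℕ) (σ₀ : ℕ → ℕ) (v : ℕ) : Prop :=
  ∀ σ pos, Valid B x (σ, pos) → (∀ r < d, σ r = σ₀ r) →
    ∃ σ' pos', RegExec x S B p (σ, pos) (σ', pos') ∧ σ' d = v ∧ ∀ r < d, σ' r = σ₀ r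

theorem computes_seqAll {n d : ℕ} (f : Fin n → Prog I Cell (T + 1)) (σ₀ : ℕ → ℕ) (v : Fin n → ℕ)
    (hS : 0 < S)
    (h : ∀ i (σ : ℕ → ℕ), (∀ r < d, σ r = σ₀ r) → Computes x S B (f i) (d + i) σ (v i))
    (σ : ℕ → ℕ) (pos : ℕ) (hv : Valid B x (σ, pos)) (hσ : ∀ r < d, σ r = σ₀ r) :
    ∃ σ' pos', RegExec x S B (seqAll n f) (σ, pos) (σ', pos') ∧ (∀ i : Fin n, σ' (d + i) = v i) ∧
      ∀ r < d, σ' r = σ₀ r := by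
  induction n with
  | zero => exact ⟨σ, pos, regExec_skip hv hS, fun i => i.elim0, hσ⟩
  | succ n ih =>
    obtain ⟨σ₁, pos₁, h1, h2, h3⟩ := ih (fun i => f i.castSucc) (fun i => v i.castSucc)
      (fun i => h i.castSucc)
    obtain ⟨σ₂, pos₂, h4, h5, h6⟩ := h (Fin.last n) σ₁ h3 σ₁ pos₁ h1.1 (fun _ _ => rfl)
    simp only [Fin.val_last] at h5 h6
    refine ⟨σ₂, pos₂, h1.seq h4, fun i => ?_, fun r hr => by rw [h6 r (by omega), h3 r hr]⟩
    refine Fin.lastCases h5 (fun i => ?_) i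
    have hi := i.2
    rw [Fin.val_castSucc, h6 _ (by omega)]
    exact h2 i

/-- Positions behind the input all read as the right end marker, where the head stops. -/
theorem readInput_min (x : List I) (p : ℕ) :
    readInput x (min (p + 1) (x.length + 1)) = readInput x (p + 1) := by
  rcases Nat.lt_or_ge p x.length with h | h
  · rw [min_eq_left (by omega)]
  · rw [min_eq_right (by omega)]
    simp [readInput, List.getElem?_eq_none h]

/-- Induction on the description, carried by a stack discipline: a program for register `d` reads
its arguments below `d` and preserves everything there, so intermediate results survive the
subprograms that start above them. `width` measures how many registers from `d` on are touched. -/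
theorem computes_compile (code : InSym I → ℕ) (hcode : ∀ a, code a ≤ 16) (hB16 : 16 ≤ B)
    (hB : B.size + 1 < S) {k : ℕ} (e : Fn k) :
    ∀ (loc : Fin k → ℕ) (d : ℕ) (σ₀ : ℕ → ℕ) (ρ : Fin k → ℕ), σ₀ 1 = B → 1 < d →
      (∀ i, 0 < loc i) → (∀ i, loc i < d) → (∀ i, σ₀ (loc i) = ρ i) → d + e.width ≤ T + 1 →
      Computes x S B (e.compile code T loc d) d σ₀ (e.eval code x B ρ) := by
  have hS : 0 < S := by omega
  induction e with
  | var i =>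
    intro loc d σ₀ ρ h1 hd hl0 hld hlρ hw σ pos hv hσ
    simp only [width] at hw
    have := hld i
    refine ⟨_, pos, regExec_copy hB hv (hl0 i) (by omega) (by omega) (by omega) (by omega), ?_,
      fun r hr => ?_⟩
    · simp [eval, hσ _ (hld i), hlρ]
    · rw [Function.update_of_ne (by omega), hσ r hr]
  | zero =>
    intro loc d σ₀ ρ h1 hd hl0 hld hlρ hw σ pos hv hσ
    simp only [width] at hw
    refine ⟨_, pos, regExec_clear hB hv (by omega) (by omega), by simp [eval], fun r hr => ?_⟩
    rw [Function.update_of_ne (by omega), hσ r hr]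
  | cap =>
    intro loc d σ₀ ρ h1 hd hl0 hld hlρ hw σ pos hv hσ
    simp only [width] at hw
    refine ⟨_, pos, regExec_copy hB hv (by omega) (by omega) (by omega) (by omega) (by omega),
      ?_, fun r hr => ?_⟩
    · simp [eval, hσ 1 hd, h1]
    · rw [Function.update_of_ne (by omega), hσ r hr]
  | succ e ih =>
    intro loc d σ₀ ρ h1 hd hl0 hld hlρ hw σ pos hv hσ
    simp only [width] at hw
    have hwp := e.width_pos
    obtain ⟨σ₁, pos₁, h2, h3, h4⟩ := ih loc d σ₀ ρ h1 hd hl0 hld hlρ hw σ pos hv hσ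
    have hv₁ := h2.1
    have hle : σ₁ d ≤ B := hv₁.1 d
    have e1 : σ₁ 1 = B := by rw [h4 1 hd, h1]
    by_cases hc : σ₁ d = B
    · refine ⟨σ₁, pos₁, h2.seq (regExec_ifEq hB hv₁ (by omega) (by omega) (by omega) (by omega)
        (by omega) ?_), ?_, h4⟩
      · rw [if_pos (by rw [hc, e1])]
        exact regExec_skip hv₁ hS
      · simp only [eval]; omega
    · refine ⟨_, pos₁, h2.seq (regExec_ifEq hB hv₁ (by omega) (by omega) (by omega) (by omega)
        (by omega) (st' := (Function.update σ₁ d (σ₁ d + 1), pos₁)) ?_), ?_, fun r hr => ?_⟩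
      · rw [if_neg (by rw [e1]; exact hc)]
        exact regExec_inc hB hv₁ (by omega) (by omega) (by omega)
      · simp only [eval, Function.update_self]; omega
      · rw [Function.update_of_ne (by omega), h4 r hr]
  | inp e ih =>
    intro loc d σ₀ ρ h1 hd hl0 hld hlρ hw σ pos hv hσ
    simp only [width] at hw
    have hwp := e.width_pos
    obtain ⟨σ₁, pos₁, h2, h3, h4⟩ := ih loc d σ₀ ρ h1 hd hl0 hld hlρ (by omega) σ pos hv hσ
    have a1 := regExec_home (T := T) h2.1 hS
    have a2 := regExec_right (T := T) a1.1 hS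
    have a3 := regExec_clear (T := T) (r := d + 1) hB a2.1 (by omega) (by omega)
    have hv' : ∀ j ≤ σ₁ d, Valid B x (Function.update σ₁ (d + 1) j,
        min (j + 1) (x.length + 1)) := fun j hj =>
      ⟨(valid_update h2.1 (hj.trans (h2.1.1 d))).1, min_le_right _ _⟩
    -- Register `d + 1` counts the moves; the head started on position `1`, hence the offset.
    have a4 : RegExec x S B (whileReg false (d + 1) d (seq (inMove .right) (inc T (d + 1))))
        (Function.update σ₁ (d + 1) 0, min (0 + 1) (x.length + 1))
        (Function.update σ₁ (d + 1) (σ₁ d), min (σ₁ d + 1) (x.length + 1)) := by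
      refine regExec_whileReg false (by omega) (by omega) (by omega) (by omega) (by omega) (σ₁ d)
        (fun j => (Function.update σ₁ (d + 1) j, min (j + 1) (x.length + 1))) (fun _ => B)
        (fun _ _ => hB) hv' (fun j hj => ⟨by simp; omega, ?_⟩) (by simp)
      have b1 := regExec_right (T := T) (hv' j hj.le) hS
      have b2 := regExec_inc (T := T) (r := d + 1) hB b1.1 (by omega) (by omega) (by
        have : σ₁ d ≤ B := h2.1.1 d
        simp only [Function.update_self]; omega)
      have := b1.seq b2
      simp only [Function.update_self, Function.update_idem] at this
      rwa [show min (min (j + 1) (x.length + 1) + 1) (x.length + 1) =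
        min (j + 1 + 1) (x.length + 1) by omega] at this
    have a5 := regExec_clear (T := T) (r := d) hB a4.1 (by omega) (by omega)
    -- The limit `16` loses nothing, as no code exceeds it, and `16 ≤ B` leaves room for it.
    have a6 := regExec_addCode (T := T) (d := d) code 16 hB a5.1 (by omega) (by omega)
      (by simpa using hB16)
    refine ⟨_, _, h2.seq (a1.seq (a2.seq (a3.seq (a4.seq (a5.seq a6))))), ?_, fun r hr => ?_⟩
    · simp only [eval, Function.update_self, Nat.zero_add, readInput_min, h3]
      exact min_eq_right (hcode _)
    · rw [Function.update_of_ne (by omega), Function.update_of_ne (by omega),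
        Function.update_of_ne (by omega), h4 r hr]
  | ifEq a b c e iha ihb ihc ihe =>
    intro loc d σ₀ ρ h1 hd hl0 hld hlρ hw σ pos hv hσ
    simp only [width] at hw
    have ha := a.width_pos
    have hb := b.width_pos
    have hc := c.width_pos
    have he := e.width_pos
    obtain ⟨σ₁, pos₁, h2, h3, h4⟩ := iha loc d σ₀ ρ h1 hd hl0 hld hlρ (by omega) σ pos hv hσ
    obtain ⟨σ₂, pos₂, h5, h6, h7⟩ := ihb loc (d + 1) σ₁ ρ (by rw [h4 1 hd, h1]) (by omega) hl0
      (fun i => (hld i).trans (by omega)) (fun i => by rw [h4 _ (hld i), hlρ]) (by omega) σ₁ pos₁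
      h2.1 (fun _ _ => rfl)
    have h8 : ∀ r < d, σ₂ r = σ₀ r := fun r hr => by rw [h7 r (by omega), h4 r hr]
    have h9 : σ₂ d = a.eval code x B ρ := by rw [h7 d (by omega), h3]
    by_cases hcond : a.eval code x B ρ = b.eval code x B ρ
    · obtain ⟨σ₃, pos₃, g1, g2, g3⟩ := ihc loc d σ₀ ρ h1 hd hl0 hld hlρ (by omega) σ₂ pos₂ h5.1 h8
      refine ⟨σ₃, pos₃, h2.seq (h5.seq (regExec_ifEq hB h5.1 (by omega) (by omega) (by omega)
        (by omega) (by omega) ?_)), ?_, g3⟩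
      · rw [if_pos (by rw [h9, h6, hcond])]
        exact g1
      · rw [g2, eval, if_pos hcond]
    · obtain ⟨σ₃, pos₃, g1, g2, g3⟩ := ihe loc d σ₀ ρ h1 hd hl0 hld hlρ (by omega) σ₂ pos₂ h5.1 h8
      refine ⟨σ₃, pos₃, h2.seq (h5.seq (regExec_ifEq hB h5.1 (by omega) (by omega) (by omega)
        (by omega) (by omega) ?_)), ?_, g3⟩
      · rw [if_neg (by rw [h9, h6]; exact hcond)]
        exact g1
      · rw [g2, eval, if_neg hcond]
  | loop n a b ihn iha ihb =>
    intro loc d σ₀ ρ h1 hd hl0 hld hlρ hw σ pos hv hσ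
    simp only [width] at hw
    have hwn := n.width_pos
    have hwa := a.width_pos
    have hwb := b.width_pos
    obtain ⟨σ₁, pos₁, h2, h3, h4⟩ := ihn loc d σ₀ ρ h1 hd hl0 hld hlρ (by omega) σ pos hv hσ
    obtain ⟨σ₂, pos₂, h5, h6, h7⟩ := iha loc (d + 2) σ₁ ρ (by rw [h4 1 hd, h1]) (by omega) hl0
      (fun i => (hld i).trans (by omega)) (fun i => by rw [h4 _ (hld i), hlρ]) (by omega) σ₁ pos₁
      h2.1 (fun _ _ => rfl)
    have h8 : ∀ r < d, σ₂ r = σ₀ r := fun r hr => by rw [h7 r (by omega), h4 r hr]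
    have h9 : σ₂ d = n.eval code x B ρ := by rw [h7 d (by omega), h3]
    have a3 := regExec_clear (T := T) (r := d + 1) hB h5.1 (by omega) (by omega)
    let F : ℕ → ℕ := fun j => Nat.rec (a.eval code x B ρ)
      (fun j v => b.eval code x B (Matrix.vecCons j (Matrix.vecCons v ρ))) j
    -- Register `d` holds the number of rounds, `d + 1` the finished rounds, `d + 2` the current
    -- value `F j`; the body delivers its result to `d + 3`.
    obtain ⟨⟨σ₃, pos₃⟩, g1, g2⟩ := exists_regExec_whileReg (x := x) (S := S) (T := T)
      (p := seq (b.compile code T (Matrix.vecCons (d + 1) (Matrix.vecCons (d + 2) loc)) (d + 3))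
          (seq (copy T (d + 3) (d + 2)) (inc T (d + 1)))) (r := d + 1) (r' := d)
      false (by omega) (by omega) (by omega) (by omega) (by omega) (n.eval code x B ρ) (fun _ => B)
      (fun j st => Valid B x st ∧ st.1 (d + 1) = j ∧ st.1 (d + 2) = F j ∧
        st.1 d = n.eval code x B ρ ∧ ∀ r < d, st.1 r = σ₀ r)
      (st₀ := (Function.update σ₂ (d + 1) 0, pos₂))
      ⟨a3.1, by simp, by simp [h6, F], by simp [h9], fun r hr => by
        dsimp only; rw [Function.update_of_ne (by omega), h8 r hr]⟩
      (fun _ _ => hB) (fun _ _ _ h => h.1)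
      (by
        rintro j hj ⟨τ, q⟩ ⟨b1, b2, b3, b4, b5⟩
        dsimp only at b2 b3 b4 b5
        refine ⟨by simp [b2, b4]; omega, ?_⟩
        obtain ⟨τ₁, q₁, c1, c2, c3⟩ := ihb (Matrix.vecCons (d + 1) (Matrix.vecCons (d + 2) loc))
          (d + 3) τ (Matrix.vecCons j (Matrix.vecCons (F j) ρ)) (by rw [b5 1 hd, h1]) (by omega)
          (fun i => by
            refine Fin.cases ?_ (fun i => Fin.cases ?_ (fun i => ?_) i) i
            · simp
            · simp
            · simpa using hl0 i)
          (fun i => by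
            refine Fin.cases ?_ (fun i => Fin.cases ?_ (fun i => ?_) i) i
            · simp
            · simp
            · have := hld i
              simp only [Matrix.cons_val_succ]; omega)
          (fun i => by
            refine Fin.cases ?_ (fun i => Fin.cases ?_ (fun i => ?_) i) i
            · simpa using b2
            · simpa using b3
            · simpa [b5 _ (hld i)] using hlρ i)
          (by omega) τ q b1 (fun _ _ => rfl)
        have d1 := regExec_copy (T := T) (r := d + 3) (d := d + 2) hB c1.1 (by omega) (by omega)
          (by omega) (by omega) (by omega)
        have hle : n.eval code x B ρ ≤ B := by rw [← b4]; exact b1.1 d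
        have e1 : τ₁ (d + 1) = j := by rw [c3 _ (by omega), b2]
        have d2 := regExec_inc (T := T) (r := d + 1) hB d1.1 (by omega) (by omega) (by
          rw [Function.update_of_ne (by omega), e1]; omega)
        refine ⟨_, c1.seq (d1.seq d2), d2.1, ?_, ?_, ?_, fun r hr => ?_⟩
        · simp [e1]
        · simp [c2, F]
        · simp [c3 d (by omega), b4]
        · dsimp only
          rw [Function.update_of_ne (by omega), Function.update_of_ne (by omega), c3 r (by omega),
            b5 r hr])
      (by rintro ⟨τ, q⟩ ⟨b1, b2, b3, b4, b5⟩; simp_all)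
    obtain ⟨b1, b2, b3, b4, b5⟩ := g2
    dsimp only at b2 b3 b4 b5
    have d1 := regExec_copy (T := T) (r := d + 2) (d := d) hB b1 (by omega) (by omega)
          (by omega) (by omega) (by omega)
    refine ⟨_, _, h2.seq (h5.seq (a3.seq (g1.seq d1))), ?_, fun r hr => ?_⟩
    · simp only [Function.update_self, b3, eval, F]
    · rw [Function.update_of_ne (by omega), b5 r hr]
  | @comp k m f g ihf ihg =>
    intro loc d σ₀ ρ h1 hd hl0 hld hlρ hw σ pos hv hσ
    simp only [width] at hw
    have hwf := f.width_pos
    obtain ⟨σ₁, pos₁, h2, h3, h4⟩ := computes_seqAll (x := x) (S := S) (B := B) (T := T)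
      (d := d + 1) (fun i => (g i).compile code T loc (d + 1 + i)) σ
      (fun i => (g i).eval code x B ρ) hS
      (fun i τ hτ => by
        have hle : (g i).width ≤ ∑ i, (g i).width :=
          Finset.single_le_sum (f := fun i => (g i).width) (fun _ _ => Nat.zero_le _)
            (Finset.mem_univ i)
        have hi := i.2
        exact ihg i loc (d + 1 + i) τ ρ (by rw [hτ 1 (by omega), hσ 1 hd, h1]) (by omega) hl0
          (fun j => (hld j).trans_le (by omega))
          (fun j => by rw [hτ _ ((hld j).trans (by omega)), hσ _ (hld j), hlρ]) (by omega))
      σ pos hv (fun _ _ => rfl)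
    obtain ⟨σ₂, pos₂, h5, h6, h7⟩ := ihf (fun i => d + 1 + i) (d + 1 + m) σ₁
      (fun i => (g i).eval code x B ρ) (by rw [h4 1 (by omega), hσ 1 hd, h1]) (by omega)
      (fun i => by omega) (fun i => by have := i.2; omega) h3 (by omega) σ₁ pos₁ h2.1
      (fun _ _ => rfl)
    have d1 := regExec_copy (T := T) (r := d + 1 + m) (d := d) hB h5.1 (by omega) (by omega)
      (by omega) (by omega) (by omega)
    refine ⟨_, _, h2.seq (h5.seq d1), ?_, fun r hr => ?_⟩
    · simp only [Function.update_self, h6, eval]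
    · rw [Function.update_of_ne (by omega), h7 r (by omega), h4 r (by omega), hσ r hr]

/-- The program that finds a cap above the value of `req` and then evaluates `dec`. -/
def decideProg (code : InSym I → ℕ) (T : ℕ) (req dec : Fn 0) : Prog I Cell (T + 1) :=
  seq (init T) (seq (addCode T 1 (fun _ => 16) 16) (seq (req.compile code T Fin.elim0 2)
    (seq (whileReg true 2 1 (seq (inc T 1) (req.compile code T Fin.elim0 2)))
      (seq (dec.compile code T Fin.elim0 2) (seq (clear T 3) (seq (inc T 3) (eqReg T 2 3)))))))

/-- The machine that decides whether `dec` has the value `1` for a cap above the value of `req`. -/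
def decider (code : InSym I → ℕ) (req dec : Fn 0) : Machine I :=
  (decideProg code (req.width + dec.width + 3) req dec).toMachine none
    fun s => decide (s 0 = some (some true))

/-- The caps `16, 17, …` are tried up to the first one that differs from the value of `req`. The
search does not pass `B₀`, so every register fits into the size of `B₀`, with one cell for the
marker and one for the blank behind the number. -/
theorem decider_spec (code : InSym I → ℕ) (hcode : ∀ a, code a ≤ 16) (req dec : Fn 0) (x : List I)
    {B₀ : ℕ} (hB₀ : 16 ≤ B₀) (hreq : req.eval code x B₀ Fin.elim0 ≠ B₀) :
    ∃ B, 16 ≤ B ∧ B ≤ B₀ ∧ req.eval code x B Fin.elim0 ≠ B ∧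
      (decider code req dec).HaltsWith x (decide (dec.eval code x B Fin.elim0 = 1)) ∧
      (decider code req dec).UsesSpace x (B₀.size + 2) := by
  classical
  set T := req.width + dec.width + 3 with hT
  set S := B₀.size + 2 with hS
  have hex : ∃ N, req.eval code x (16 + N) Fin.elim0 ≠ 16 + N := ⟨B₀ - 16, by
    rwa [show 16 + (B₀ - 16) = B₀ by omega]⟩
  set N := Nat.find hex with hN
  have hNB : N ≤ B₀ - 16 := Nat.find_min' hex (by rwa [show 16 + (B₀ - 16) = B₀ by omega])
  have hNspec : req.eval code x (16 + N) Fin.elim0 ≠ 16 + N := Nat.find_spec hex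
  have hNmin : ∀ j < N, req.eval code x (16 + j) Fin.elim0 = 16 + j := fun j hj => by
    simpa using Nat.find_min hex hj
  have hBd : ∀ j ≤ N, (16 + j).size + 1 < S := fun j hj => by
    have := Nat.size_le_size (show 16 + j ≤ B₀ by omega)
    omega
  have hcomp : ∀ (e : Fn 0), 2 + e.width ≤ T + 1 → ∀ j ≤ N, ∀ σ pos, σ 1 = 16 + j →
      Valid (16 + j) x (σ, pos) → ∃ σ' pos',
        RegExec x S (16 + j) (e.compile code T Fin.elim0 2) (σ, pos) (σ', pos') ∧
        σ' 2 = e.eval code x (16 + j) Fin.elim0 ∧ σ' 1 = 16 + j := by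
    intro e he j hj σ pos h1 hv
    obtain ⟨σ', pos', h2, h3, h4⟩ := computes_compile (S := S) (T := T) code hcode (by omega)
      (hBd j hj) e Fin.elim0 2 σ Fin.elim0 h1 (by omega) (fun i => i.elim0) (fun i => i.elim0)
      (fun i => i.elim0) he σ pos hv (fun _ _ => rfl)
    exact ⟨σ', pos', h2, h3, by rw [h4 1 (by omega), h1]⟩
  have hv0 : Valid (16 + 0) x ((fun _ => 0, 0) : (ℕ → ℕ) × ℕ) :=
    ⟨fun _ => Nat.zero_le _, Nat.zero_le _⟩
  have a1 := exec_init (T := T) (x := x) (S := S) (by omega)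
  have a2 := regExec_addCode (T := T) (d := 1) (fun _ => 16) 16 (hBd 0 (by omega)) hv0 (by omega)
    (by omega) (by simp)
  obtain ⟨σ₁, pos₁, a3, a4, a5⟩ := hcomp req (by omega) 0 (by omega) _ _ (by simp) a2.1
  obtain ⟨⟨σ₂, pos₂⟩, a6, a7⟩ := exists_regExec_whileReg (x := x) (S := S) (T := T)
    (p := seq (inc T 1) (req.compile code T Fin.elim0 2)) (r := 2) (r' := 1) true (by omega)
    (by omega) (by omega) (by omega) (by omega) N (fun j => 16 + j)
    (fun j st => Valid (16 + j) x st ∧ st.1 2 = req.eval code x (16 + j) Fin.elim0 ∧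
      st.1 1 = 16 + j) (st₀ := (σ₁, pos₁)) ⟨a3.1, a4, a5⟩ hBd (fun _ _ _ h => h.1)
    (by
      rintro j hj ⟨τ, q⟩ ⟨b1, b2, b3⟩
      dsimp only at b2 b3
      refine ⟨by simp [b2, b3, hNmin j hj], ?_⟩
      have b1' : Valid (16 + (j + 1)) x (τ, q) := ⟨fun r => (b1.1 r).trans (by omega), b1.2⟩
      have c1 := regExec_inc (T := T) (r := 1) (hBd (j + 1) (by omega)) b1' (by omega) (by omega)
        (by omega)
      obtain ⟨τ', q', c2, c3, c4⟩ := hcomp req (by omega) (j + 1) (by omega) _ _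
        (by simp [b3, Nat.add_assoc]) c1.1
      exact ⟨(τ', q'), c1.seq c2, c2.1, c3, c4⟩)
    (by
      rintro ⟨τ, q⟩ ⟨b1, b2, b3⟩
      dsimp only at b2 b3
      simpa [b2, b3] using hNspec)
  obtain ⟨a8, a9, a10⟩ := a7
  obtain ⟨σ₃, pos₃, c1, c2, c3⟩ := hcomp dec (by omega) N le_rfl σ₂ pos₂ a10 a8
  have c4 := regExec_clear (T := T) (r := 3) (hBd N le_rfl) c1.1 (by omega) (by omega)
  have c5 := regExec_inc (T := T) (r := 3) (hBd N le_rfl) c4.1 (by omega) (by omega) (by simp; omega)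
  have hrun : ∃ σ' fl', (decideProg code T req dec).Exec x S (initMem none)
      (regMem T (σ', pos₃) fl') ∧ fl' = decide (dec.eval code x (16 + N) Fin.elim0 = 1) := by
    obtain ⟨f1, d1⟩ := a2.2 false
    obtain ⟨f2, d2⟩ := a3.2 f1
    obtain ⟨f3, d3⟩ := a6.2 f2
    obtain ⟨f4, d4⟩ := c1.2 f3
    obtain ⟨f5, d5⟩ := c4.2 f4
    obtain ⟨f6, d6⟩ := c5.2 f5
    have d7 := exec_eqReg (T := T) (r := 2) (r' := 3) (fl := f6) (hBd N le_rfl) c5.1 (by omega)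
      (by omega) (by omega) (by omega) (by omega)
    exact ⟨_, _, a1.seq (d1.seq (d2.seq (d3.seq (d4.seq (d5.seq (d6.seq d7)))))), by simp [c2]⟩
  obtain ⟨σ', fl', hrun, hfl⟩ := hrun
  refine ⟨16 + N, by omega, by omega, hNspec, ?_, hrun.usesSpace c1.1.2⟩
  have := hrun.haltsWith (ver := fun s => decide (s 0 = some (some true))) c1.1.2
  simp only [syms_regMem_zero, hfl, Option.some.injEq, decide_eq_true_eq] at this
  exact this

end Fn

end SpaceTM


/-! ## Arithmetic -/

namespace SpaceTM

namespace Fn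

variable {I : Type} {code : InSym I → ℕ} {x : List I} {B k : ℕ} {ρ : Fin k → ℕ}

theorem loop_induction {n a : Fn k} {b : Fn (k + 2)} (P : ℕ → ℕ → Prop)
    (h0 : P 0 (a.eval code x B ρ))
    (hs : ∀ j v, j < n.eval code x B ρ → P j v →
      P (j + 1) (b.eval code x B (Matrix.vecCons j (Matrix.vecCons v ρ)))) :
    P (n.eval code x B ρ) ((loop n a b).eval code x B ρ) := by
  simp only [eval]
  have key : ∀ N ≤ n.eval code x B ρ, P N (Nat.rec (a.eval code x B ρ)
      (fun j v => b.eval code x B (Matrix.vecCons j (Matrix.vecCons v ρ))) N) := by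
    intro N
    induction N with
    | zero => exact fun _ => h0
    | succ N ih => exact fun h => hs N _ (by omega) (ih (by omega))
  exact key _ le_rfl

theorem eval_ifEq_pos {a b c d : Fn k} (h : a.eval code x B ρ = b.eval code x B ρ) :
    (ifEq a b c d).eval code x B ρ = c.eval code x B ρ := if_pos h

theorem eval_ifEq_neg {a b c d : Fn k} (h : a.eval code x B ρ ≠ b.eval code x B ρ) :
    (ifEq a b c d).eval code x B ρ = d.eval code x B ρ := if_neg h

/-- Composition with a function of one argument. -/
def app₁ (f : Fn 1) (a : Fn k) : Fn k := comp f ![a]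
/-- Composition with a function of two arguments. -/
def app₂ (f : Fn 2) (a b : Fn k) : Fn k := comp f ![a, b]
/-- Composition with a function of three arguments. -/
def app₃ (f : Fn 3) (a b c : Fn k) : Fn k := comp f ![a, b, c]
/-- Composition with a function of four arguments. -/
def app₄ (f : Fn 4) (a b c d : Fn k) : Fn k := comp f ![a, b, c, d]
/-- A constant function. -/
def app₀ (f : Fn 0) : Fn k := comp f ![]

@[simp] theorem eval_app₀ (f : Fn 0) :
    (app₀ f).eval code x B ρ = f.eval code x B ![] := by
  simp only [app₀, eval]
  congr 1
  funext i
  exact i.elim0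

@[simp] theorem eval_app₁ (f : Fn 1) (a : Fn k) :
    (app₁ f a).eval code x B ρ = f.eval code x B ![a.eval code x B ρ] := by
  simp only [app₁, eval]
  congr 1
  funext i
  fin_cases i
  rfl

@[simp] theorem eval_app₂ (f : Fn 2) (a b : Fn k) :
    (app₂ f a b).eval code x B ρ = f.eval code x B ![a.eval code x B ρ, b.eval code x B ρ] := by
  simp only [app₂, eval]
  congr 1
  funext i
  fin_cases i <;> rfl

@[simp] theorem eval_app₃ (f : Fn 3) (a b c : Fn k) : (app₃ f a b c).eval code x B ρ =
    f.eval code x B ![a.eval code x B ρ, b.eval code x B ρ, c.eval code x B ρ] := by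
  simp only [app₃, eval]
  congr 1
  funext i
  fin_cases i <;> rfl

@[simp] theorem eval_app₄ (f : Fn 4) (a b c d : Fn k) : (app₄ f a b c d).eval code x B ρ =
    f.eval code x B ![a.eval code x B ρ, b.eval code x B ρ, c.eval code x B ρ,
      d.eval code x B ρ] := by
  simp only [app₄, eval]
  congr 1
  funext i
  fin_cases i <;> rfl

/-- Numerals. -/
def num : ℕ → Fn k
  | 0 => zero
  | n + 1 => succ (num n)

@[simp] theorem eval_num (n : ℕ) : (num n : Fn k).eval code x B ρ = min n B := by
  induction n with
  | zero => simp [num, eval]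
  | succ n ih => simp only [num, eval, ih]; omega

/-- Saturating addition. -/
def add (a b : Fn k) : Fn k := app₂ (loop (var 1) (var 0) (succ (var 1))) a b

theorem eval_add_min {a b : Fn k} (ha : a.eval code x B ρ ≤ B) :
    (add a b).eval code x B ρ = min (a.eval code x B ρ + b.eval code x B ρ) B := by
  rw [add, eval_app₂]
  refine loop_induction (n := var 1) (fun j v => v = min (a.eval code x B ρ + j) B) ?_ ?_
  · simpa [eval] using ha
  · rintro j v - rfl
    simp only [eval, Matrix.cons_val]
    omega

/-- Saturating multiplication. -/
def mul (a b : Fn k) : Fn k := app₂ (loop (var 1) zero (add (var 1) (var 2))) a b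

theorem eval_mul_min {a b : Fn k} :
    (mul a b).eval code x B ρ = min (a.eval code x B ρ * b.eval code x B ρ) B := by
  rw [mul, eval_app₂]
  refine loop_induction (n := var 1) (fun j v => v = min (a.eval code x B ρ * j) B) ?_ ?_
  · simp [eval]
  · rintro j v - rfl
    rw [eval_add_min (by simp [eval])]
    simp only [eval, Matrix.cons_val, Nat.mul_succ]
    omega

/-- A product that has reached the cap stays there, unless the next factor is `0`; so cutting off
early changes nothing. -/
theorem min_min_mul (p a B : ℕ) : min (min p B * a) B = min (p * a) B := by
  rcases Nat.eq_zero_or_pos a with rfl | ha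
  · simp
  rcases le_total p B with h | h
  · rw [min_eq_left h]
  · rw [min_eq_right h, min_eq_right (Nat.le_mul_of_pos_right _ ha),
      min_eq_right (h.trans (Nat.le_mul_of_pos_right _ ha))]

/-- Saturating exponentiation. -/
def pow (a b : Fn k) : Fn k := app₂ (loop (var 1) (num 1) (mul (var 1) (var 2))) a b

theorem eval_pow_min {a b : Fn k} :
    (pow a b).eval code x B ρ = min (a.eval code x B ρ ^ b.eval code x B ρ) B := by
  rw [pow, eval_app₂]
  refine loop_induction (n := var 1) (fun j v => v = min (a.eval code x B ρ ^ j) B) ?_ ?_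
  · simp
  · rintro j v - rfl
    rw [eval_mul_min]
    simp only [eval, Matrix.cons_val, pow_succ]
    exact min_min_mul _ _ _

section Exact

variable {a b : Fn k} {u v : ℕ}

theorem eval_num_eq {n : ℕ} (h : n ≤ B) : (num n : Fn k).eval code x B ρ = n := by simp [h]

theorem eval_succ_eq (ha : a.eval code x B ρ = u) (h : u + 1 ≤ B) :
    (succ a).eval code x B ρ = u + 1 := by
  simp [eval, ha, h]

theorem eval_add_eq (ha : a.eval code x B ρ = u) (hb : b.eval code x B ρ = v) (h : u + v ≤ B) :
    (add a b).eval code x B ρ = u + v := by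
  rw [eval_add_min (by omega), ha, hb, min_eq_left h]

theorem eval_mul_eq (ha : a.eval code x B ρ = u) (hb : b.eval code x B ρ = v) (h : u * v ≤ B) :
    (mul a b).eval code x B ρ = u * v := by
  rw [eval_mul_min, ha, hb, min_eq_left h]

theorem eval_pow_eq (ha : a.eval code x B ρ = u) (hb : b.eval code x B ρ = v) (h : u ^ v ≤ B) :
    (pow a b).eval code x B ρ = u ^ v := by
  rw [eval_pow_min, ha, hb, min_eq_left h]

/-- Truncated subtraction. -/
def sub (a b : Fn k) : Fn k :=
  app₂ (loop (var 1) (var 0) (app₁ (loop (var 0) zero (var 0)) (var 1))) a b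

/-- The inner loop is the predecessor: its body returns the number of finished rounds, so the last
round yields one less than the argument. -/
theorem eval_sub_eq (ha : a.eval code x B ρ = u) (hb : b.eval code x B ρ = v) :
    (sub a b).eval code x B ρ = u - v := by
  rw [sub, eval_app₂, ha, hb]
  refine loop_induction (n := var 1) (fun j w => w = u - j) ?_ ?_
  · simp [eval]
  · rintro j w - rfl
    simp only [eval_app₁, eval, Matrix.cons_val]
    rcases h : u - j with _ | d
    · simp; omega
    · simp; omega

/-- The truth value of `a ≤ b`. -/
def le (a b : Fn k) : Fn k := ifEq (sub a b) zero (num 1) zero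

theorem eval_le_eq (hB : 1 ≤ B) (ha : a.eval code x B ρ = u) (hb : b.eval code x B ρ = v) :
    (le a b).eval code x B ρ = if u ≤ v then 1 else 0 := by
  simp only [le, eval, eval_sub_eq ha hb, eval_num, min_eq_left hB, Nat.sub_eq_zero_iff_le]

/-- The truth value of `a < b`. -/
def lt (a b : Fn k) : Fn k := ifEq (sub b a) zero zero (num 1)

theorem eval_lt_eq (hB : 1 ≤ B) (ha : a.eval code x B ρ = u) (hb : b.eval code x B ρ = v) :
    (lt a b).eval code x B ρ = if u < v then 1 else 0 := by
  simp only [lt, eval, eval_sub_eq hb ha, eval_num, min_eq_left hB, Nat.sub_eq_zero_iff_le]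
  split_ifs <;> first | rfl | omega

end Exact

section Binders

/-- Adding a variable for the value of a loop. -/
def weaken (b : Fn (k + 1)) : Fn (k + 2) :=
  comp b (Matrix.vecCons (var 0) fun i => var i.succ.succ)

theorem eval_weaken (b : Fn (k + 1)) (j v : ℕ) :
    (weaken b).eval code x B (Matrix.vecCons j (Matrix.vecCons v ρ)) =
      b.eval code x B (Matrix.vecCons j ρ) := by
  simp only [weaken, eval]
  congr 1
  funext i
  refine Fin.cases ?_ (fun i => ?_) i
  · simp [eval]
  · simp [eval]

/-- The sum of the values of `b` for the numbers below `n`. -/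
def sum (n : Fn k) (b : Fn (k + 1)) : Fn k := loop n zero (add (var 1) (weaken b))

theorem eval_sum_eq {n : Fn k} {b : Fn (k + 1)} {N : ℕ} (f : ℕ → ℕ)
    (hn : n.eval code x B ρ = N)
    (hb : ∀ j < N, b.eval code x B (Matrix.vecCons j ρ) = f j)
    (h : ∑ j ∈ Finset.range N, f j ≤ B) :
    (sum n b).eval code x B ρ = ∑ j ∈ Finset.range N, f j := by
  have key := loop_induction (code := code) (x := x) (B := B) (ρ := ρ) (n := n) (a := zero)
    (b := add (var 1) (weaken b)) (fun j v => j ≤ N → v = ∑ i ∈ Finset.range j, f i)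
    (by simp [eval]) (by
      intro j v hj ih hjN
      rw [hn] at hj
      have ih := ih hj.le
      have hle : ∑ i ∈ Finset.range (j + 1), f i ≤ B := le_trans
        (Finset.sum_le_sum_of_subset (Finset.range_mono hjN)) h
      rw [Finset.sum_range_succ] at hle ⊢
      refine eval_add_eq ?_ ?_ hle
      · simp [eval, ih]
      · rw [eval_weaken, hb j hj])
  exact hn ▸ key hn.le

open Classical in
/-- The truth value of `P`. -/
noncomputable def truth (P : Prop) : ℕ := if P then 1 else 0

theorem truth_eq_one {P : Prop} : truth P = 1 ↔ P := by
  unfold truth; split_ifs <;> simp [*]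

theorem truth_congr {P Q : Prop} (h : P ↔ Q) : truth P = truth Q := by
  rw [propext h]

theorem eval_ifTrue_pos (hB : 1 ≤ B) {a c d : Fn k} {P : Prop} (ha : a.eval code x B ρ = truth P)
    (hP : P) : (ifEq a (num 1) c d).eval code x B ρ = c.eval code x B ρ :=
  eval_ifEq_pos (by rw [ha, eval_num_eq hB, truth_eq_one.2 hP])

theorem eval_ifTrue_neg (hB : 1 ≤ B) {a c d : Fn k} {P : Prop} (ha : a.eval code x B ρ = truth P)
    (hP : ¬ P) : (ifEq a (num 1) c d).eval code x B ρ = d.eval code x B ρ :=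
  eval_ifEq_neg (by rw [ha, eval_num_eq hB]; exact fun h => hP (truth_eq_one.1 h))

/-- Whether `b` has the value `1` for some number below `n`. -/
def ex (n : Fn k) (b : Fn (k + 1)) : Fn k :=
  loop n zero (ifEq (weaken b) (num 1) (num 1) (var 1))

theorem eval_ex (hB : 1 ≤ B) {n : Fn k} {b : Fn (k + 1)} {N : ℕ} (P : ℕ → Prop)
    (hn : n.eval code x B ρ = N)
    (hb : ∀ j < N, b.eval code x B (Matrix.vecCons j ρ) = truth (P j)) :
    (ex n b).eval code x B ρ = truth (∃ j < N, P j) := by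
  have key := loop_induction (code := code) (x := x) (B := B) (ρ := ρ) (n := n) (a := zero)
    (b := ifEq (weaken b) (num 1) (num 1) (var 1)) (fun j v => v = truth (∃ i < j, P i))
    (by simp [eval, truth]) (by
      rintro j v hj rfl
      rw [hn] at hj
      have hb' := (eval_weaken b j (truth (∃ i < j, P i))).trans (hb j hj)
      by_cases hP : P j
      · rw [eval_ifTrue_pos hB hb' hP, eval_num_eq hB, eq_comm, truth_eq_one]
        exact ⟨j, by omega, hP⟩
      · rw [eval_ifTrue_neg hB hb' hP]
        refine truth_congr ⟨fun ⟨i, hi, h⟩ => ⟨i, by omega, h⟩, fun ⟨i, hi, h⟩ => ⟨i, ?_, h⟩⟩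
        rcases Nat.lt_succ_iff_lt_or_eq.1 hi with h' | rfl
        · exact h'
        · exact absurd h hP)
  rw [hn] at key
  exact key

/-- Whether `b` has the value `1` for all numbers below `n`. -/
def all (n : Fn k) (b : Fn (k + 1)) : Fn k :=
  loop n (num 1) (ifEq (weaken b) (num 1) (var 1) zero)

theorem eval_all (hB : 1 ≤ B) {n : Fn k} {b : Fn (k + 1)} {N : ℕ} (P : ℕ → Prop)
    (hn : n.eval code x B ρ = N)
    (hb : ∀ j < N, b.eval code x B (Matrix.vecCons j ρ) = truth (P j)) :
    (all n b).eval code x B ρ = truth (∀ j < N, P j) := by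
  have key := loop_induction (code := code) (x := x) (B := B) (ρ := ρ) (n := n) (a := num 1)
    (b := ifEq (weaken b) (num 1) (var 1) zero) (fun j v => v = truth (∀ i < j, P i))
    (by simp [truth, hB]) (by
      rintro j v hj rfl
      rw [hn] at hj
      have hb' := (eval_weaken b j (truth (∀ i < j, P i))).trans (hb j hj)
      by_cases hP : P j
      · rw [eval_ifTrue_pos hB hb' hP]
        refine truth_congr ⟨fun h i hi => ?_, fun h i hi => h i (by omega)⟩
        rcases Nat.lt_succ_iff_lt_or_eq.1 hi with h' | rfl
        · exact h i h'
        · exact hP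
      · have h0 : truth (∀ i < j + 1, P i) = 0 := if_neg fun h => hP (h j (by omega))
        rw [eval_ifTrue_neg hB hb' hP, h0]
        rfl)
  rw [hn] at key
  exact key

/-- The truth value of an equation. -/
def eq (a b : Fn k) : Fn k := ifEq a b (num 1) zero

theorem eval_eq (hB : 1 ≤ B) {a b : Fn k} {u v : ℕ} (ha : a.eval code x B ρ = u)
    (hb : b.eval code x B ρ = v) : (eq a b).eval code x B ρ = truth (u = v) := by
  by_cases h : u = v
  · rw [eq, eval_ifEq_pos (by rw [ha, hb, h]), eval_num_eq hB, truth_eq_one.2 h]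
  · rw [eq, eval_ifEq_neg (by rw [ha, hb]; exact h), truth, if_neg h]
    rfl

/-- Conjunction. -/
def and (a b : Fn k) : Fn k := ifEq a (num 1) b zero

theorem eval_and (hB : 1 ≤ B) {a b : Fn k} {P Q : Prop} (ha : a.eval code x B ρ = truth P)
    (hb : P → b.eval code x B ρ = truth Q) : (and a b).eval code x B ρ = truth (P ∧ Q) := by
  by_cases hP : P
  · rw [and, eval_ifTrue_pos hB ha hP, hb hP]; exact truth_congr (by simp [hP])
  · rw [and, eval_ifTrue_neg hB ha hP]; simp [truth, hP, eval]

/-- Division. -/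
def div (a b : Fn k) : Fn k :=
  app₂ (sum (var 0) (le (mul (succ (var 0)) (var 2)) (var 1))) a b

/-- The quotient counts the positive multiples of `v` up to `u`. -/
theorem sum_ite_mul_le (u v : ℕ) (hv : 0 < v) :
    (∑ j ∈ Finset.range u, if (j + 1) * v ≤ u then 1 else 0) = u / v := by
  have : ∀ j, (j + 1) * v ≤ u ↔ j < u / v := fun j => by
    rw [← Nat.le_div_iff_mul_le hv, Nat.succ_le_iff]
  simp only [this]
  rw [← Finset.card_filter]
  have h2 : (Finset.range u).filter (fun j => j < u / v) = Finset.range (u / v) := by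
    ext j
    have := Nat.div_le_self u v
    simp only [Finset.mem_filter, Finset.mem_range]
    omega
  rw [h2, Finset.card_range]

theorem eval_div_eq {a b : Fn k} {u v : ℕ} (ha : a.eval code x B ρ = u)
    (hb : b.eval code x B ρ = v) (hv : 0 < v) (hu : u < B) :
    (div a b).eval code x B ρ = u / v := by
  rw [div, eval_app₂, ha, hb, ← sum_ite_mul_le u v hv]
  refine eval_sum_eq _ (by simp [eval]) (fun j hj => ?_) ?_
  -- The product may saturate, but as `u < B` its comparison with `u` is still correct.
  · rw [eval_le_eq (u := min ((j + 1) * v) B) (v := u) (by omega) ?_ (by simp [eval])]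
    · congr 1
      simp only [eq_iff_iff]
      omega
    · rw [eval_mul_min, eval_succ_eq (u := j) (by simp [eval]) (by omega)]
      simp [eval]
  · rw [sum_ite_mul_le u v hv]
    exact (Nat.div_le_self _ _).trans hu.le

/-- Remainder. -/
def mod (a b : Fn k) : Fn k := sub a (mul b (div a b))

theorem eval_mod_eq {a b : Fn k} {u v : ℕ} (ha : a.eval code x B ρ = u)
    (hb : b.eval code x B ρ = v) (hv : 0 < v) (hu : u < B) :
    (mod a b).eval code x B ρ = u % v := by
  rw [mod, eval_sub_eq ha (eval_mul_eq hb (eval_div_eq ha hb hv hu) ?_)]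
  · have := Nat.div_add_mod u v
    omega
  · exact (Nat.mul_div_le u v).trans hu.le

end Binders

end Fn

end SpaceTM


/-! ## Reachability by recursive bisection -/

namespace SpaceTM

namespace Bisection

open Fn

/-- There is a path of `2 ^ j` edges from `u` to `v` in the graph `E` on the numbers below `V`. -/
def Path (V : ℕ) (E : ℕ → ℕ → Prop) : ℕ → ℕ → ℕ → Prop
  | 0, u, v => E u v
  | j + 1, u, v => ∃ d < V, Path V E j u d ∧ Path V E j d v

/-- The start of the edge that is examined; a digit `t h` stands for the midpoint `t h / 2` at
height `h` and for the left or right half according to its parity. -/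
def leftEnd (t : ℕ → ℕ) : ℕ → ℕ → ℕ
  | 0, u => u
  | j + 1, u => leftEnd t j (if t j % 2 = 0 then u else t j / 2)

/-- The end of the edge that is examined. -/
def rightEnd (t : ℕ → ℕ) : ℕ → ℕ → ℕ
  | 0, v => v
  | j + 1, v => rightEnd t j (if t j % 2 = 0 then t j / 2 else v)

/-- What happens at the next larger height, with digit `t` and place value `P`, after the outcome
`o`; outcomes are `0` for failure, `1` for success, and `2 + g` for continuing with `g`. -/
def combine (V P t o : ℕ) : ℕ :=
  if o = 0 then (if t / 2 + 1 < V then 2 + 2 * (t / 2 + 1) * P else 0)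
  else if o = 1 then (if t % 2 = 0 then 2 + (t + 1) * P else 1) else o + t * P

/-- The outcome at height `j` if that at height `0` is `o`. -/
def raise (V : ℕ) (t : ℕ → ℕ) : ℕ → ℕ → ℕ
  | 0, o => o
  | j + 1, o => combine V ((2 * V) ^ j) (t j) (raise V t j o)

/-- The outcome at height `j` with end points `u` and `v`. -/
noncomputable def outcome (V : ℕ) (E : ℕ → ℕ → Prop) (j u v : ℕ) (t : ℕ → ℕ) : ℕ :=
  raise V t j (truth (E (leftEnd t j u) (rightEnd t j v)))

/-- The digits of the state of the search. -/
def digit (V g h : ℕ) : ℕ := g / (2 * V) ^ h % (2 * V)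

/-- One step of the search. -/
noncomputable def step (V : ℕ) (E : ℕ → ℕ → Prop) (j u v c : ℕ) : ℕ :=
  if c < 2 then c else outcome V E j u v (digit V (c - 2))

variable {V : ℕ} {E : ℕ → ℕ → Prop}

theorem leftEnd_congr {t t' : ℕ → ℕ} {j : ℕ} (h : ∀ i < j, t i = t' i) (u : ℕ) :
    leftEnd t j u = leftEnd t' j u := by
  induction j generalizing u with
  | zero => rfl
  | succ j ih => simp only [leftEnd, h j (by omega)]; exact ih (fun i hi => h i (by omega)) _

theorem rightEnd_congr {t t' : ℕ → ℕ} {j : ℕ} (h : ∀ i < j, t i = t' i) (u : ℕ) :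
    rightEnd t j u = rightEnd t' j u := by
  induction j generalizing u with
  | zero => rfl
  | succ j ih => simp only [rightEnd, h j (by omega)]; exact ih (fun i hi => h i (by omega)) _

theorem raise_congr {t t' : ℕ → ℕ} {j : ℕ} (h : ∀ i < j, t i = t' i) (o : ℕ) :
    raise V t j o = raise V t' j o := by
  induction j with
  | zero => rfl
  | succ j ih => simp only [raise, h j (by omega), ih (fun i hi => h i (by omega))]

theorem digit_lt (hV : 0 < V) (g h : ℕ) : digit V g h < 2 * V := Nat.mod_lt _ (by omega)

theorem digit_top {T r j : ℕ} (hT : T < 2 * V) (hr : r < (2 * V) ^ j) :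
    digit V (T * (2 * V) ^ j + r) j = T := by
  have hP : 0 < (2 * V) ^ j := by omega
  rw [digit, Nat.add_comm, Nat.add_mul_div_right _ _ hP, Nat.div_eq_of_lt hr, Nat.zero_add,
    Nat.mod_eq_of_lt hT]

theorem digit_rest (hV : 0 < V) {T r j h : ℕ} (hh : h < j) :
    digit V (T * (2 * V) ^ j + r) h = digit V r h := by
  obtain ⟨i, rfl⟩ : ∃ i, j = h + 1 + i := ⟨j - h - 1, by omega⟩
  have hP : 0 < (2 * V) ^ h := pow_pos (by omega) _
  have : T * (2 * V) ^ (h + 1 + i) = (T * (2 * V) ^ i * (2 * V)) * (2 * V) ^ h := by ring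
  rw [digit, digit, this, Nat.add_comm, Nat.add_mul_div_right _ _ hP, Nat.add_mul_mod_self_right]

/-- The top digit fixes the midpoint and the half; the remaining digits describe the search one
height lower between the end points of that half. -/
theorem outcome_succ (hV : 0 < V) {T r j : ℕ} (hT : T < 2 * V) (hr : r < (2 * V) ^ j) (u v : ℕ) :
    outcome V E (j + 1) u v (digit V (T * (2 * V) ^ j + r)) =
      combine V ((2 * V) ^ j) T (outcome V E j (if T % 2 = 0 then u else T / 2)
        (if T % 2 = 0 then T / 2 else v) (digit V r)) := by
  have h : ∀ i < j, digit V (T * (2 * V) ^ j + r) i = digit V r i := fun i hi =>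
    digit_rest hV hi
  simp only [outcome, raise, leftEnd, rightEnd, digit_top hT hr]
  rw [leftEnd_congr h, rightEnd_congr h, raise_congr h]

/-- Every outcome that does not end the search is a larger state: failure leads to the next
midpoint, success in the left half to the right half, both with zero lower digits, and otherwise the
lower digits grow. Termination rests on this. -/
theorem combine_bound {T r P o : ℕ} (hT : T < 2 * V) (hr : r < P)
    (ho : o < 2 ∨ 2 + r < o ∧ o < 2 + P) :
    combine V P T o < 2 ∨ 2 + (T * P + r) < combine V P T o ∧ combine V P T o < 2 + 2 * V * P := by
  have hTP : (T + 1) * P ≤ 2 * V * P := Nat.mul_le_mul_right _ hT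
  have e1 : (T + 1) * P = T * P + P := by ring
  unfold combine
  split_ifs with h1 h2 h3 h4
  · right
    have h5 : (T + 1) * P ≤ 2 * (T / 2 + 1) * P := Nat.mul_le_mul_right _ (by omega)
    have h6 : (2 * (T / 2 + 1) + 1) * P ≤ 2 * V * P := Nat.mul_le_mul_right _ (by omega)
    have e2 : (2 * (T / 2 + 1) + 1) * P = 2 * (T / 2 + 1) * P + P := by ring
    omega
  · left; omega
  · right
    have h6 : (T + 1 + 1) * P ≤ 2 * V * P := Nat.mul_le_mul_right _ (by omega)
    have e2 : (T + 1 + 1) * P = (T + 1) * P + P := by ring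
    omega
  · left; omega
  · right
    omega

theorem outcome_bound (hV : 0 < V) (j u v r : ℕ) (hr : r < (2 * V) ^ j) :
    outcome V E j u v (digit V r) < 2 ∨ 2 + r < outcome V E j u v (digit V r) ∧
      outcome V E j u v (digit V r) < 2 + (2 * V) ^ j := by
  induction j generalizing u v r with
  | zero =>
    left
    simp only [outcome, raise, truth]
    split_ifs <;> omega
  | succ j ih =>
    have hP : 0 < (2 * V) ^ j := pow_pos (by omega) _
    have e := Nat.div_add_mod' r ((2 * V) ^ j)
    have hT : r / (2 * V) ^ j < 2 * V := by
      rw [Nat.div_lt_iff_lt_mul hP, ← pow_succ']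
      exact hr
    have hr' := Nat.mod_lt r hP
    have key := combine_bound hT hr' (ih (if r / (2 * V) ^ j % 2 = 0 then u else r / (2 * V) ^ j / 2)
      (if r / (2 * V) ^ j % 2 = 0 then r / (2 * V) ^ j / 2 else v) _ hr')
    rw [← outcome_succ hV hT hr', e, ← pow_succ'] at key
    exact key

theorem step_of_lt {j u v c : ℕ} (hc : c < 2) : step V E j u v c = c := if_pos hc

theorem iterate_step_of_lt {j u v c : ℕ} (hc : c < 2) (n : ℕ) :
    (step V E j u v)^[n] c = c := Function.iterate_fixed (step_of_lt hc) n

theorem step_two_add (j u v r : ℕ) :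
    step V E j u v (2 + r) = outcome V E j u v (digit V r) := by
  rw [step, if_neg (by omega), Nat.add_sub_cancel_left]

/-- While the top digit stays, the search simulates the one at the next lower height; the step in
which the latter ends applies `combine` to its answer. -/
theorem exists_iterate_combine (hV : 0 < V) {T j : ℕ} (hT : T < 2 * V) (u v : ℕ) {o : ℕ}
    (ho : o < 2) (n : ℕ) : ∀ r < (2 * V) ^ j,
    (step V E j (if T % 2 = 0 then u else T / 2) (if T % 2 = 0 then T / 2 else v))^[n] (2 + r) = o →
    ∃ m, (step V E (j + 1) u v)^[m] (2 + (T * (2 * V) ^ j + r)) = combine V ((2 * V) ^ j) T o := by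
  induction n with
  | zero => intro r _ h; simp at h; omega
  | succ n ih =>
    intro r hr h
    rw [Function.iterate_succ_apply, step_two_add] at h
    rcases outcome_bound (E := E) hV j (if T % 2 = 0 then u else T / 2)
      (if T % 2 = 0 then T / 2 else v) r hr with hlt | ⟨h1, h2⟩
    · rw [iterate_step_of_lt hlt] at h
      exact ⟨1, by rw [Function.iterate_one, step_two_add, outcome_succ hV hT hr, h]⟩
    · obtain ⟨r', hr'⟩ : ∃ r', outcome V E j (if T % 2 = 0 then u else T / 2)
          (if T % 2 = 0 then T / 2 else v) (digit V r) = 2 + r' :=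
        Nat.exists_eq_add_of_le (by omega)
      rw [hr'] at h h1 h2
      obtain ⟨m, hm⟩ := ih r' (by omega) h
      refine ⟨m + 1, ?_⟩
      rw [Function.iterate_succ_apply, step_two_add, outcome_succ hV hT hr, hr', ← hm]
      congr 1
      rw [combine, if_neg (by omega), if_neg (by omega)]
      ring

/-- Midpoints are tried in increasing order, the right half only after success in the left one. The
state `2` has all digits zero: midpoint `0` and left half at every height. -/
theorem exists_iterate_step (hV : 0 < V) (j u v : ℕ) :
    ∃ n, (step V E j u v)^[n] 2 = truth (Path V E j u v) := by
  induction j generalizing u v with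
  | zero => exact ⟨1, by rw [Function.iterate_one]; exact step_two_add 0 u v 0⟩
  | succ j ih =>
    have hP : 0 < (2 * V) ^ j := pow_pos (by omega) _
    have ht : ∀ P : Prop, truth P < 2 := fun P => by unfold truth; split_ifs <;> omega
    -- One midpoint takes at most two searches at the lower height, each started with zero digits.
    have round : ∀ d < V, ∃ m, (step V E (j + 1) u v)^[m] (2 + 2 * d * (2 * V) ^ j) =
        if truth (Path V E j u d ∧ Path V E j d v) = 1 then 1
        else if d + 1 < V then 2 + 2 * (d + 1) * (2 * V) ^ j else 0 := by
      intro d hd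
      have e1 : (2 * d + 1) / 2 = d := by omega
      have e2 : 2 * d / 2 = d := by omega
      have e3 : (2 * d + 1) % 2 ≠ 0 := by omega
      obtain ⟨n₁, h₁⟩ := ih u d
      obtain ⟨n₂, h₂⟩ := ih d v
      obtain ⟨m₁, h₃⟩ := exists_iterate_combine (E := E) hV (T := 2 * d) (j := j) (by omega) u v
        (ht (Path V E j u d)) n₁ 0 hP (by simpa using h₁)
      obtain ⟨m₂, h₄⟩ := exists_iterate_combine (E := E) hV (T := 2 * d + 1) (j := j) (by omega)
        u v (ht (Path V E j d v)) n₂ 0 hP (by simpa [e1, e3] using h₂)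
      change (step V E (j + 1) u v)^[m₁] (2 + 2 * d * (2 * V) ^ j) = _ at h₃
      change (step V E (j + 1) u v)^[m₂] (2 + (2 * d + 1) * (2 * V) ^ j) = _ at h₄
      by_cases hu : Path V E j u d
      · refine ⟨m₂ + m₁, ?_⟩
        rw [Function.iterate_add_apply, h₃, truth_eq_one.2 hu, combine, if_neg (by omega),
          if_pos rfl, if_pos (by omega), h₄]
        by_cases hv : Path V E j d v
        · rw [truth_eq_one.2 hv, truth_eq_one.2 ⟨hu, hv⟩, if_pos rfl, combine, if_neg (by omega),
            if_pos rfl, if_neg e3]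
        · have e4 : truth (Path V E j d v) = 0 := if_neg hv
          have e5 : truth (Path V E j u d ∧ Path V E j d v) = 0 := if_neg fun h => hv h.2
          rw [e4, e5, if_neg (by omega), combine, if_pos rfl, e1]
      · refine ⟨m₁, ?_⟩
        have e4 : truth (Path V E j u d) = 0 := if_neg hu
        have e5 : truth (Path V E j u d ∧ Path V E j d v) = 0 := if_neg fun h => hu h.1
        rw [h₃, e4, e5, if_neg (by omega), combine, if_pos rfl, e2]
    -- Induction on the number `i` of midpoints after `d`.
    have key : ∀ i d, i + d + 1 = V → ∃ n,
        (step V E (j + 1) u v)^[n] (2 + 2 * d * (2 * V) ^ j) =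
          truth (∃ d', d ≤ d' ∧ d' < V ∧ Path V E j u d' ∧ Path V E j d' v) := by
      intro i
      induction i with
      | zero =>
        intro d hd
        obtain ⟨m, hm⟩ := round d (by omega)
        refine ⟨m, ?_⟩
        rw [hm, if_neg (show ¬ d + 1 < V by omega)]
        have hiff : (∃ d', d ≤ d' ∧ d' < V ∧ Path V E j u d' ∧ Path V E j d' v) ↔
            Path V E j u d ∧ Path V E j d v := by
          refine ⟨fun ⟨d', h1, h2, h3⟩ => ?_, fun h => ⟨d, le_rfl, by omega, h⟩⟩
          obtain rfl : d' = d := by omega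
          exact h3
        rw [truth_congr hiff]
        have := ht (Path V E j u d ∧ Path V E j d v)
        split_ifs <;> omega
      | succ i ihi =>
        intro d hd
        obtain ⟨m, hm⟩ := round d (by omega)
        obtain ⟨n, hn⟩ := ihi (d + 1) (by omega)
        rw [if_pos (show d + 1 < V by omega)] at hm
        by_cases hboth : Path V E j u d ∧ Path V E j d v
        · refine ⟨m, ?_⟩
          rw [hm, if_pos (truth_eq_one.2 hboth), eq_comm, truth_eq_one]
          exact ⟨d, le_rfl, by omega, hboth⟩
        · refine ⟨n + m, ?_⟩
          rw [Function.iterate_add_apply, hm, if_neg (fun h => hboth (truth_eq_one.1 h)), hn]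
          refine truth_congr ⟨fun ⟨d', h1, h2⟩ => ⟨d', by omega, h2⟩, fun ⟨d', h1, h2, h3⟩ => ?_⟩
          rcases Nat.eq_or_lt_of_le h1 with rfl | h4
          · exact absurd h3 hboth
          · exact ⟨d', h4, h2, h3⟩
    obtain ⟨n, hn⟩ := key (V - 1) 0 (by omega)
    refine ⟨n, ?_⟩
    simp only [Nat.mul_zero, Nat.zero_mul, Nat.add_zero, Nat.zero_le, true_and] at hn
    exact hn

/-- Unfinished states increase strictly and stay below `2 + (2 V) ^ j`, so `(2 V) ^ j` steps exhaust
them. -/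
theorem iterate_step_progress (hV : 0 < V) (j u v n : ℕ) :
    (step V E j u v)^[n] 2 < 2 ∨ 2 + n ≤ (step V E j u v)^[n] 2 ∧
      (step V E j u v)^[n] 2 < 2 + (2 * V) ^ j := by
  induction n with
  | zero =>
    have : 0 < (2 * V) ^ j := pow_pos (by omega) _
    right; simp; omega
  | succ n ih =>
    rw [Function.iterate_succ_apply']
    rcases ih with h | ⟨h1, h2⟩
    · left; rw [step_of_lt h]; exact h
    · obtain ⟨r, hr⟩ : ∃ r, (step V E j u v)^[n] 2 = 2 + r := Nat.exists_eq_add_of_le (by omega)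
      rw [hr] at h1 h2 ⊢
      rw [step_two_add]
      rcases outcome_bound (E := E) hV j u v r (by omega) with h | h
      · left; exact h
      · right; omega

/-- The answers `0` and `1` are fixed points, so surplus steps do no harm and a program may iterate
up to its cap. -/
theorem iterate_step (hV : 0 < V) (j u v : ℕ) {N : ℕ} (hN : (2 * V) ^ j ≤ N) :
    (step V E j u v)^[N] 2 = truth (Path V E j u v) := by
  obtain ⟨n, hn⟩ := exists_iterate_step (E := E) hV j u v
  have hlt : (step V E j u v)^[N] 2 < 2 := by
    rcases iterate_step_progress (E := E) hV j u v N with h | h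
    · exact h
    · omega
  have ht : truth (Path V E j u v) < 2 := by unfold truth; split_ifs <;> omega
  rcases le_total n N with h | h
  · obtain ⟨i, rfl⟩ := Nat.exists_eq_add_of_le' h
    rw [Function.iterate_add_apply, hn, iterate_step_of_lt ht]
  · obtain ⟨i, rfl⟩ := Nat.exists_eq_add_of_le' h
    rw [← hn, Function.iterate_add_apply, iterate_step_of_lt hlt]

end Bisection

end SpaceTM


/-! ### Bisection as a function of capped numbers -/

namespace SpaceTM

namespace Bisection

open Fn

section

variable (nV nJ : Fn 0) (edge : Fn 2)

/-- `2 V`. -/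
def baseFn {k : ℕ} : Fn k := mul (num 2) (app₀ nV)

/-- The digits of the state of the search. -/
def digitFn {k : ℕ} (g h : Fn k) : Fn k := mod (div g (pow (baseFn nV) h)) (baseFn nV)

/-- The start of the edge that is examined. -/
def leftEndFn : Fn 2 :=
  loop (app₀ nJ) (var 1) (app₂ (ifEq (mod (var 0) (num 2)) zero (var 1) (div (var 0) (num 2)))
    (digitFn nV (var 2) (sub (sub (app₀ nJ) (num 1)) (var 0))) (var 1))

/-- The end of the edge that is examined. -/
def rightEndFn : Fn 2 :=
  loop (app₀ nJ) (var 1) (app₂ (ifEq (mod (var 0) (num 2)) zero (div (var 0) (num 2)) (var 1))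
    (digitFn nV (var 2) (sub (sub (app₀ nJ) (num 1)) (var 0))) (var 1))

/-- The function `combine`. -/
def combineFn : Fn 3 :=
  ifEq (var 2) zero
    (ifEq (lt (succ (div (var 1) (num 2))) (app₀ nV)) (num 1)
      (add (num 2) (mul (mul (num 2) (succ (div (var 1) (num 2)))) (var 0))) zero)
    (ifEq (var 2) (num 1)
      (ifEq (mod (var 1) (num 2)) zero (add (num 2) (mul (succ (var 1)) (var 0))) (num 1))
      (add (var 2) (mul (var 1) (var 0))))

/-- The function `outcome`. -/
def outcomeFn : Fn 3 :=
  loop (app₀ nJ) (app₂ edge (app₂ (leftEndFn nV nJ) (var 2) (var 0))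
      (app₂ (rightEndFn nV nJ) (var 2) (var 1)))
    (app₃ (combineFn nV) (pow (baseFn nV) (var 0)) (digitFn nV (var 4) (var 0)) (var 1))

/-- Whether there is a path of `2 ^ J` edges. -/
def pathFn : Fn 2 :=
  loop cap (num 2) (ifEq (lt (var 1) (num 2)) (num 1) (var 1)
    (app₃ (outcomeFn nV nJ edge) (var 2) (var 3) (sub (var 1) (num 2))))

variable {I : Type} {code : InSym I → ℕ} {x : List I} {B k : ℕ} {ρ : Fin k → ℕ}
  {nV nJ : Fn 0} {edge : Fn 2} {V J : ℕ} {E : ℕ → ℕ → Prop}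

theorem eval_baseFn (hnV : nV.eval code x B ![] = V) (h : 2 * V ≤ B) (hV : 0 < V) :
    (baseFn nV).eval code x B ρ = 2 * V :=
  eval_mul_eq (eval_num_eq (by omega)) (by simpa using hnV) h

theorem eval_digitFn {g h : Fn k} {u v : ℕ} (hnV : nV.eval code x B ![] = V) (hV : 0 < V)
    (hg : g.eval code x B ρ = u) (hh : h.eval code x B ρ = v) (hu : u < B)
    (hv : (2 * V) ^ (v + 1) ≤ B) : (digitFn nV g h).eval code x B ρ = digit V u v := by
  have h1 : 2 * V ≤ B := le_trans (Nat.le_self_pow (by omega) _) hv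
  have h2 : (2 * V) ^ v ≤ B := le_trans (Nat.pow_le_pow_right (by omega) (by omega)) hv
  have hb := eval_baseFn (x := x) (ρ := ρ) hnV h1 hV
  exact eval_mod_eq (eval_div_eq hg (eval_pow_eq hb hh h2) (pow_pos (by omega) _) hu) hb
    (by omega) (lt_of_le_of_lt (Nat.div_le_self _ _) hu)

theorem pow_le_of_lt (hV : 0 < V) (hbig : 2 + (2 * V) ^ J ≤ B) {i : ℕ} (hi : i < J) :
    (2 * V) ^ (i + 1) ≤ B :=
  le_trans (Nat.pow_le_pow_right (by omega) hi) (by omega)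

/-- Round `i` uses digit `J - 1 - i`, so the digits are read from the top; the remaining `J - i`
heights always lead to the same final end point. -/
theorem eval_leftEndFn (hnV : nV.eval code x B ![] = V) (hnJ : nJ.eval code x B ![] = J)
    (hV : 0 < V) (hbig : 2 + (2 * V) ^ J ≤ B) {g u : ℕ} (hg : g < B) :
    (leftEndFn nV nJ).eval code x B ![g, u] = leftEnd (digit V g) J u := by
  have hn : (app₀ nJ : Fn 2).eval code x B ![g, u] = J := by simpa using hnJ
  have hpos : 0 < (2 * V) ^ J := pow_pos (by omega) _
  have key := loop_induction (code := code) (x := x) (B := B) (ρ := ![g, u]) (n := app₀ nJ)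
    (a := var 1) (b := app₂ (ifEq (mod (var 0) (num 2)) zero (var 1) (div (var 0) (num 2)))
    (digitFn nV (var 2) (sub (sub (app₀ nJ) (num 1)) (var 0))) (var 1))
    (fun i v => leftEnd (digit V g) (J - i) v = leftEnd (digit V g) J u) (by simp [eval]) (by
      intro i v hi ih
      rw [hn] at hi
      rw [← ih, eval_app₂, eval_digitFn (u := g) (v := J - 1 - i) hnV hV (by simp [eval])
        (eval_sub_eq (eval_sub_eq (by simpa using hnJ) (eval_num_eq (by omega))) (by simp [eval]))
        hg (pow_le_of_lt hV hbig (by omega))]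
      have hd := digit_lt hV g (J - 1 - i)
      have h2V : 2 * V ≤ B := by simpa using pow_le_of_lt hV hbig (show 0 < J by omega)
      obtain ⟨j, hj⟩ : ∃ j, J - i = j + 1 := ⟨J - i - 1, by omega⟩
      have e₁ : J - (i + 1) = j := by omega
      have e₂ : J - 1 - i = j := by omega
      rw [e₂] at hd
      rw [hj, leftEnd, e₁, e₂]
      have hmod := eval_mod_eq (code := code) (x := x) (B := B)
        (ρ := ![digit V g j, v]) (a := var 0) (b := num 2) (u := digit V g j) (v := 2)
        (by simp [eval]) (eval_num_eq (by omega)) (by omega) (by omega)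
      have hdiv := eval_div_eq (code := code) (x := x) (B := B)
        (ρ := ![digit V g j, v]) (a := var 0) (b := num 2) (u := digit V g j) (v := 2)
        (by simp [eval]) (eval_num_eq (by omega)) (by omega) (by omega)
      congr 1
      by_cases h : digit V g j % 2 = 0
      · rw [if_pos h, show eval code x B (var 1) (Matrix.vecCons i ![v, g, u]) = v by simp [eval],
          eval_ifEq_pos (by rw [hmod, h]; rfl)]
        simp [eval]
      · rw [if_neg h, show eval code x B (var 1) (Matrix.vecCons i ![v, g, u]) = v by simp [eval],
          eval_ifEq_neg (by rw [hmod]; exact h), hdiv])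
  rw [hn, Nat.sub_self] at key
  exact key

theorem eval_rightEndFn (hnV : nV.eval code x B ![] = V) (hnJ : nJ.eval code x B ![] = J)
    (hV : 0 < V) (hbig : 2 + (2 * V) ^ J ≤ B) {g u : ℕ} (hg : g < B) :
    (rightEndFn nV nJ).eval code x B ![g, u] = rightEnd (digit V g) J u := by
  have hn : (app₀ nJ : Fn 2).eval code x B ![g, u] = J := by simpa using hnJ
  have hpos : 0 < (2 * V) ^ J := pow_pos (by omega) _
  have key := loop_induction (code := code) (x := x) (B := B) (ρ := ![g, u]) (n := app₀ nJ)
    (a := var 1) (b := app₂ (ifEq (mod (var 0) (num 2)) zero (div (var 0) (num 2)) (var 1))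
    (digitFn nV (var 2) (sub (sub (app₀ nJ) (num 1)) (var 0))) (var 1))
    (fun i v => rightEnd (digit V g) (J - i) v = rightEnd (digit V g) J u) (by simp [eval]) (by
      intro i v hi ih
      rw [hn] at hi
      rw [← ih, eval_app₂, eval_digitFn (u := g) (v := J - 1 - i) hnV hV (by simp [eval])
        (eval_sub_eq (eval_sub_eq (by simpa using hnJ) (eval_num_eq (by omega))) (by simp [eval]))
        hg (pow_le_of_lt hV hbig (by omega))]
      have hd := digit_lt hV g (J - 1 - i)
      have h2V : 2 * V ≤ B := by simpa using pow_le_of_lt hV hbig (show 0 < J by omega)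
      obtain ⟨j, hj⟩ : ∃ j, J - i = j + 1 := ⟨J - i - 1, by omega⟩
      have e₁ : J - (i + 1) = j := by omega
      have e₂ : J - 1 - i = j := by omega
      rw [e₂] at hd
      rw [hj, rightEnd, e₁, e₂]
      have hmod := eval_mod_eq (code := code) (x := x) (B := B)
        (ρ := ![digit V g j, v]) (a := var 0) (b := num 2) (u := digit V g j) (v := 2)
        (by simp [eval]) (eval_num_eq (by omega)) (by omega) (by omega)
      have hdiv := eval_div_eq (code := code) (x := x) (B := B)
        (ρ := ![digit V g j, v]) (a := var 0) (b := num 2) (u := digit V g j) (v := 2)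
        (by simp [eval]) (eval_num_eq (by omega)) (by omega) (by omega)
      congr 1
      by_cases h : digit V g j % 2 = 0
      · rw [if_pos h, show eval code x B (var 1) (Matrix.vecCons i ![v, g, u]) = v by simp [eval],
          eval_ifEq_pos (by rw [hmod, h]; rfl), hdiv]
      · rw [if_neg h, show eval code x B (var 1) (Matrix.vecCons i ![v, g, u]) = v by simp [eval],
          eval_ifEq_neg (by rw [hmod]; exact h)]
        simp [eval])
  rw [hn, Nat.sub_self] at key
  exact key

theorem eval_combineFn (hnV : nV.eval code x B ![] = V) {P t o : ℕ} (ht : t < 2 * V)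
    (hP : 2 + 2 * V * P ≤ B) (hP0 : 0 < P) (ho : o < 2 + P) :
    (combineFn nV).eval code x B ![P, t, o] = combine V P t o := by
  have h2V : 2 * V ≤ 2 * V * P := Nat.le_mul_of_pos_right _ hP0
  have hB : 1 ≤ B := by omega
  have v0 : (var 0 : Fn 3).eval code x B ![P, t, o] = P := by simp [eval]
  have v1 : (var 1 : Fn 3).eval code x B ![P, t, o] = t := by simp [eval]
  have v2 : (var 2 : Fn 3).eval code x B ![P, t, o] = o := by simp [eval]
  have n2 : (num 2 : Fn 3).eval code x B ![P, t, o] = 2 := eval_num_eq (by omega)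
  have hmod := eval_mod_eq v1 n2 (by omega) (by omega)
  have hdiv := eval_succ_eq (eval_div_eq v1 n2 (by omega) (by omega)) (by omega)
  have hTP : (t + 1) * P ≤ 2 * V * P := Nat.mul_le_mul_right _ ht
  have e1 : (t + 1) * P = t * P + P := by ring
  rw [combineFn, combine]
  by_cases h0 : o = 0
  · rw [eval_ifEq_pos (by rw [v2, h0]; rfl), if_pos h0]
    have hlt := eval_lt_eq (x := x) hB hdiv (b := app₀ nV) (v := V) (by simpa using hnV)
    by_cases hd : t / 2 + 1 < V
    · rw [if_pos hd] at hlt ⊢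
      rw [eval_ifEq_pos (by rw [hlt, eval_num_eq hB])]
      have h1 : 2 * (t / 2 + 1) * P ≤ 2 * V * P := Nat.mul_le_mul_right _ (by omega)
      exact eval_add_eq n2 (eval_mul_eq (eval_mul_eq n2 hdiv (by omega)) v0 (by omega)) (by omega)
    · rw [if_neg hd] at hlt ⊢
      rw [eval_ifEq_neg (by rw [hlt, eval_num_eq hB]; omega)]
      rfl
  · rw [eval_ifEq_neg (by rw [v2]; exact h0), if_neg h0]
    by_cases h1 : o = 1
    · rw [eval_ifEq_pos (by rw [v2, eval_num_eq hB, h1]), if_pos h1]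
      by_cases h : t % 2 = 0
      · rw [eval_ifEq_pos (by rw [hmod, h]; rfl), if_pos h]
        exact eval_add_eq n2 (eval_mul_eq (eval_succ_eq v1 (by omega)) v0 (by omega)) (by omega)
      · rw [eval_ifEq_neg (by rw [hmod]; exact h), if_neg h, eval_num_eq hB]
    · rw [eval_ifEq_neg (by rw [v2, eval_num_eq hB]; exact h1), if_neg h1]
      exact eval_add_eq v2 (eval_mul_eq v1 v0 (by omega)) (by omega)

theorem leftEnd_lt (hV : 0 < V) (g : ℕ) (j u : ℕ) (hu : u < V) : leftEnd (digit V g) j u < V := by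
  induction j generalizing u with
  | zero => exact hu
  | succ j ih =>
    refine ih _ ?_
    have := digit_lt hV g j
    split_ifs <;> omega

theorem rightEnd_lt (hV : 0 < V) (g : ℕ) (j u : ℕ) (hu : u < V) :
    rightEnd (digit V g) j u < V := by
  induction j generalizing u with
  | zero => exact hu
  | succ j ih =>
    refine ih _ ?_
    have := digit_lt hV g j
    split_ifs <;> omega

/-- Keeps the intermediate outcomes in the range of `eval_combineFn`; unlike in `outcome_bound`, `g`
is arbitrary. -/
theorem raise_lt (hV : 0 < V) (g j o : ℕ) (ho : o < 2) :
    raise V (digit V g) j o < 2 + (2 * V) ^ j := by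
  induction j with
  | zero => simp only [raise]; omega
  | succ j ih =>
    have hP : 0 < (2 * V) ^ j := pow_pos (by omega) _
    have hP' : 0 < (2 * V) ^ (j + 1) := pow_pos (by omega) _
    have ht := digit_lt hV g j
    simp only [raise]
    rcases Nat.lt_or_ge (raise V (digit V g) j o) 2 with h | h
    · have := combine_bound (r := 0) ht hP (Or.inl h)
      rw [pow_succ'] at *
      omega
    · have hTP : (digit V g j + 1) * (2 * V) ^ j ≤ 2 * V * (2 * V) ^ j :=
        Nat.mul_le_mul_right _ ht
      have e1 : (digit V g j + 1) * (2 * V) ^ j = digit V g j * (2 * V) ^ j + (2 * V) ^ j := by ring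
      rw [combine, if_neg (by omega), if_neg (by omega), pow_succ']
      omega

theorem eval_outcomeFn (hnV : nV.eval code x B ![] = V) (hnJ : nJ.eval code x B ![] = J)
    (hV : 0 < V) (hbig : 2 + (2 * V) ^ J ≤ B)
    (hedge : ∀ u < V, ∀ v < V, edge.eval code x B ![u, v] = truth (E u v)) {u v g : ℕ} (hu : u < V)
    (hv : v < V) (hg : g < B) :
    (outcomeFn nV nJ edge).eval code x B ![u, v, g] = outcome V E J u v (digit V g) := by
  have hn : (app₀ nJ : Fn 3).eval code x B ![u, v, g] = J := by simpa using hnJ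
  have hpos : 0 < (2 * V) ^ J := pow_pos (by omega) _
  have h0 : (app₂ edge (app₂ (leftEndFn nV nJ) (var 2) (var 0))
      (app₂ (rightEndFn nV nJ) (var 2) (var 1))).eval code x B ![u, v, g] =
      truth (E (leftEnd (digit V g) J u) (rightEnd (digit V g) J v)) := by
    rw [eval_app₂, eval_app₂, eval_app₂]
    simp only [eval, Matrix.cons_val]
    rw [eval_leftEndFn hnV hnJ hV hbig hg, eval_rightEndFn hnV hnJ hV hbig hg]
    exact hedge _ (leftEnd_lt hV _ _ _ hu) _ (rightEnd_lt hV _ _ _ hv)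
  have key := loop_induction (code := code) (x := x) (B := B) (ρ := ![u, v, g]) (n := app₀ nJ)
    (a := app₂ edge (app₂ (leftEndFn nV nJ) (var 2) (var 0))
      (app₂ (rightEndFn nV nJ) (var 2) (var 1)))
    (b := app₃ (combineFn nV) (pow (baseFn nV) (var 0)) (digitFn nV (var 4) (var 0)) (var 1))
    (fun i w => w = raise V (digit V g) i
      (truth (E (leftEnd (digit V g) J u) (rightEnd (digit V g) J v)))) h0 (by
      rintro i w hi rfl
      rw [hn] at hi
      have hP := pow_le_of_lt hV hbig hi
      have h2V : 2 * V ≤ B := by simpa using pow_le_of_lt hV hbig (show 0 < J by omega)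
      have hP' : 2 * V * (2 * V) ^ i ≤ (2 * V) ^ J := by
        rw [← pow_succ']; exact Nat.pow_le_pow_right (by omega) hi
      have hPi : (2 * V) ^ i ≤ (2 * V) ^ J := Nat.pow_le_pow_right (by omega) hi.le
      rw [eval_app₃, eval_pow_eq (eval_baseFn hnV h2V hV) (v := i) (by simp [eval]) (by omega),
        eval_digitFn (u := g) (v := i) hnV hV (by simp [eval]) (by simp [eval]) hg hP]
      simp only [eval, Matrix.cons_val]
      rw [eval_combineFn hnV (digit_lt hV _ _) (by omega) (pow_pos (by omega) _)
        (raise_lt hV _ _ _ (by unfold truth; split_ifs <;> omega))]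
      rfl)
  rw [hn] at key
  exact key

/-- The loop runs `B` times, enough by `iterate_step`, and by `iterate_step_progress` no state on
the way exceeds the cap. -/
theorem eval_pathFn (hnV : nV.eval code x B ![] = V) (hnJ : nJ.eval code x B ![] = J)
    (hV : 0 < V) (hbig : 2 + (2 * V) ^ J ≤ B)
    (hedge : ∀ u < V, ∀ v < V, edge.eval code x B ![u, v] = truth (E u v)) {u v : ℕ} (hu : u < V)
    (hv : v < V) :
    (pathFn nV nJ edge).eval code x B ![u, v] = truth (Path V E J u v) := by
  have hpos : 0 < (2 * V) ^ J := pow_pos (by omega) _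
  rw [← iterate_step hV J u v (show (2 * V) ^ J ≤ B by omega)]
  refine loop_induction (code := code) (x := x) (B := B) (ρ := ![u, v]) (n := cap)
    (a := num 2) (b := ifEq (lt (var 1) (num 2)) (num 1) (var 1)
      (app₃ (outcomeFn nV nJ edge) (var 2) (var 3) (sub (var 1) (num 2))))
    (fun i w => w = (step V E J u v)^[i] 2) (by rw [eval_num_eq (by omega)]; rfl) ?_
  rintro i w - hw
  rw [Function.iterate_succ_apply', ← hw]
  have hprog := iterate_step_progress (E := E) hV J u v i
  rw [← hw] at hprog
  have hlt := eval_lt_eq (code := code) (x := x) (B := B) (a := (var 1 : Fn 4))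
    (b := num 2) (ρ := ![i, w, u, v]) (u := w) (v := 2) (by omega) (by simp [eval])
    (eval_num_eq (by omega))
  by_cases h : w < 2
  · rw [if_pos h] at hlt
    refine (eval_ifEq_pos (hlt.trans (eval_num_eq (by omega)).symm)).trans ?_
    rw [step_of_lt h]
    simp [eval]
  · rw [if_neg h] at hlt
    refine (eval_ifEq_neg (by rw [hlt, eval_num_eq (by omega)]; omega)).trans ?_
    rw [eval_app₃, eval_sub_eq (u := w) (v := 2) (by simp [eval]) (eval_num_eq (by omega))]
    simp only [eval, Matrix.cons_val]
    rw [eval_outcomeFn hnV hnJ hV hbig hedge hu hv (by omega), step, if_neg h]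

end

end Bisection

end SpaceTM


/-! ## Reading the description of an automaton -/

namespace IPCANT

open SpaceTM

/-- Numbers for the symbols of the input tape. -/
def symCode : InSym Sym → ℕ
  | .leftEnd => 0
  | .rightEnd => 0
  | .sym (.bit false) => 1
  | .sym (.bit true) => 2
  | .sym .sep => 3
  | .sym .ctr => 4
  | .sym .trn => 5
  | .sym .eps => 6
  | .sym .letter => 7
  | .sym .inc => 8
  | .sym .dec => 9
  | .sym .transf => 10

theorem symCode_le (a : InSym Sym) : symCode a ≤ 16 := by
  rcases a with _ | (b | _ | _ | _ | _ | _ | _ | _ | _) | _ <;>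
    first | (cases b <;> simp [symCode]) | simp [symCode]

/-- The number of the symbol at position `p` of the word. -/
def symAt (x : List Sym) (p : ℕ) : ℕ := symCode (readInput x (p + 1))

theorem symAt_of_getElem? {x : List Sym} {p : ℕ} {a : Sym} (h : x[p]? = some a) :
    symAt x p = symCode (.sym a) := by
  simp [symAt, readInput, h]

theorem symAt_of_length_le {x : List Sym} {p : ℕ} (h : x.length ≤ p) : symAt x p = 0 := by
  simp [symAt, readInput, List.getElem?_eq_none h, symCode]

theorem symAt_ne_zero {x : List Sym} {p : ℕ} (h : p < x.length) : symAt x p ≠ 0 := by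
  rw [symAt_of_getElem? (List.getElem?_eq_getElem h)]
  rcases x[p] with b | _ | _ | _ | _ | _ | _ | _ | _ <;>
    first | (cases b <;> simp [symCode]) | simp [symCode]

theorem symAt_eq_five {x : List Sym} {p : ℕ} : symAt x p = 5 ↔ x[p]? = some .trn := by
  constructor
  · intro h
    by_cases hp : p < x.length
    · rw [symAt_of_getElem? (List.getElem?_eq_getElem hp)] at h
      rw [List.getElem?_eq_getElem hp]
      rcases hx : x[p] with b | _ | _ | _ | _ | _ | _ | _ | _ <;> rw [hx] at h <;>
        first | (cases b <;> simp [symCode] at h) | simp [symCode] at h ⊢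
    · rw [symAt_of_length_le (by omega)] at h
      omega
  · intro h; rw [symAt_of_getElem? h]; rfl

/-- The word `l` occurs in `x` at position `p`. -/
def OccursAt (x : List Sym) (p : ℕ) (l : List Sym) : Prop := l <+: x.drop p

namespace OccursAt

variable {x l m : List Sym} {p : ℕ}

theorem left (h : OccursAt x p (l ++ m)) : OccursAt x p l :=
  (List.prefix_append l m).trans h

theorem right (h : OccursAt x p (l ++ m)) : OccursAt x (p + l.length) m := by
  obtain ⟨r, hr⟩ := h
  refine ⟨r, ?_⟩
  rw [← List.drop_drop, ← hr, List.append_assoc, List.drop_left]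

theorem tail {a : Sym} (h : OccursAt x p (a :: l)) : OccursAt x (p + 1) l :=
  right (l := [a]) h

theorem getElem? (h : OccursAt x p l) {i : ℕ} (hi : i < l.length) : x[p + i]? = some l[i] := by
  obtain ⟨r, hr⟩ := h
  rw [← List.getElem?_drop, ← hr, List.getElem?_append_left hi, List.getElem?_eq_getElem hi]

theorem symAt_add (h : OccursAt x p l) {i : ℕ} (hi : i < l.length) :
    symAt x (p + i) = symCode (.sym l[i]) := symAt_of_getElem? (h.getElem? hi)

theorem symAt_head {a : Sym} (h : OccursAt x p (a :: l)) : symAt x p = symCode (.sym a) :=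
  h.symAt_add (i := 0) (by simp)

theorem add_le_length (h : OccursAt x p l) (hl : l ≠ []) : p + l.length ≤ x.length := by
  have h' := h.length_le
  rw [List.length_drop] at h'
  have := List.length_pos_iff.2 hl
  omega

theorem of_append (r : List Sym) : OccursAt (l ++ (m ++ r)) l.length m := by
  refine ⟨r, by simp⟩

end OccursAt

end IPCANT

/-! ### Finding separators and decoding numbers -/

namespace SpaceTM

namespace Fn

open IPCANT

variable {x : List Sym} {B k : ℕ} {ρ : Fin k → ℕ}

theorem eval_inp_eq {e : Fn k} {p : ℕ} (h : e.eval symCode x B ρ = p) :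
    (inp e).eval symCode x B ρ = symAt x p := by
  simp only [eval, h, symAt]

/-- The length of the input. -/
def length : Fn 0 := loop cap zero (ifEq (inp (var 1)) zero (var 1) (succ (var 1)))

/-- Only the end markers have code `0`, so the position advances up to the end of the word or to the
cap. -/
theorem eval_length : length.eval symCode x B ![] = min x.length B := by
  refine loop_induction (n := cap) (fun j v => v = min x.length j) (by simp [eval]) ?_
  rintro j _ hj rfl
  simp only [eval] at hj
  by_cases h : x.length ≤ j
  · rw [eval_ifEq_pos]
    · simp [eval, h, Nat.le_succ_of_le h]
    · rw [eval_inp_eq (p := x.length) (by simp [eval, h]), symAt_of_length_le le_rfl]; rfl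
  · rw [eval_ifEq_neg]
    · rw [eval_succ_eq (u := j) (by simp [eval]; omega) (by omega)]; omega
    · rw [eval_inp_eq (p := j) (by simp [eval]; omega)]
      exact symAt_ne_zero (by omega)

/-- The position of the first separator. -/
def sepPos (p : Fn k) : Fn k :=
  app₁ (loop cap (var 0) (ifEq (inp (var 1)) (num 3) (var 1) (succ (var 1)))) p

theorem eval_sepPos (hB : 3 ≤ B) {e : Fn k} {p : ℕ} (he : e.eval symCode x B ρ = p) {l : List Bool}
    (h : OccursAt x p (l.map Sym.bit ++ [Sym.sep])) (hp : p + l.length ≤ B) :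
    (sepPos e).eval symCode x B ρ = p + l.length := by
  rw [sepPos, eval_app₁, he]
  have key := loop_induction (code := symCode) (x := x) (B := B) (ρ := ![p]) (n := cap) (a := var 0)
    (b := ifEq (inp (var 1)) (num 3) (var 1) (succ (var 1)))
    (fun j v => v = p + min j l.length) (by simp [eval]) (by
      rintro j _ - rfl
      by_cases hj : l.length ≤ j
      · rw [eval_ifEq_pos]
        · simp [eval, hj, Nat.le_succ_of_le hj]
        · rw [eval_inp_eq (p := p + l.length) (by simp [eval, hj]), eval_num_eq hB,
            h.symAt_add (i := l.length) (by simp)]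
          simp [symCode]
      · rw [eval_ifEq_neg]
        · rw [eval_succ_eq (u := p + j) (by simp [eval]; omega) (by omega)]; omega
        · rw [eval_inp_eq (p := p + j) (by simp [eval]; omega), eval_num_eq hB,
            h.symAt_add (i := j) (by simp; omega)]
          rw [List.getElem_append_left (by simp; omega)]
          simp only [List.getElem_map]
          cases l[j] <;> simp [symCode])
  rw [key]
  simp only [eval]
  rw [min_eq_right (by omega)]

/-- The position after the first separator. -/
def skip (p : Fn k) : Fn k := succ (sepPos p)

theorem eval_skip (hB : 3 ≤ B) {e : Fn k} {p : ℕ} (he : e.eval symCode x B ρ = p) {l : List Bool}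
    (h : OccursAt x p (l.map Sym.bit ++ [Sym.sep])) (hp : p + l.length + 1 ≤ B) :
    (skip e).eval symCode x B ρ = p + l.length + 1 :=
  eval_succ_eq (eval_sepPos hB he h (by omega)) hp

/-- The number that is written before the first separator. -/
def value (p : Fn k) : Fn k :=
  app₂ (loop (sub (var 1) (var 0)) zero (add (add (var 1) (var 1))
    (sub (inp (sub (sub (var 3) (num 1)) (var 0))) (num 1)))) p (sepPos p)

theorem min_add_self_add (y b B : ℕ) :
    min (min (min y B + min y B) B + b) B = min (y + y + b) B := by omega

/-- Horner's rule, from the most significant bit just before the separator backwards; after `j`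
rounds the value is that of the top `j` bits. Bits have codes `1` and `2`, hence the subtraction of
`1`. The result is saturated, since a number may exceed the cap even if its numeral is short. -/
theorem eval_value_min (hB : 3 ≤ B) {e : Fn k} {p m : ℕ} (he : e.eval symCode x B ρ = p)
    (h : OccursAt x p (encodeNat m)) (hp : p + m.size ≤ B) :
    (value e).eval symCode x B ρ = min m B := by
  have hsz : m.bits.length = m.size := Nat.size_eq_bits_len m
  rw [value, eval_app₂, he, eval_sepPos hB he h (by omega), hsz]
  have hn : (sub (var 1) (var 0)).eval symCode x B ![p, p + m.size] = m.size := by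
    rw [eval_sub_eq (u := p + m.size) (v := p) (by simp [eval]) (by simp [eval])]; omega
  have key := loop_induction (code := symCode) (x := x) (B := B) (ρ := ![p, p + m.size])
    (n := sub (var 1) (var 0)) (a := zero) (b := add (add (var 1) (var 1))
    (sub (inp (sub (sub (var 3) (num 1)) (var 0))) (num 1)))
    (fun j v => v = min (m / 2 ^ (m.size - j)) B) (by
      simp only [eval, Nat.sub_zero]
      rw [Nat.div_eq_of_lt (Nat.lt_size_self m)]; simp) (by
      rintro j _ hj rfl
      rw [hn] at hj
      have hbit : symAt x (p + m.size - 1 - j) - 1 = m / 2 ^ (m.size - (j + 1)) % 2 := by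
        rw [show p + m.size - 1 - j = p + (m.size - (j + 1)) by omega,
          h.symAt_add (by simp [encodeNat, hsz])]
        simp only [encodeNat]
        rw [List.getElem_append_left (by simp [hsz]; omega)]
        simp only [List.getElem_map]
        have hb : m.bits[m.size - (j + 1)]'(by omega) = m.testBit (m.size - (j + 1)) := by
          rw [Nat.testBit_eq_inth, List.getI_eq_getElem]
        rw [hb, Nat.testBit_eq_decide_div_mod_eq]
        by_cases h1 : m / 2 ^ (m.size - (j + 1)) % 2 = 1
        · simp [h1, symCode]
        · have : m / 2 ^ (m.size - (j + 1)) % 2 = 0 := by omega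
          simp [this, symCode]
      have h2 : m / 2 ^ (m.size - j) = m / 2 ^ (m.size - (j + 1)) / 2 := by
        rw [Nat.div_div_eq_div_mul, ← pow_succ]; congr 2; omega
      have hv : (var 1 : Fn 4).eval symCode x B
          ![j, min (m / 2 ^ (m.size - j)) B, p, p + m.size] = min (m / 2 ^ (m.size - j)) B := by
        simp [eval]
      rw [eval_add_min, eval_add_min (by rw [hv]; omega), hv,
        eval_sub_eq (v := 1) (eval_inp_eq (eval_sub_eq (v := j)
          (eval_sub_eq (u := p + m.size) (v := 1) (by simp [eval]) (eval_num_eq (by omega)))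
          (by simp [eval]))) (eval_num_eq (by omega)), hbit, min_add_self_add, h2]
      · congr 1; omega
      · rw [eval_add_min (by rw [hv]; omega)]; exact min_le_right _ _)
  rw [hn] at key
  simpa using key

end Fn

end SpaceTM


/-! ## The layout of the description of an automaton -/

namespace IPCANT

theorem OccursAt.flatMap {ι : Type*} {f : ι → List Sym} {L : ℕ} {x : List Sym} {cs : List ι}
    (hL : ∀ c ∈ cs, (f c).length = L) {p : ℕ} (h : OccursAt x p (cs.flatMap f)) {i : ℕ}
    (hi : i < cs.length) : OccursAt x (p + i * L) (f cs[i]) := by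
  induction cs generalizing p i with
  | nil => simp at hi
  | cons c cs ih =>
    rw [List.flatMap_cons] at h
    cases i with
    | zero => simpa using h.left
    | succ i =>
      have h' := ih (fun c hc => hL c (by simp [hc])) h.right (by simpa using hi)
      rw [hL c (by simp)] at h'
      rw [show p + (i + 1) * L = p + L + i * L by ring]
      simpa using h'

theorem exists_occursAt_of_mem {ι : Type*} {f : ι → List Sym} {ts : List ι} {t : ι} (ht : t ∈ ts)
    (pre : List Sym) : ∃ p, OccursAt (pre ++ ts.flatMap f) p (f t) := by
  obtain ⟨t₁, t₂, rfl⟩ := List.append_of_mem ht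
  refine ⟨(pre ++ t₁.flatMap f).length, ?_⟩
  have := OccursAt.of_append (l := pre ++ t₁.flatMap f) (m := f t) (t₂.flatMap f)
  simpa [List.append_assoc] using this

/-- The symbol `a` occurs only at the front of a block, so each occurrence locates one. -/
theorem exists_prefix_of_getElem? {ι : Type*} {f : ι → List Sym} {a : Sym} {ts : List ι}
    (hf : ∀ t ∈ ts, ∃ r, f t = a :: r ∧ a ∉ r) {p : ℕ} (h : (ts.flatMap f)[p]? = some a) :
    ∃ t ∈ ts, f t <+: (ts.flatMap f).drop p := by
  induction ts generalizing p with
  | nil => simp at h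
  | cons t ts ih =>
    rw [List.flatMap_cons] at h ⊢
    by_cases hp : p < (f t).length
    · rw [List.getElem?_append_left hp] at h
      obtain ⟨r, hr, har⟩ := hf t (by simp)
      cases p with
      | zero => exact ⟨t, by simp, by simp⟩
      | succ p =>
        rw [hr, List.getElem?_cons_succ] at h
        exact absurd (List.mem_of_getElem? h) har
    · rw [List.getElem?_append_right (by omega)] at h
      obtain ⟨t', ht', h'⟩ := ih (fun t ht => hf t (by simp [ht])) h
      refine ⟨t', by simp [ht'], ?_⟩
      rwa [List.drop_append, List.drop_of_length_le (by omega), List.nil_append]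

theorem exists_occursAt_of_getElem? {ι : Type*} {f : ι → List Sym} {a : Sym} {ts : List ι}
    (hf : ∀ t ∈ ts, ∃ r, f t = a :: r ∧ a ∉ r) {pre : List Sym} (hpre : a ∉ pre) {p : ℕ}
    (h : (pre ++ ts.flatMap f)[p]? = some a) :
    ∃ t ∈ ts, OccursAt (pre ++ ts.flatMap f) p (f t) := by
  by_cases hp : p < pre.length
  · rw [List.getElem?_append_left hp] at h
    exact absurd (List.mem_of_getElem? h) hpre
  · rw [List.getElem?_append_right (by omega)] at h
    obtain ⟨t, ht, h'⟩ := exists_prefix_of_getElem? hf h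
    refine ⟨t, ht, ?_⟩
    unfold OccursAt
    rwa [List.drop_append, List.drop_of_length_le (by omega), List.nil_append]

theorem length_encodeNat (m : ℕ) : (encodeNat m).length = m.size + 1 := by
  simp [encodeNat, Nat.size_eq_bits_len]

theorem length_encodeSet {n : ℕ} (c : Finset (Fin n)) : (encodeSet c).length = n + 1 := by
  simp [encodeSet]

theorem trn_notMem_encodeNat (m : ℕ) : Sym.trn ∉ encodeNat m := by simp [encodeNat]

theorem trn_notMem_encodeSet {n : ℕ} (c : Finset (Fin n)) : Sym.trn ∉ encodeSet c := by
  simp [encodeSet]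

section

variable {a s n : ℕ} {C : Finset (Finset (Fin n))} {cs : List C}

theorem encodeTrans_eq_cons (t : Trans (Fin a) (Fin s) C) :
    ∃ r, encodeTrans cs t = Sym.trn :: r ∧ Sym.trn ∉ r := by
  refine ⟨_, rfl, ?_⟩
  have h1 : Sym.trn ∉ encodeLabel t.label := by
    cases t.label <;> simp [encodeLabel, trn_notMem_encodeNat]
  have h2 : Sym.trn ∉ encodeInstr cs t.instr := by
    cases t.instr <;> simp [encodeInstr, trn_notMem_encodeSet]
  simp only [List.mem_append, trn_notMem_encodeNat, h1, h2, or_self, not_false_eq_true]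

/-- The word describes an automaton with the given parts. -/
structure Layout (a s n q : ℕ) (C : Finset (Finset (Fin n))) (cs : List C)
    (ts : List (Trans (Fin a) (Fin s) C)) (x : List Sym) : Prop where
  alphabet : OccursAt x 0 (encodeNat a)
  states : OccursAt x (a.size + 1) (encodeNat s)
  basis : OccursAt x (a.size + 1 + s.size + 1) (encodeNat n)
  init : OccursAt x (a.size + 1 + s.size + 1 + n.size + 1) (encodeNat q)
  counter : ∀ i (hi : i < cs.length), OccursAt x
    (a.size + 1 + s.size + 1 + n.size + 1 + q.size + 1 + i * (n + 2)) (Sym.ctr :: encodeSet cs[i].1)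
  counters_end : symAt x
    (a.size + 1 + s.size + 1 + n.size + 1 + q.size + 1 + cs.length * (n + 2)) ≠ 4
  exists_trans : ∀ p, symAt x p = 5 → ∃ t ∈ ts, OccursAt x p (encodeTrans cs t)
  exists_pos : ∀ t ∈ ts, ∃ p, OccursAt x p (encodeTrans cs t)

theorem Layout.of_eq {q : ℕ} {ts : List (Trans (Fin a) (Fin s) C)} {x : List Sym}
    (hx : x = encodeNat a ++ encodeNat s ++ encodeNat n ++ encodeNat q ++
      cs.flatMap (fun c => Sym.ctr :: encodeSet c.1) ++ ts.flatMap (encodeTrans cs)) :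
    Layout a s n q C cs ts x := by
  have h0 : OccursAt x 0 (encodeNat a ++ (encodeNat s ++ (encodeNat n ++ (encodeNat q ++
      (cs.flatMap (fun c => Sym.ctr :: encodeSet c.1) ++ ts.flatMap (encodeTrans cs)))))) := by
    refine ⟨[], by simp [hx]⟩
  have h1 := h0.right
  have h2 := h1.right
  have h3 := h2.right
  have h4 := h3.right
  simp only [length_encodeNat, Nat.zero_add, ← Nat.add_assoc] at h1 h2 h3 h4
  have hL : ∀ c ∈ cs, (Sym.ctr :: encodeSet c.1).length = n + 2 := fun c _ => by
    simp [length_encodeSet]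
  refine ⟨h0.left, h1.left, h2.left, h3.left, fun i hi => h4.left.flatMap hL hi, ?_, ?_, ?_⟩
  · have h5 := h4.right
    have hlen : (cs.flatMap (fun c => Sym.ctr :: encodeSet c.1)).length = cs.length * (n + 2) := by
      rw [List.length_flatMap]
      rw [List.map_congr_left hL]
      simp
    rw [hlen] at h5
    set P := a.size + 1 + s.size + 1 + n.size + 1 + q.size + 1 + cs.length * (n + 2)
    -- Behind the counters the word ends or a transition begins; neither gives code `4`.
    cases ts with
    | nil =>
      rw [symAt_of_length_le]; · omega
      rw [hx]
      simp only [List.length_append, length_encodeNat, hlen, List.flatMap_nil, List.length_nil]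
      omega
    | cons t ts =>
      obtain ⟨r, hr, -⟩ := encodeTrans_eq_cons (cs := cs) t
      rw [List.flatMap_cons, hr, List.cons_append] at h5
      rw [h5.symAt_head]
      simp [symCode]
  · intro p hp
    rw [symAt_eq_five, hx] at hp
    rw [hx]
    refine exists_occursAt_of_getElem? (fun t _ => encodeTrans_eq_cons t) ?_ hp
    simp [trn_notMem_encodeNat, trn_notMem_encodeSet]
  · intro t ht
    rw [hx]
    exact exists_occursAt_of_mem ht _

end

/-! ## Configurations as numbers -/

theorem exists_digits {D : ℕ} (m : ℕ) {d : ℕ → ℕ} (hd : ∀ i < m, d i < D) :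
    ∃ N < D ^ m, ∀ i < m, N / D ^ i % D = d i := by
  induction m with
  | zero => exact ⟨0, by simp, by simp⟩
  | succ m ih =>
    obtain ⟨N, hN, h⟩ := ih fun i hi => hd i (by omega)
    have hm := hd m (by omega)
    have hD : 0 < D := by omega
    refine ⟨N + D ^ m * d m, ?_, fun i hi => ?_⟩
    · calc N + D ^ m * d m < D ^ m * (d m + 1) := by rw [mul_add]; omega
        _ ≤ D ^ (m + 1) := by rw [pow_succ]; exact Nat.mul_le_mul_left _ hm
    · rcases Nat.lt_succ_iff_lt_or_eq.1 hi with hi | rfl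
      · obtain ⟨r, rfl⟩ : ∃ r, m = i + 1 + r := ⟨m - (i + 1), by omega⟩
        rw [show N + D ^ (i + 1 + r) * d (i + 1 + r) =
          N + D ^ i * (D * (D ^ r * d (i + 1 + r))) by ring,
          Nat.add_mul_div_left _ _ (pow_pos hD _), Nat.add_mul_mod_self_left, h i hi]
      · rw [Nat.add_mul_div_left _ _ (pow_pos hD _), Nat.div_eq_of_lt hN, Nat.zero_add,
          Nat.mod_eq_of_lt hm]

section

variable {n m D : ℕ} {C : Finset (Finset (Fin n))} (e : Fin m ≃ C)

/-- Expresses an update by bounded quantifiers over indices of counters, which a program can test.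
-/
theorem eq_update_iff {α β : ℕ → ℕ} {c : C} {g : ℕ → ℕ} :
    ((fun d => β (e.symm d)) = Function.update (fun d => α (e.symm d)) c (g (α (e.symm c)))) ↔
      ∃ i < m, (∃ hi : i < m, e ⟨i, hi⟩ = c) ∧
        ∀ j < m, β j = if j = i then g (α j) else α j := by
  constructor
  · intro h
    refine ⟨e.symm c, (e.symm c).2, ⟨(e.symm c).2, by simp⟩, fun j hj => ?_⟩
    have := congrFun h (e ⟨j, hj⟩)
    simp only [Equiv.symm_apply_apply, Function.update_apply, ← Equiv.eq_symm_apply,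
      Fin.ext_iff] at this
    rw [this]
    split_ifs with h1
    · rw [h1]
    · rfl
  · rintro ⟨i, hi, ⟨_, rfl⟩, h⟩
    funext d
    obtain ⟨j, rfl⟩ := e.surjective d
    simp only [Equiv.symm_apply_apply, Function.update_apply, EmbeddingLike.apply_eq_iff_eq,
      h j j.2, Fin.ext_iff]
    split_ifs with h1
    · rw [h1]
    · rfl

theorem sum_counters (g : C → ℕ) (b : ℕ → ℕ) (h : ∀ i : Fin m, g (e i) = b i) :
    ∑ c, g c = ∑ i ∈ Finset.range m, b i := by
  rw [← Equiv.sum_comp e, Finset.sum_range]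
  exact Finset.sum_congr rfl fun i _ => h i

/-- The relevant entries of `K` are bounded by the row sums `α i < D`, so the matrix can be guessed
as a single number with `m * m` digits in base `D`. Entries not permitted by `f` are masked by the
0-1 matrix `b`. -/
theorem exists_transfer_iff {f : C → Finset C} {α β : ℕ → ℕ} {b : ℕ → ℕ → ℕ}
    (hα : ∀ i < m, α i < D) (hb : ∀ i j : Fin m, b i j = if e j ∈ f (e i) then 1 else 0) :
    (∃ K : C → C → ℕ, (∀ c, α (e.symm c) = ∑ c' ∈ f c, K c c') ∧
        ∀ c', β (e.symm c') = ∑ c : C with c' ∈ f c, K c c') ↔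
      ∃ k < D ^ (m * m),
        (∀ i < m, α i = ∑ j ∈ Finset.range m, b i j * (k / D ^ (i * m + j) % D)) ∧
        ∀ j < m, β j = ∑ i ∈ Finset.range m, b i j * (k / D ^ (i * m + j) % D) := by
  have hidx : ∀ i < m, ∀ j < m, i * m + j < m * m := fun i hi j hj => by
    calc i * m + j < i * m + m := by omega
      _ = (i + 1) * m := by ring
      _ ≤ m * m := Nat.mul_le_mul_right _ hi
  constructor
  · rintro ⟨K, h1, h2⟩
    have hK : ∀ c, ∀ c' ∈ f c, K c c' < D := fun c c' hc' => by
      refine lt_of_le_of_lt ?_ (hα (e.symm c) (e.symm c).2)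
      rw [h1]
      exact Finset.single_le_sum (f := K c) (fun _ _ => Nat.zero_le _) hc'
    let d : ℕ → ℕ := fun r => if h : r / m < m ∧ r % m < m then
      (if e ⟨r % m, h.2⟩ ∈ f (e ⟨r / m, h.1⟩) then K (e ⟨r / m, h.1⟩) (e ⟨r % m, h.2⟩) else 0)
      else 0
    obtain ⟨k, hk, hd⟩ := exists_digits (D := D) (m * m) (d := d) (by
      intro r hr
      have hm : 0 < m := by
        rcases Nat.eq_zero_or_pos m with rfl | h
        · simp at hr
        · exact h
      have hD := hα 0 hm
      simp only [d]
      split_ifs with h3 h4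
      · exact hK _ _ h4
      · omega
      · omega)
    have hdig : ∀ i j : Fin m, k / D ^ ((i : ℕ) * m + j) % D =
        if e j ∈ f (e i) then K (e i) (e j) else 0 := by
      intro i j
      rw [hd _ (hidx i i.2 j j.2)]
      have hm : 0 < m := by have := i.2; omega
      have q1 : ((i : ℕ) * m + j) / m = i := by
        rw [Nat.mul_comm, Nat.mul_add_div hm, Nat.div_eq_of_lt j.2, Nat.add_zero]
      have q2 : ((i : ℕ) * m + j) % m = j := by
        rw [Nat.mul_comm, Nat.mul_add_mod, Nat.mod_eq_of_lt j.2]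
      simp only [d, q1, q2, i.2, j.2, and_self, dite_true]
    refine ⟨k, hk, fun i hi => ?_, fun j hj => ?_⟩
    · have := h1 (e ⟨i, hi⟩)
      simp only [Equiv.symm_apply_apply] at this
      rw [this, ← Finset.univ_inter (f _), ← Finset.sum_ite_mem]
      refine sum_counters e _ _ fun j => ?_
      rw [hdig ⟨i, hi⟩ j, hb ⟨i, hi⟩ j]
      split_ifs <;> simp
    · have := h2 (e ⟨j, hj⟩)
      simp only [Equiv.symm_apply_apply] at this
      rw [this, Finset.sum_filter]
      refine sum_counters e _ _ fun i => ?_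
      rw [hdig i ⟨j, hj⟩, hb i ⟨j, hj⟩]
      split_ifs <;> simp
  · rintro ⟨k, -, h1, h2⟩
    refine ⟨fun c c' => k / D ^ ((e.symm c : ℕ) * m + e.symm c') % D, fun c => ?_, fun c' => ?_⟩
    · rw [h1 _ (e.symm c).2]
      have := sum_counters e (fun c' => if c' ∈ f c then
        k / D ^ ((e.symm c : ℕ) * m + e.symm c') % D else 0)
        (fun j => b (e.symm c) j * (k / D ^ ((e.symm c : ℕ) * m + j) % D)) (fun j => by
          rw [hb]; simp)
      rw [← this, Finset.sum_ite_mem, Finset.univ_inter]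
    · rw [h2 _ (e.symm c').2, Finset.sum_filter]
      symm
      refine sum_counters e _ _ fun i => ?_
      rw [hb i (e.symm c')]
      simp

end

end IPCANT


/-! ## Lazy runs as paths -/

namespace IPCANT

/-- Transfers preserve the number of tokens, and an increment adds one. -/
theorem LazyObtains.sum_le {X : Type*} [DecidableEq X] {C : Finset (Finset X)} {l : Instr C}
    {v v' : Valuation C} (h : LazyObtains l v v') : ∑ c, v' c ≤ ∑ c, v c + 1 := by
  have hupd : ∀ (c : C) (y : ℕ), y ≤ v c + 1 → ∑ d, Function.update v c y d ≤ ∑ d, v d + 1 := by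
    intro c y hy
    rw [Finset.sum_update_of_mem (Finset.mem_univ c), ← Finset.add_sum_erase _ v (Finset.mem_univ c),
      Finset.sdiff_singleton_eq_erase]
    omega
  cases l with
  | inc c => rw [LazyObtains.inc_iff.1 h]; exact hupd _ _ le_rfl
  | dec c => rw [LazyObtains.dec_iff.1 h]; exact hupd _ _ (by omega)
  | transf f hf =>
    obtain ⟨K, h1, h2⟩ := LazyObtains.transf_iff.1 h
    simp only [h1, h2]
    rw [Finset.sum_comm' (t' := Finset.univ) (s' := f) (by simp)]
    exact Nat.le_succ _

end IPCANT

namespace SafetyIPCANT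

open IPCANT SpaceTM

variable {A X : Type*} {s m : ℕ}

/-- The configuration with number `u`. -/
def ofCode (M : SafetyIPCANT A (Fin s) X) (e : Fin m ≃ M.counters) (D u : ℕ) : M.Config :=
  (⟨u % s, Nat.mod_lt _ M.init.pos⟩, fun c => u / s / D ^ (e.symm c : ℕ) % D)

variable {M : SafetyIPCANT A (Fin s) X} {e : Fin m ≃ M.counters} {D : ℕ}

theorem exists_ofCode_eq {z : M.Config} (hz : ∀ c, z.2 c < D) :
    ∃ u < s * D ^ m, M.ofCode e D u = z := by
  obtain ⟨N, hN, hd⟩ := exists_digits (D := D) m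
    (d := fun i => if h : i < m then z.2 (e ⟨i, h⟩) else 0) (fun i hi => by simp [hi, hz])
  have hs := M.init.pos
  have hq := z.1.2
  refine ⟨z.1 + s * N, ?_, ?_⟩
  · calc (z.1 : ℕ) + s * N < s * (N + 1) := by rw [mul_add]; omega
      _ ≤ s * D ^ m := Nat.mul_le_mul_left _ hN
  · refine Prod.ext (Fin.ext ?_) (funext fun c => ?_)
    · simp [ofCode, Nat.mod_eq_of_lt hq]
    · simp only [ofCode]
      rw [Nat.add_mul_div_left _ _ hs, Nat.div_eq_of_lt hq, Nat.zero_add, hd _ (e.symm c).2]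
      simp

theorem ofCode_init : M.ofCode e D M.init = M.initConfig := by
  refine Prod.ext (Fin.ext ?_) (funext fun c => ?_)
  · simp [ofCode, initConfig, Nat.mod_eq_of_lt M.init.2]
  · simp [ofCode, initConfig, Nat.div_eq_of_lt M.init.2]

variable [DecidableEq X]

/-- Lazy transitions between numbers of configurations. -/
def LazyEdge (M : SafetyIPCANT A (Fin s) X) (e : Fin m ≃ M.counters) (D u v : ℕ) : Prop :=
  ∃ w l, M.LazyStep w l (M.ofCode e D u) (M.ofCode e D v)

theorem path_of_run {V J : ℕ} {z : ℕ → M.Config}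
    (hz : ∀ i ≤ 2 ^ J, ∃ u < V, M.ofCode e D u = z i)
    (hstep : ∀ i < 2 ^ J, ∃ w l, M.LazyStep w l (z i) (z (i + 1))) {u v : ℕ}
    (hu : M.ofCode e D u = z 0) (hv : M.ofCode e D v = z (2 ^ J)) :
    Bisection.Path V (M.LazyEdge e D) J u v := by
  induction J generalizing z u v with
  | zero =>
    have := hstep 0 (by simp)
    simp only [Bisection.Path, LazyEdge, hu, hv]
    exact this
  | succ J ih =>
    have h2 : 2 ^ (J + 1) = 2 ^ J + 2 ^ J := by ring
    have hpos : 0 < 2 ^ J := by positivity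
    rw [h2] at hz hstep hv
    obtain ⟨d, hd, hdz⟩ := hz (2 ^ J) (by omega)
    refine ⟨d, hd, ih (fun i hi => hz i (by omega)) (fun i hi => hstep i (by omega)) hu hdz,
      ih (z := fun i => z (2 ^ J + i)) (fun i hi => hz _ (by omega))
        (fun i hi => hstep _ (by omega)) hdz hv⟩

theorem run_of_path {V J : ℕ} {u v : ℕ} (h : Bisection.Path V (M.LazyEdge e D) J u v) :
    ∃ z : ℕ → M.Config, z 0 = M.ofCode e D u ∧ z (2 ^ J) = M.ofCode e D v ∧
      ∀ i < 2 ^ J, ∃ w l, M.LazyStep w l (z i) (z (i + 1)) := by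
  induction J generalizing u v with
  | zero =>
    refine ⟨fun i => if i = 0 then M.ofCode e D u else M.ofCode e D v, by simp, by simp, ?_⟩
    intro i hi
    obtain rfl : i = 0 := by simpa using hi
    obtain ⟨w, l, h⟩ : M.LazyEdge e D u v := h
    exact ⟨w, l, by simpa using h⟩
  | succ J ih =>
    obtain ⟨d, -, h1, h2⟩ := h
    obtain ⟨y, hy0, hy1, hy⟩ := ih h1
    obtain ⟨z, hz0, hz1, hz⟩ := ih h2
    have hpos : 0 < 2 ^ J := by positivity
    refine ⟨fun i => if i ≤ 2 ^ J then y i else z (i - 2 ^ J), by simp [hy0], ?_, fun i hi => ?_⟩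
    · rw [show 2 ^ (J + 1) = 2 ^ J + 2 ^ J by ring]
      simp [hz1]
    · rw [show 2 ^ (J + 1) = 2 ^ J + 2 ^ J by ring] at hi
      rcases lt_trichotomy i (2 ^ J) with h | h | h
      · simpa [h.le, Nat.succ_le_of_lt h] using hy i h
      · have := hz 0 hpos
        simp only [h, le_refl, if_true, hy1, ← hz0]
        simpa using this
      · have := hz (i - 2 ^ J) (by omega)
        rw [show i - 2 ^ J + 1 = i + 1 - 2 ^ J by omega] at this
        simpa [show ¬ i ≤ 2 ^ J by omega, show ¬ i + 1 ≤ 2 ^ J by omega] using this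

/-- Starting from zero, `2 ^ J` steps create at most `2 ^ J < D` tokens, so every configuration of
the run has a code. -/
theorem hasLazyRun_iff_exists_path {J : ℕ} (hD : 2 ^ J < D) :
    M.HasLazyRun (2 ^ J) ↔ ∃ v < s * D ^ m,
      Bisection.Path (s * D ^ m) (M.LazyEdge e D) J M.init v := by
  constructor
  · rintro ⟨z, h0, hstep⟩
    have hsum : ∀ i ≤ 2 ^ J, ∑ c, (z i).2 c ≤ i := by
      intro i
      induction i with
      | zero => intro _; simp [h0, initConfig]
      | succ i ih =>
        intro hi
        obtain ⟨w, l, h⟩ := hstep i (by omega)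
        have h1 := (lazyStep_iff.1 h).2.sum_le
        have h2 := ih (by omega)
        omega
    have hz : ∀ i ≤ 2 ^ J, ∃ u < s * D ^ m, M.ofCode e D u = z i := fun i hi =>
      exists_ofCode_eq fun c => by
        have h1 := Finset.single_le_sum (f := (z i).2) (fun _ _ => Nat.zero_le _)
          (Finset.mem_univ c)
        have h2 := hsum i hi
        omega
    obtain ⟨v, hv, hvz⟩ := hz (2 ^ J) le_rfl
    exact ⟨v, hv, path_of_run hz hstep (by rw [ofCode_init, h0]) hvz⟩
  · rintro ⟨v, -, h⟩
    obtain ⟨z, h0, -, hz⟩ := run_of_path h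
    exact ⟨z, by rw [h0, ofCode_init], hz⟩

end SafetyIPCANT


/-! ## Computing the lazy transitions from the description -/

namespace IPCANT

/-- Binary logarithm of the length of the runs that are searched for. -/
def height (s n : ℕ) : ℕ := (s.size + 2) * 2 ^ (2 * (n * n) + n)

/-- A strict bound for the values of the counters in these runs. -/
def base (s n : ℕ) : ℕ := 2 ^ height s n + 1

/-- The number `B` exceeds everything that occurs in the computation, for a description of length
`len` of an automaton with `s` states, basis of size `n` and `m` counters. -/
structure Ample (len s n m B : ℕ) : Prop where
  sixteen_le : 16 ≤ B
  length_lt : len < B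
  states_le : s ≤ B
  basis_le : n ≤ B
  height_le : height s n ≤ B
  base_le : base s n ≤ B
  sq_le : m * m ≤ B
  mul_base_le : m * base s n ≤ B
  matrix_le : base s n ^ (m * m) ≤ B
  path_le : 2 + (2 * (s * base s n ^ m)) ^ height s n ≤ B

end IPCANT

namespace SpaceTM

namespace Fn

open IPCANT

variable {k : ℕ}

/-- The position of the number of states. -/
def posStates : Fn 0 := skip zero
/-- The position of the size of the basis. -/
def posBasis : Fn 0 := skip posStates
/-- The position of the initial state. -/
def posInit : Fn 0 := skip posBasis
/-- The position of the first counter. -/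
def posCounters : Fn 0 := skip posInit

/-- The number of states. -/
def numStates : Fn 0 := value posStates
/-- The length of the number of states. -/
def sizeStates : Fn 0 := sub (sepPos posStates) posStates
/-- The size of the basis. -/
def sizeBasis : Fn 0 := value posBasis
/-- The initial state. -/
def initState : Fn 0 := value posInit

/-- The position of a counter. -/
def posCounter (i : Fn k) : Fn k :=
  add (app₀ posCounters) (mul i (add (app₀ sizeBasis) (num 2)))

/-- The number of counters. -/
def numCounters : Fn 0 :=
  loop length zero (ifEq (inp (posCounter (var 1))) (num 4) (succ (var 1)) (var 1))

/-- The function that computes `height`. -/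
def heightFn : Fn 0 :=
  mul (add sizeStates (num 2))
    (pow (num 2) (add (mul (num 2) (mul sizeBasis sizeBasis)) sizeBasis))

/-- The function that computes `base`. -/
def baseFn : Fn 0 := succ (pow (num 2) heightFn)

/-- The number of codes of configurations. -/
def numCodes : Fn 0 := mul numStates (pow baseFn numCounters)

/-- A digit of a number. -/
def digitAt (u i : Fn k) : Fn k := mod (div u (pow (app₀ baseFn) i)) (app₀ baseFn)

/-- The value of a counter in a configuration. -/
def counterValue (u i : Fn k) : Fn k := digitAt (div u (app₀ numStates)) i

/-- Whether the counter with a given index is the one that is written at a given position. -/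
def isCounter : Fn 2 :=
  all (app₀ sizeBasis) (eq (inp (add (succ (var 2)) (var 0)))
    (inp (add (succ (posCounter (var 1))) (var 0))))

/-- The increment or decrement at a given position. -/
def updateFn : Fn 3 :=
  ex (app₀ numCounters) (and (app₂ isCounter (var 0) (var 1))
    (all (app₀ numCounters) (eq (counterValue (var 4) (var 0))
      (ifEq (var 0) (var 1)
        (ifEq (inp (var 2)) (num 8) (succ (counterValue (var 3) (var 0)))
          (sub (counterValue (var 3) (var 0)) (num 1)))
        (counterValue (var 3) (var 0))))))

/-- An entry of the matrix of a transfer times an entry of a guessed matrix. -/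
def entryFn : Fn 4 :=
  mul (sub (inp (add (succ (var 0)) (add (mul (var 2) (succ (app₀ numCounters))) (var 3))))
      (num 1))
    (digitAt (var 1) (add (mul (var 2) (app₀ numCounters)) (var 3)))

/-- The transfer at a given position. -/
def transferFn : Fn 3 :=
  ex (pow (app₀ baseFn) (mul (app₀ numCounters) (app₀ numCounters))) (and
    (all (app₀ numCounters) (eq (counterValue (var 3) (var 0))
      (sum (app₀ numCounters) (app₄ entryFn (var 3) (var 2) (var 1) (var 0)))))
    (all (app₀ numCounters) (eq (counterValue (var 4) (var 0))
      (sum (app₀ numCounters) (app₄ entryFn (var 3) (var 2) (var 0) (var 1))))))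

/-- The instruction at a given position. -/
def instrFn : Fn 3 := ifEq (inp (var 0)) (num 10) transferFn updateFn

/-- The position of the target of the transition at a given position. -/
def posTarget (p : Fn k) : Fn k := skip (succ p)
/-- The position of the label. -/
def posLabel (p : Fn k) : Fn k := skip (posTarget p)
/-- The position of the instruction. -/
def posInstr (p : Fn k) : Fn k :=
  ifEq (inp (posLabel p)) (num 6) (succ (posLabel p)) (skip (succ (posLabel p)))

/-- Whether there is a lazy transition between two configurations. -/
def edgeFn : Fn 2 :=
  ex (app₀ length) (and (eq (inp (var 0)) (num 5))
    (and (eq (value (succ (var 0))) (mod (var 1) (app₀ numStates)))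
      (and (eq (value (posTarget (var 0))) (mod (var 2) (app₀ numStates)))
        (app₃ instrFn (posInstr (var 0)) (var 1) (var 2)))))

variable {B : ℕ} {ρ : Fin k → ℕ} {a s n q : ℕ} {C : Finset (Finset (Fin n))} {cs : List C}
  {ts : List (Trans (Fin a) (Fin s) C)} {x : List Sym}

theorem eval_skip_nat (hB : 3 ≤ B) {e : Fn k} {p m : ℕ} (he : e.eval symCode x B ρ = p)
    (h : OccursAt x p (encodeNat m)) (hlen : x.length < B) :
    (skip e).eval symCode x B ρ = p + m.size + 1 := by
  have h' := h.add_le_length (by simp [encodeNat])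
  rw [length_encodeNat] at h'
  rw [← Nat.size_eq_bits_len]
  exact eval_skip hB he h (by rw [Nat.size_eq_bits_len]; omega)

theorem eval_value_nat (hB : 3 ≤ B) {e : Fn k} {p m : ℕ} (he : e.eval symCode x B ρ = p)
    (h : OccursAt x p (encodeNat m)) (hlen : x.length < B) :
    (value e).eval symCode x B ρ = min m B := by
  have h' := h.add_le_length (by simp [encodeNat])
  rw [length_encodeNat] at h'
  exact eval_value_min hB he h (by omega)

theorem eval_posStates (hL : Layout a s n q C cs ts x) (hB : 3 ≤ B) (hlen : x.length < B) :
    posStates.eval symCode x B ![] = a.size + 1 := by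
  have h := eval_skip_nat (ρ := ![]) (e := zero) (p := 0) hB rfl hL.alphabet hlen
  rwa [Nat.zero_add] at h

theorem eval_posBasis (hL : Layout a s n q C cs ts x) (hB : 3 ≤ B) (hlen : x.length < B) :
    posBasis.eval symCode x B ![] = a.size + 1 + s.size + 1 :=
  eval_skip_nat hB (eval_posStates hL hB hlen) hL.states hlen

theorem eval_posInit (hL : Layout a s n q C cs ts x) (hB : 3 ≤ B) (hlen : x.length < B) :
    posInit.eval symCode x B ![] = a.size + 1 + s.size + 1 + n.size + 1 :=
  eval_skip_nat hB (eval_posBasis hL hB hlen) hL.basis hlen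

theorem eval_posCounters (hL : Layout a s n q C cs ts x) (hB : 3 ≤ B) (hlen : x.length < B) :
    posCounters.eval symCode x B ![] = a.size + 1 + s.size + 1 + n.size + 1 + q.size + 1 :=
  eval_skip_nat hB (eval_posInit hL hB hlen) hL.init hlen

theorem eval_sizeStates (hL : Layout a s n q C cs ts x) (hB : 3 ≤ B) (hlen : x.length < B) :
    sizeStates.eval symCode x B ![] = s.size := by
  have h' := hL.states.add_le_length (by simp [encodeNat])
  rw [length_encodeNat] at h'
  rw [sizeStates, eval_sub_eq (eval_sepPos hB (eval_posStates hL hB hlen) hL.states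
    (by rw [Nat.size_eq_bits_len]; omega)) (eval_posStates hL hB hlen), Nat.size_eq_bits_len]
  omega

theorem eval_sizeBasis_min (hL : Layout a s n q C cs ts x) (hB : 3 ≤ B) (hlen : x.length < B) :
    sizeBasis.eval symCode x B ![] = min n B :=
  eval_value_nat hB (eval_posBasis hL hB hlen) hL.basis hlen

theorem _root_.IPCANT.Ample.three_le {len s n m B : ℕ} (hA : Ample len s n m B) : 3 ≤ B :=
  le_trans (by norm_num) hA.sixteen_le

theorem _root_.IPCANT.Ample.one_le {len s n m B : ℕ} (hA : Ample len s n m B) : 1 ≤ B :=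
  le_trans (by norm_num) hA.sixteen_le

theorem base_pos (s n : ℕ) : 0 < base s n := Nat.succ_pos _

theorem height_pos (s n : ℕ) : 0 < height s n := by unfold height; positivity

theorem _root_.IPCANT.Ample.codes_lt {len s n m B : ℕ} (hA : Ample len s n m B) :
    s * base s n ^ m < B := by
  have h := hA.path_le
  have h' := Nat.le_self_pow (height_pos s n).ne' (2 * (s * base s n ^ m))
  omega

theorem eval_numStates (hL : Layout a s n q C cs ts x) (hA : Ample x.length s n cs.length B) :
    numStates.eval symCode x B ![] = s :=
  (eval_value_nat hA.three_le (eval_posStates hL hA.three_le hA.length_lt) hL.states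
    hA.length_lt).trans (min_eq_left hA.states_le)

theorem eval_sizeBasis (hL : Layout a s n q C cs ts x) (hA : Ample x.length s n cs.length B) :
    sizeBasis.eval symCode x B ![] = n :=
  (eval_sizeBasis_min hL hA.three_le hA.length_lt).trans (min_eq_left hA.basis_le)

theorem eval_initState (hL : Layout a s n q C cs ts x) (hA : Ample x.length s n cs.length B)
    (hq : q < s) : initState.eval symCode x B ![] = q :=
  (eval_value_nat hA.three_le (eval_posInit hL hA.three_le hA.length_lt) hL.init
    hA.length_lt).trans (min_eq_left (hq.le.trans hA.states_le))

theorem counters_le_length (hL : Layout a s n q C cs ts x) :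
    a.size + 1 + s.size + 1 + n.size + 1 + q.size + 1 + cs.length * (n + 2) ≤ x.length := by
  rcases Nat.eq_zero_or_pos cs.length with h | h
  · have h' := hL.init.add_le_length (by simp [encodeNat])
    rw [length_encodeNat] at h'
    rw [h]; omega
  · have h' := (hL.counter (cs.length - 1) (by omega)).add_le_length (by simp)
    rw [List.length_cons, length_encodeSet] at h'
    obtain ⟨m, hm⟩ : ∃ m, cs.length = m + 1 := ⟨cs.length - 1, by omega⟩
    rw [hm] at h' ⊢
    rw [Nat.add_sub_cancel] at h'
    rw [Nat.add_mul]
    omega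

theorem eval_posCounter (hL : Layout a s n q C cs ts x) (hA : Ample x.length s n cs.length B)
    {e : Fn k} {i : ℕ} (he : e.eval symCode x B ρ = i) (hi : i ≤ cs.length) :
    (posCounter e).eval symCode x B ρ =
      a.size + 1 + s.size + 1 + n.size + 1 + q.size + 1 + i * (n + 2) := by
  have h1 := counters_le_length hL
  have h2 := hA.length_lt
  have h3 : i * (n + 2) ≤ cs.length * (n + 2) := Nat.mul_le_mul_right _ hi
  refine eval_add_eq (by simpa using eval_posCounters hL hA.three_le h2) ?_ (by omega)
  have h16 := hA.sixteen_le
  -- Nothing bounds `n + 2` by the cap if there are no counters; for `i = 0` a saturated factor is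
  -- harmless.
  rcases Nat.eq_zero_or_pos i with h0 | h0
  · rw [eval_mul_min, he, h0]; simp
  · refine eval_mul_eq he (eval_add_eq (by simpa using eval_sizeBasis hL hA)
      (eval_num_eq (by omega)) ?_) (by omega)
    have : n + 2 ≤ i * (n + 2) := Nat.le_mul_of_pos_left _ h0
    omega

theorem eval_length_eq (hA : Ample x.length s n cs.length B) :
    length.eval symCode x B ![] = x.length := by
  rw [eval_length, min_eq_left hA.length_lt.le]

/-- The count advances while the block it points to opens with code `4`; `length` rounds are plenty.
-/
theorem eval_numCounters (hL : Layout a s n q C cs ts x)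
    (hA : Ample x.length s n cs.length B) :
    numCounters.eval symCode x B ![] = cs.length := by
  have h1 := counters_le_length hL
  have h2 := hA.length_lt
  have h16 := hA.sixteen_le
  have h3 : cs.length ≤ cs.length * (n + 2) := Nat.le_mul_of_pos_right _ (by omega)
  have key := loop_induction (code := symCode) (x := x) (B := B) (ρ := ![]) (n := length)
    (a := zero) (b := ifEq (inp (posCounter (var 1))) (num 4) (succ (var 1)) (var 1))
    (fun j v => v = min j cs.length) (by simp [eval]) (by
      rintro j _ - rfl
      have hp := eval_inp_eq (eval_posCounter hL hA (e := (var 1 : Fn 2)) (i := min j cs.length)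
        (ρ := ![j, min j cs.length]) (by simp [eval]) (min_le_right _ _))
      by_cases hj : cs.length ≤ j
      · rw [min_eq_right hj] at hp ⊢
        rw [min_eq_right (by omega), eval_ifEq_neg]
        · simp [eval]
        · rw [hp, eval_num_eq (by omega)]
          exact hL.counters_end
      · rw [min_eq_left (by omega)] at hp ⊢
        rw [min_eq_left (by omega), eval_ifEq_pos]
        · exact eval_succ_eq (by simp [eval]) (by omega)
        · rw [hp, eval_num_eq (by omega), (hL.counter j (by omega)).symAt_head]
          rfl)
  rw [eval_length_eq hA, min_eq_right (by omega)] at key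
  exact key

theorem eval_heightFn (hL : Layout a s n q C cs ts x) (hA : Ample x.length s n cs.length B) :
    heightFn.eval symCode x B ![] = height s n := by
  have h1 := hA.height_le
  have h16 := hA.sixteen_le
  have hb : sizeBasis.eval symCode x B ![] = n := eval_sizeBasis hL hA
  have h2 : 2 ^ (2 * (n * n) + n) ≤ B :=
    le_trans (Nat.le_mul_of_pos_left _ (by omega)) h1
  have h3 : 2 * (n * n) + n ≤ B := Nat.lt_two_pow_self.le.trans h2
  have h4 : s.size + 2 ≤ B := le_trans (Nat.le_mul_of_pos_right _ (by positivity)) h1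
  exact eval_mul_eq (eval_add_eq (eval_sizeStates hL hA.three_le hA.length_lt)
    (eval_num_eq (by omega)) h4) (eval_pow_eq (eval_num_eq (by omega)) (eval_add_eq (eval_mul_eq
    (eval_num_eq (by omega)) (eval_mul_eq hb hb (by omega)) (by omega)) hb (by omega)) h2) h1

theorem eval_baseFn (hL : Layout a s n q C cs ts x) (hA : Ample x.length s n cs.length B) :
    baseFn.eval symCode x B ![] = base s n := by
  have h1 : 2 ^ height s n + 1 ≤ B := hA.base_le
  have h16 := hA.sixteen_le
  exact eval_succ_eq (eval_pow_eq (eval_num_eq (by omega)) (eval_heightFn hL hA) (by omega)) h1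

theorem eval_numCodes (hL : Layout a s n q C cs ts x) (hA : Ample x.length s n cs.length B)
    (hs : 0 < s) : numCodes.eval symCode x B ![] = s * base s n ^ cs.length := by
  have h1 := hA.codes_lt
  have h2 : base s n ^ cs.length ≤ s * base s n ^ cs.length := Nat.le_mul_of_pos_left _ hs
  exact eval_mul_eq (eval_numStates hL hA) (eval_pow_eq (eval_baseFn hL hA)
    (eval_numCounters hL hA) (by omega)) (by omega)

theorem eval_digitAt (hL : Layout a s n q C cs ts x) (hA : Ample x.length s n cs.length B)
    {e f : Fn k} {u i : ℕ} (he : e.eval symCode x B ρ = u) (hf : f.eval symCode x B ρ = i)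
    (hu : u < B) (hi : base s n ^ i ≤ B) :
    (digitAt e f).eval symCode x B ρ = u / base s n ^ i % base s n := by
  have hb : (app₀ baseFn : Fn k).eval symCode x B ρ = base s n := by
    simpa using eval_baseFn hL hA
  exact eval_mod_eq (eval_div_eq he (eval_pow_eq hb hf hi) (pow_pos (base_pos _ _) _) hu) hb
    (base_pos _ _) (lt_of_le_of_lt (Nat.div_le_self _ _) hu)

theorem eval_counterValue (hL : Layout a s n q C cs ts x)
    (hA : Ample x.length s n cs.length B) (hs : 0 < s)
    {e f : Fn k} {u i : ℕ} (he : e.eval symCode x B ρ = u) (hf : f.eval symCode x B ρ = i)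
    (hu : u < s * base s n ^ cs.length) (hi : i < cs.length) :
    (counterValue e f).eval symCode x B ρ = u / s / base s n ^ i % base s n := by
  have hB := hA.codes_lt
  refine eval_digitAt hL hA (eval_div_eq he (by simpa using eval_numStates hL hA) hs (by omega))
    hf (lt_of_le_of_lt (Nat.div_le_self _ _) (by omega)) ?_
  have h2 : base s n ^ cs.length ≤ s * base s n ^ cs.length := Nat.le_mul_of_pos_left _ hs
  have h3 : base s n ^ i ≤ base s n ^ cs.length := Nat.pow_le_pow_right (base_pos _ _) hi.le
  omega

theorem symCode_bit_injective {b b' : Bool}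
    (h : symCode (.sym (.bit b)) = symCode (.sym (.bit b'))) : b = b' := by
  cases b <;> cases b' <;> simp_all [symCode]

theorem symAt_encodeSet {p : ℕ} {c : Finset (Fin n)} (h : OccursAt x p (encodeSet c)) {j : ℕ}
    (hj : j < n) : symAt x (p + j) = symCode (.sym (.bit (decide (⟨j, hj⟩ ∈ c)))) := by
  rw [h.symAt_add (by rw [length_encodeSet]; omega)]
  simp only [encodeSet]
  rw [List.getElem_append_left (by simpa using hj)]
  simp

/-- Counters agree when their characteristic vectors do, and both are read from the input. -/
theorem eval_isCounter (hL : Layout a s n q C cs ts x) (hA : Ample x.length s n cs.length B)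
    {i r : ℕ} (hi : i < cs.length) {c : C} (h : OccursAt x (r + 1) (encodeSet c.1)) :
    isCounter.eval symCode x B ![i, r] = truth (∃ hi : i < cs.length, cs[i] = c) := by
  have hb : (app₀ sizeBasis : Fn 2).eval symCode x B ![i, r] = n := by
    simpa using eval_sizeBasis hL hA
  have hc := (hL.counter i hi).tail
  have h1 := hc.add_le_length (by simp [encodeSet])
  have h2 := h.add_le_length (by simp [encodeSet])
  rw [length_encodeSet] at h1 h2
  have hlen := hA.length_lt
  set P := a.size + 1 + s.size + 1 + n.size + 1 + q.size + 1 + i * (n + 2)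
  refine (eval_all hA.one_le (fun j => symAt x (r + 1 + j) = symAt x (P + 1 + j)) hb
    fun j hj => ?_).trans (truth_congr ?_)
  · exact eval_eq hA.one_le
      (eval_inp_eq (eval_add_eq (eval_succ_eq (by simp [eval]) (by omega)) (by simp [eval])
        (by omega)))
      (eval_inp_eq (eval_add_eq (eval_succ_eq (eval_posCounter hL hA (by simp [eval]) hi.le)
        (by omega)) (by simp [eval]) (by omega)))
  · constructor
    · intro heq
      refine ⟨hi, Subtype.ext (Finset.ext fun y => ?_)⟩
      have hy := heq y y.2
      rw [symAt_encodeSet h y.2, symAt_encodeSet hc y.2] at hy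
      have := symCode_bit_injective hy
      simpa using this.symm
    · rintro ⟨_, rfl⟩ j hj
      rw [symAt_encodeSet h hj, symAt_encodeSet hc hj]

end Fn

end SpaceTM


/-! ### Correctness of the test for lazy transitions -/

namespace SpaceTM

namespace Fn

open IPCANT

variable {k B : ℕ} {ρ : Fin k → ℕ} {a s n q : ℕ} {C : Finset (Finset (Fin n))} {cs : List C}
  {ts : List (Trans (Fin a) (Fin s) C)} {x : List Sym}

/-- `g` covers increments and decrements together; its truncated subtraction is the lazy decrement.
-/
theorem eval_updateFn (hL : Layout a s n q C cs ts x) (hA : Ample x.length s n cs.length B)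
    (hs : 0 < s) (e : Fin cs.length ≃ C) (he : ∀ i, e i = cs[i]) {u v r : ℕ}
    (hu : u < s * base s n ^ cs.length) (hv : v < s * base s n ^ cs.length) {c : C}
    (h : OccursAt x (r + 1) (encodeSet c.1)) {g : ℕ → ℕ}
    (hg : symAt x r = 8 ∧ g = (· + 1) ∨ symAt x r ≠ 8 ∧ g = (· - 1)) :
    updateFn.eval symCode x B ![r, u, v] = truth
      ((fun d => v / s / base s n ^ (e.symm d : ℕ) % base s n) =
        Function.update (fun d => u / s / base s n ^ (e.symm d : ℕ) % base s n) c
          (g (u / s / base s n ^ (e.symm c : ℕ) % base s n))) := by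
  have h16 := hA.sixteen_le
  have hm : ∀ {j : ℕ} {ρ : Fin j → ℕ},
      (app₀ numCounters : Fn j).eval symCode x B ρ = cs.length := by
    intro j ρ
    simpa using eval_numCounters hL hA
  rw [truth_congr (eq_update_iff e (α := fun i => u / s / base s n ^ i % base s n)
    (β := fun i => v / s / base s n ^ i % base s n) (g := g))]
  refine eval_ex hA.one_le _ hm fun i hi => eval_and hA.one_le ?_ fun _ =>
    eval_all hA.one_le _ hm fun j hj => eval_eq hA.one_le ?_ ?_
  · rw [eval_app₂]
    simp only [he]
    exact eval_isCounter hL hA hi h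
  · exact eval_counterValue hL hA hs (by simp [eval]) (by simp [eval]) hv hj
  · have hd : (counterValue (var 3) (var 0)).eval symCode x B ![j, i, r, u, v] =
        u / s / base s n ^ j % base s n :=
      eval_counterValue hL hA hs (by simp [eval]) (by simp [eval]) hu hj
    have hlt : u / s / base s n ^ j % base s n < base s n := Nat.mod_lt _ (base_pos _ _)
    have hbase := hA.base_le
    have hr : (inp (var 2)).eval symCode x B ![j, i, r, u, v] = symAt x r :=
      eval_inp_eq (by simp [eval])
    by_cases hij : j = i
    · rw [if_pos hij]
      refine (eval_ifEq_pos (by simp [eval, hij])).trans ?_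
      rcases hg with ⟨h8, rfl⟩ | ⟨h8, rfl⟩
      · exact (eval_ifEq_pos (by rw [eval_num_eq (by omega)]; exact hr.trans h8)).trans
          (eval_succ_eq hd (by omega))
      · exact (eval_ifEq_neg (by
          rw [eval_num_eq (by omega)]; exact fun h => h8 (hr.symm.trans h))).trans
          (eval_sub_eq hd (eval_num_eq (by omega)))
    · rw [if_neg hij]
      exact (eval_ifEq_neg (by simp [eval, hij])).trans hd

theorem occursAt_row {f : C → Finset C} {p : ℕ}
    (h : OccursAt x p (cs.flatMap fun c => cs.map (fun c' => Sym.bit (decide (c' ∈ f c))) ++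
      [Sym.sep])) {i : ℕ} (hi : i < cs.length) :
    OccursAt x (p + i * (cs.length + 1))
      (cs.map (fun c' => Sym.bit (decide (c' ∈ f cs[i]))) ++ [Sym.sep]) :=
  h.flatMap (fun c _ => by simp) hi

theorem symAt_matrix {f : C → Finset C} {p : ℕ}
    (h : OccursAt x p (cs.flatMap fun c => cs.map (fun c' => Sym.bit (decide (c' ∈ f c))) ++
      [Sym.sep])) {i j : ℕ} (hi : i < cs.length) (hj : j < cs.length) :
    symAt x (p + (i * (cs.length + 1) + j)) - 1 = if cs[j] ∈ f cs[i] then 1 else 0 := by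
  rw [← Nat.add_assoc, (occursAt_row h hi).symAt_add (by simp; omega),
    List.getElem_append_left (by simpa using hj), List.getElem_map]
  by_cases hm : cs[j] ∈ f cs[i] <;> simp [hm, symCode]

theorem mul_add_lt_mul_self {m i j : ℕ} (hi : i < m) (hj : j < m) : i * m + j < m * m :=
  calc i * m + j < (i + 1) * m := by rw [Nat.add_mul]; omega
    _ ≤ m * m := Nat.mul_le_mul_right _ hi

/-- A row of the written matrix takes `cs.length + 1` symbols because of the separator, a row of the
guessed one `cs.length` digits. -/
theorem eval_entryFn (hL : Layout a s n q C cs ts x) (hA : Ample x.length s n cs.length B)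
    {f : C → Finset C} {r : ℕ}
    (h : OccursAt x (r + 1) (cs.flatMap fun c =>
      cs.map (fun c' => Sym.bit (decide (c' ∈ f c))) ++ [Sym.sep])) {K i j : ℕ}
    (hK : K < base s n ^ (cs.length * cs.length)) (hi : i < cs.length) (hj : j < cs.length) :
    entryFn.eval symCode x B ![r, K, i, j] =
      (symAt x (r + 1 + (i * (cs.length + 1) + j)) - 1) *
        (K / base s n ^ (i * cs.length + j) % base s n) := by
  have h1 := (occursAt_row h hi).add_le_length (by simp)
  simp only [List.length_append, List.length_map, List.length_singleton] at h1
  have hlen := hA.length_lt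
  have h16 := hA.sixteen_le
  have hm : (app₀ numCounters : Fn 4).eval symCode x B ![r, K, i, j] = cs.length := by
    simpa using eval_numCounters hL hA
  have hsq := mul_add_lt_mul_self hi hj
  have hsq' := hA.sq_le
  have hmat := hA.matrix_le
  have hpw : base s n ^ (i * cs.length + j) ≤ base s n ^ (cs.length * cs.length) :=
    Nat.pow_le_pow_right (base_pos _ _) hsq.le
  have hlt : K / base s n ^ (i * cs.length + j) % base s n < base s n :=
    Nat.mod_lt _ (base_pos _ _)
  have hbase := hA.base_le
  have h01 := symAt_matrix h hi hj
  have hle : i ≤ i * (cs.length + 1) := Nat.le_mul_of_pos_right _ (by omega)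
  refine eval_mul_eq (eval_sub_eq (eval_inp_eq (eval_add_eq (eval_succ_eq (by simp [eval])
    (by omega)) (eval_add_eq (eval_mul_eq (by simp [eval]) (eval_succ_eq hm ?_) (by omega))
    (by simp [eval]) (by omega)) (by omega))) (eval_num_eq (by omega)))
    (eval_digitAt hL hA (by simp [eval]) (eval_add_eq (eval_mul_eq (by simp [eval]) hm (by omega))
    (by simp [eval]) (by omega)) (by omega) (by omega)) ?_
  · have := counters_le_length hL
    have : cs.length ≤ cs.length * (n + 2) := Nat.le_mul_of_pos_right _ (by omega)
    omega
  · rw [h01]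
    split_ifs <;> omega

/-- All candidate matrices are tried. Masked entries are at most `base s n`, so row and column sums
stay below the cap by `mul_base_le`. -/
theorem eval_transferFn (hL : Layout a s n q C cs ts x) (hA : Ample x.length s n cs.length B)
    (hs : 0 < s) (e : Fin cs.length ≃ C) (he : ∀ i, e i = cs[i]) {u v r : ℕ}
    (hu : u < s * base s n ^ cs.length) (hv : v < s * base s n ^ cs.length) {f : C → Finset C}
    (h : OccursAt x (r + 1) (cs.flatMap fun c =>
      cs.map (fun c' => Sym.bit (decide (c' ∈ f c))) ++ [Sym.sep])) :
    transferFn.eval symCode x B ![r, u, v] = truth (∃ K : C → C → ℕ,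
      (∀ c, u / s / base s n ^ (e.symm c : ℕ) % base s n = ∑ c' ∈ f c, K c c') ∧
      ∀ c', v / s / base s n ^ (e.symm c' : ℕ) % base s n = ∑ c : C with c' ∈ f c, K c c') := by
  have hm : ∀ {j : ℕ} {ρ : Fin j → ℕ},
      (app₀ numCounters : Fn j).eval symCode x B ρ = cs.length := by
    intro j ρ
    simpa using eval_numCounters hL hA
  have hb : ∀ i j : Fin cs.length, symAt x (r + 1 + ((i : ℕ) * (cs.length + 1) + j)) - 1 =
      if e j ∈ f (e i) then 1 else 0 := by
    intro i j
    rw [symAt_matrix h i.2 j.2]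
    simp only [he]
    rfl
  rw [truth_congr (exists_transfer_iff e (D := base s n)
    (α := fun i => u / s / base s n ^ i % base s n)
    (β := fun i => v / s / base s n ^ i % base s n)
    (b := fun i j => symAt x (r + 1 + (i * (cs.length + 1) + j)) - 1)
    (fun i _ => Nat.mod_lt _ (base_pos _ _)) hb)]
  have hbound : ∀ i < cs.length, ∀ j < cs.length, ∀ K,
      (symAt x (r + 1 + (i * (cs.length + 1) + j)) - 1) *
        (K / base s n ^ (i * cs.length + j) % base s n) ≤ base s n := by
    intro i hi j hj K
    rw [symAt_matrix h hi hj]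
    have : K / base s n ^ (i * cs.length + j) % base s n < base s n :=
      Nat.mod_lt _ (base_pos _ _)
    split_ifs <;> omega
  have hsum : ∀ F : ℕ → ℕ, (∀ i < cs.length, F i ≤ base s n) →
      ∑ i ∈ Finset.range cs.length, F i ≤ B := by
    intro F hF
    refine le_trans (Finset.sum_le_card_nsmul _ _ (base s n) fun i hi =>
      hF i (Finset.mem_range.1 hi)) ?_
    simpa using hA.mul_base_le
  refine eval_ex hA.one_le _ (eval_pow_eq (by simpa using eval_baseFn hL hA)
    (eval_mul_eq hm hm hA.sq_le) hA.matrix_le) fun K hK => eval_and hA.one_le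
    (eval_all hA.one_le _ hm fun i hi => eval_eq hA.one_le ?_ ?_) fun _ =>
    eval_all hA.one_le _ hm fun j hj => eval_eq hA.one_le ?_ ?_
  · exact eval_counterValue hL hA hs (by simp [eval]) (by simp [eval]) hu hi
  · refine eval_sum_eq _ hm (fun j hj => ?_) (hsum _ fun j hj => hbound i hi j hj K)
    rw [eval_app₄]
    exact eval_entryFn hL hA h hK hi hj
  · exact eval_counterValue hL hA hs (by simp [eval]) (by simp [eval]) hv hj
  · refine eval_sum_eq _ hm (fun i hi => ?_) (hsum _ fun i hi => hbound i hi j hj K)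
    rw [eval_app₄]
    exact eval_entryFn hL hA h hK hi hj

theorem eval_instrFn (hL : Layout a s n q C cs ts x) (hA : Ample x.length s n cs.length B)
    (hs : 0 < s) (e : Fin cs.length ≃ C) (he : ∀ i, e i = cs[i]) {u v r : ℕ}
    (hu : u < s * base s n ^ cs.length) (hv : v < s * base s n ^ cs.length) {l : Instr C}
    (h : OccursAt x r (encodeInstr cs l)) :
    instrFn.eval symCode x B ![r, u, v] = truth (LazyObtains l
      (fun c => u / s / base s n ^ (e.symm c : ℕ) % base s n)
      (fun c => v / s / base s n ^ (e.symm c : ℕ) % base s n)) := by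
  have h16 := hA.sixteen_le
  have hr : (inp (var 0)).eval symCode x B ![r, u, v] = symAt x r := eval_inp_eq (by simp [eval])
  cases l with
  | inc c =>
    have h' : OccursAt x r (Sym.inc :: encodeSet c.1) := h
    have h8 : symAt x r = 8 := h'.symAt_head
    rw [truth_congr LazyObtains.inc_iff]
    refine (eval_ifEq_neg ?_).trans
      (eval_updateFn hL hA hs e he hu hv h'.tail (g := (· + 1)) (Or.inl ⟨h8, rfl⟩))
    rw [hr, h8, eval_num_eq (by omega)]; omega
  | dec c =>
    have h' : OccursAt x r (Sym.dec :: encodeSet c.1) := h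
    have h9 : symAt x r = 9 := h'.symAt_head
    rw [truth_congr LazyObtains.dec_iff]
    refine (eval_ifEq_neg ?_).trans
      (eval_updateFn hL hA hs e he hu hv h'.tail (g := (· - 1)) (Or.inr ⟨by omega, rfl⟩))
    rw [hr, h9, eval_num_eq (by omega)]; omega
  | transf f hf =>
    have h' : OccursAt x r (Sym.transf :: cs.flatMap (fun c =>
      cs.map (fun c' => Sym.bit (decide (c' ∈ f c))) ++ [Sym.sep])) := h
    have h10 : symAt x r = 10 := h'.symAt_head
    rw [truth_congr LazyObtains.transf_iff]
    refine (eval_ifEq_pos ?_).trans (eval_transferFn hL hA hs e he hu hv h'.tail)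
    rw [hr, h10, eval_num_eq (by omega)]

theorem eval_posTarget (hB : 3 ≤ B) (hlen : x.length < B) {t : Trans (Fin a) (Fin s) C} {p : ℕ}
    (h : OccursAt x p (encodeTrans cs t)) {e : Fn k} (he : e.eval symCode x B ρ = p) :
    (posTarget e).eval symCode x B ρ = p + 1 + (t.src : ℕ).size + 1 := by
  have h1 := h.tail.left.left.left
  have h2 := h1.add_le_length (by simp [encodeNat])
  rw [length_encodeNat] at h2
  exact eval_skip_nat hB (eval_succ_eq he (by omega)) h1 hlen

theorem occursAt_target {t : Trans (Fin a) (Fin s) C} {p : ℕ}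
    (h : OccursAt x p (encodeTrans cs t)) :
    OccursAt x (p + 1 + (t.src : ℕ).size + 1) (encodeNat t.tgt) := by
  have := h.tail.left.left.right
  rwa [length_encodeNat, ← Nat.add_assoc] at this

theorem eval_posLabel (hB : 3 ≤ B) (hlen : x.length < B) {t : Trans (Fin a) (Fin s) C} {p : ℕ}
    (h : OccursAt x p (encodeTrans cs t)) {e : Fn k} (he : e.eval symCode x B ρ = p) :
    (posLabel e).eval symCode x B ρ =
      p + 1 + (t.src : ℕ).size + 1 + (t.tgt : ℕ).size + 1 :=
  eval_skip_nat hB (eval_posTarget hB hlen h he) (occursAt_target h) hlen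

theorem eval_posInstr (hB : 6 ≤ B) (hlen : x.length < B) {t : Trans (Fin a) (Fin s) C} {p : ℕ}
    (h : OccursAt x p (encodeTrans cs t)) {e : Fn k} (he : e.eval symCode x B ρ = p) :
    OccursAt x ((posInstr e).eval symCode x B ρ) (encodeInstr cs t.instr) := by
  have hp := eval_posLabel (by omega) hlen h he
  have h1 := h.tail.left.right
  have h2 := h.tail.right
  simp only [List.length_append, length_encodeNat, ← Nat.add_assoc] at h1 h2
  set P := p + 1 + (t.src : ℕ).size + 1 + (t.tgt : ℕ).size + 1
  cases hl : t.label with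
  | none =>
    rw [hl] at h1 h2
    have h1' : OccursAt x P [Sym.eps] := h1
    have h3 := h1'.add_le_length (by simp)
    rw [List.length_singleton] at h3
    rw [posInstr, eval_ifEq_pos, eval_succ_eq hp (by omega)]
    · simpa [encodeLabel] using h2
    · rw [eval_inp_eq hp, h1'.symAt_head, eval_num_eq (by omega)]
      rfl
  | some y =>
    rw [hl] at h1 h2
    have h1' : OccursAt x P (Sym.letter :: encodeNat y) := h1
    have h3 := h1'.add_le_length (by simp)
    rw [List.length_cons] at h3
    rw [posInstr, eval_ifEq_neg, eval_skip_nat (by omega) (eval_succ_eq hp (by omega)) h1'.tail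
      hlen]
    · simp only [encodeLabel, List.length_cons, length_encodeNat] at h2
      rwa [show P + 1 + (y : ℕ).size + 1 = P + ((y : ℕ).size + 1 + 1) by ring]
    · rw [eval_inp_eq hp, h1'.symAt_head, eval_num_eq (by omega)]
      simp [symCode]

theorem eval_edgeFn {M : SafetyIPCANT (Fin a) (Fin s) (Fin n)} {cs : List M.counters}
    {ts : List (Trans (Fin a) (Fin s) M.counters)} (hts : ∀ t, t ∈ ts ↔ t ∈ M.trans)
    (hL : Layout a s n q M.counters cs ts x) (hA : Ample x.length s n cs.length B)
    (e : Fin cs.length ≃ M.counters) (he : ∀ i, e i = cs[i]) {u v : ℕ}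
    (hu : u < s * base s n ^ cs.length) (hv : v < s * base s n ^ cs.length) :
    edgeFn.eval symCode x B ![u, v] = truth (M.LazyEdge e (base s n) u v) := by
  have hs := M.init.pos
  have h16 := hA.sixteen_le
  have hcodes := hA.codes_lt
  have hlen := hA.length_lt
  have hS : (app₀ numStates : Fn 3).eval symCode x B = fun _ => s := by
    funext ρ
    simpa using eval_numStates hL hA
  refine (eval_ex hA.one_le (fun p => symAt x p = 5 ∧ ∃ t ∈ ts, OccursAt x p (encodeTrans cs t) ∧
    ((t.src : ℕ) = u % s ∧ (t.tgt : ℕ) = v % s ∧ LazyObtains t.instr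
      (fun c => u / s / base s n ^ (e.symm c : ℕ) % base s n)
      (fun c => v / s / base s n ^ (e.symm c : ℕ) % base s n)))
    (by simpa using eval_length_eq hA) fun p hp => ?_).trans (truth_congr ?_)
  · refine eval_and hA.one_le (eval_eq hA.one_le (eval_inp_eq (by simp [eval]))
      (eval_num_eq (by omega))) fun h5 => ?_
    -- The evaluation at `p` is right for every transition that occurs there. Should several occur,
    -- their truth values coincide, so the encoding need not be shown to be unambiguous.
    have key : ∀ t : Trans (Fin a) (Fin s) M.counters, OccursAt x p (encodeTrans cs t) →
        (and (eq (value (succ (var 0))) (mod (var 1) (app₀ numStates)))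
          (and (eq (value (posTarget (var 0))) (mod (var 2) (app₀ numStates)))
            (app₃ instrFn (posInstr (var 0)) (var 1) (var 2)))).eval symCode x B ![p, u, v] =
        truth ((t.src : ℕ) = u % s ∧ (t.tgt : ℕ) = v % s ∧ LazyObtains t.instr
          (fun c => u / s / base s n ^ (e.symm c : ℕ) % base s n)
          (fun c => v / s / base s n ^ (e.symm c : ℕ) % base s n)) := by
      intro t hocc
      have hvar : (var 0 : Fn 3).eval symCode x B ![p, u, v] = p := by simp [eval]
      refine eval_and hA.one_le (eval_eq hA.one_le ?_ (eval_mod_eq (by simp [eval])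
        (by rw [hS]) hs (by omega))) fun _ => eval_and hA.one_le (eval_eq hA.one_le ?_
          (eval_mod_eq (by simp [eval]) (by rw [hS]) hs (by omega))) fun _ => ?_
      · rw [eval_value_nat hA.three_le (eval_succ_eq hvar (by omega)) hocc.tail.left.left.left hlen,
          min_eq_left (t.src.2.le.trans hA.states_le)]
      · rw [eval_value_nat hA.three_le (eval_posTarget hA.three_le hlen hocc hvar)
          (occursAt_target hocc) hlen, min_eq_left (t.tgt.2.le.trans hA.states_le)]
      · rw [eval_app₃]
        simp only [eval, Matrix.cons_val]
        exact eval_instrFn hL hA hs e he hu hv (eval_posInstr (by omega) hlen hocc hvar)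
    obtain ⟨t, ht, hocc⟩ := hL.exists_trans p h5
    refine (key t hocc).trans (truth_congr ⟨fun h => ⟨t, ht, hocc, h⟩, ?_⟩)
    rintro ⟨t', -, hocc', h'⟩
    exact truth_eq_one.1 (((key t hocc).symm.trans (key t' hocc')).trans (truth_eq_one.2 h'))
  · constructor
    · rintro ⟨p, -, -, t, ht, -, h1, h2, h3⟩
      refine ⟨t.label, t.instr, SafetyIPCANT.lazyStep_iff.2 ⟨?_, h3⟩⟩
      have : (⟨(M.ofCode e (base s n) u).1, t.label, t.instr, (M.ofCode e (base s n) v).1⟩ :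
          Trans (Fin a) (Fin s) M.counters) = t := by
        cases t
        simp only [Trans.mk.injEq, true_and]
        exact ⟨Fin.ext h1.symm, Fin.ext h2.symm⟩
      rw [this]
      exact (hts t).1 ht
    · rintro ⟨w, l, h⟩
      obtain ⟨ht, hl⟩ := SafetyIPCANT.lazyStep_iff.1 h
      rw [← hts] at ht
      obtain ⟨p, hp⟩ := hL.exists_pos _ ht
      have hp' := hp.add_le_length (by simp [encodeTrans])
      refine ⟨p, ?_, hp.symAt_head, _, ht, hp, rfl, rfl, hl⟩
      simp only [encodeTrans, List.length_cons] at hp'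
      omega

end Fn

end SpaceTM


/-! ## The size of the numbers that occur -/

namespace IPCANT

/-- Binary logarithm of a bound for the numbers that occur. -/
def exponent (s n : ℕ) : ℕ := (s.size + 2) * (s.size + 2) * 2 ^ (8 * (n * n) + 8)

theorem two_pow_le (n : ℕ) : 2 ^ n ≤ 2 ^ (n * n) :=
  Nat.pow_le_pow_right (by omega) (Nat.le_mul_self n)

theorem height_le_mul (s n : ℕ) : height s n ≤ (s.size + 2) * (2 ^ (n * n)) ^ 3 := by
  unfold height
  refine Nat.mul_le_mul_left _ ?_
  rw [← pow_mul]
  exact Nat.pow_le_pow_right (by omega) (by have := Nat.le_mul_self n; omega)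

theorem exponent_eq (s n : ℕ) :
    exponent s n = 256 * ((s.size + 2) ^ 2 * (2 ^ (n * n)) ^ 8) := by
  unfold exponent
  rw [pow_add, ← pow_mul, mul_comm (n * n) 8]
  ring

theorem base_le_two_pow (s n : ℕ) : base s n ≤ 2 ^ (height s n + 1) := by
  have : 1 ≤ 2 ^ height s n := Nat.one_le_two_pow
  rw [base, pow_succ]
  omega

/-- With `Y = s.size + 2` and `G = 2 ^ (n * n)`, each quantity other than the length of the input is
at most `2 ^ e` for some `e` below `256 Y² G⁸`, the exponent allowed. The largest is the stack of
the bisection, where `e` is about `3 Y² G⁷`: height `Y G³` times the logarithm `3 Y G⁴` of the base.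
-/
theorem Ample.of_lt {len s n m B : ℕ} (hs : 0 < s) (hm : m + 1 ≤ 2 ^ n)
    (hB : len + 2 ^ exponent s n < B) : Ample len s n m B := by
  have hY : 3 ≤ s.size + 2 := by have := Nat.size_pos.2 hs; omega
  have hsY : s ≤ 2 ^ s.size := (Nat.lt_size_self s).le
  have hn : n ≤ 2 ^ (n * n) := Nat.lt_two_pow_self.le.trans (two_pow_le n)
  have hmG : m + 1 ≤ 2 ^ (n * n) := hm.trans (two_pow_le n)
  have hH := height_le_mul s n
  have hbase := base_le_two_pow s n
  have hE := exponent_eq s n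
  have hG : 1 ≤ 2 ^ (n * n) := Nat.one_le_two_pow
  set G := 2 ^ (n * n) with hGdef
  set Y := s.size + 2 with hYdef
  set H := height s n
  set E := exponent s n
  have hYG : 1 ≤ Y := by omega
  have hmono : ∀ {c i j : ℕ}, c ≤ 256 → i ≤ 2 → j ≤ 8 → c * (Y ^ i * G ^ j) ≤ E := by
    intro c i j hc hi hj
    rw [hE]
    exact Nat.mul_le_mul hc (Nat.mul_le_mul (Nat.pow_le_pow_right hYG hi)
      (Nat.pow_le_pow_right hG hj))
  have hpow : ∀ {y e : ℕ}, y ≤ 2 ^ e → e ≤ E → y ≤ B := by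
    intro y e h1 h2
    have : 2 ^ e ≤ 2 ^ E := Nat.pow_le_pow_right (by omega) h2
    omega
  have hpw : ∀ i j : ℕ, 1 ≤ Y ^ i * G ^ j := fun i j =>
    Nat.mul_pos (pow_pos hYG _) (pow_pos hG _)
  have hGE : G ≤ E := by simpa using hmono (c := 1) (i := 0) (j := 1) (by omega) (by omega) (by omega)
  have hH1 : H + 1 ≤ 2 * (Y ^ 1 * G ^ 3) := by
    have := hpw 1 3
    rw [pow_one] at this ⊢
    omega
  refine ⟨?_, lt_of_le_of_lt (Nat.le_add_right _ _) hB, hpow hsY ?_, hpow (hn.trans Nat.lt_two_pow_self.le) hGE,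
    hpow Nat.lt_two_pow_self.le ?_, hpow hbase ?_, ?_, ?_, ?_, ?_⟩
  · refine hpow (e := 4) (by norm_num) ?_
    have := hmono (c := 4) (i := 0) (j := 0) (by omega) (by omega) (by omega)
    simpa using this
  · have := hmono (c := 1) (i := 1) (j := 0) (by omega) (by omega) (by omega)
    simp only [pow_one, pow_zero, mul_one, one_mul] at this
    omega
  · have := hmono (c := 2) (i := 1) (j := 3) (by omega) (by omega) (by omega)
    omega
  · exact hH1.trans (hmono (by omega) (by omega) (by omega))
  · refine hpow (e := 2 * (Y ^ 0 * G ^ 1)) ?_ (hmono (by omega) (by omega) (by omega))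
    have h1 : m ≤ 2 ^ G := Nat.lt_two_pow_self.le.trans (Nat.pow_le_pow_right (by omega) (by omega))
    calc m * m ≤ 2 ^ G * 2 ^ G := Nat.mul_le_mul h1 h1
      _ = 2 ^ (2 * (Y ^ 0 * G ^ 1)) := by rw [← pow_add]; congr 1; ring
  · refine hpow (e := G + (H + 1)) ?_ ?_
    · have h1 : m ≤ 2 ^ G :=
        Nat.lt_two_pow_self.le.trans (Nat.pow_le_pow_right (by omega) (by omega))
      rw [pow_add]
      exact Nat.mul_le_mul h1 hbase
    · have h3 : G ≤ Y ^ 1 * G ^ 3 := by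
        rw [pow_one]
        exact (Nat.le_self_pow (by omega) G).trans (Nat.le_mul_of_pos_left _ hYG)
      have := hmono (c := 3) (i := 1) (j := 3) (by omega) (by omega) (by omega)
      omega
  · refine hpow (e := 2 * (Y ^ 1 * G ^ 5)) ?_ (hmono (by omega) (by omega) (by omega))
    calc base s n ^ (m * m) ≤ (2 ^ (H + 1)) ^ (m * m) := Nat.pow_le_pow_left hbase _
      _ = 2 ^ ((H + 1) * (m * m)) := (pow_mul 2 (H + 1) (m * m)).symm
      _ ≤ 2 ^ ((2 * (Y ^ 1 * G ^ 3)) * (G * G)) := Nat.pow_le_pow_right (by omega)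
          (Nat.mul_le_mul hH1 (Nat.mul_le_mul (by omega) (by omega)))
      _ = 2 ^ (2 * (Y ^ 1 * G ^ 5)) := by congr 1; ring
  · refine hpow (e := 4 * (Y ^ 2 * G ^ 7) + 2) ?_ ?_
    · have h1 : 2 * (s * base s n ^ m) ≤ 2 ^ (1 + s.size + (H + 1) * m) := by
        rw [pow_add, pow_add, pow_mul, pow_one, mul_assoc]
        exact Nat.mul_le_mul_left _ (Nat.mul_le_mul hsY (Nat.pow_le_pow_left hbase _))
      have h2 : 1 + s.size + (H + 1) * m ≤ 3 * (Y * G ^ 4) := by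
        have h3 : (H + 1) * m ≤ 2 * (Y ^ 1 * G ^ 3) * G := Nat.mul_le_mul hH1 (by omega)
        have h4 : Y ≤ Y * G ^ 4 := Nat.le_mul_of_pos_right _ (pow_pos hG _)
        have h5 : 2 * (Y ^ 1 * G ^ 3) * G = 2 * (Y * G ^ 4) := by ring
        omega
      have h6 : (2 * (s * base s n ^ m)) ^ H ≤ 2 ^ (3 * (Y ^ 2 * G ^ 7)) := by
        calc (2 * (s * base s n ^ m)) ^ H ≤ (2 ^ (3 * (Y * G ^ 4))) ^ H :=
              Nat.pow_le_pow_left (h1.trans (Nat.pow_le_pow_right (by omega) h2)) _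
          _ = 2 ^ (3 * (Y * G ^ 4) * H) := by rw [← pow_mul]
          _ ≤ 2 ^ (3 * (Y * G ^ 4) * (Y * G ^ 3)) :=
              Nat.pow_le_pow_right (by omega) (Nat.mul_le_mul_left _ hH)
          _ = 2 ^ (3 * (Y ^ 2 * G ^ 7)) := by congr 1; ring
      have h7 : 2 ^ (3 * (Y ^ 2 * G ^ 7)) ≤ 2 ^ (4 * (Y ^ 2 * G ^ 7)) :=
        Nat.pow_le_pow_right (by omega) (by omega)
      have h8 : 1 ≤ 2 ^ (4 * (Y ^ 2 * G ^ 7)) := Nat.one_le_two_pow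
      rw [pow_add]
      change 2 + (2 * (s * base s n ^ m)) ^ H ≤ _
      omega
    · have := hmono (c := 6) (i := 2) (j := 7) (by omega) (by omega) (by omega)
      have := hpw 2 7
      omega

/-! ## The length of the description -/

/-- Transitions as elements of a finite product. -/
def Trans.toProd {A Q X : Type*} {C : Finset (Finset X)} (t : Trans A Q C) :
    Q × Q × Option A × (C ⊕ C ⊕ (C → Finset C)) :=
  (t.src, t.tgt, t.label, match t.instr with
    | .inc c => .inl c
    | .dec c => .inr (.inl c)
    | .transf f _ => .inr (.inr f))

theorem Trans.toProd_injective {A Q X : Type*} {C : Finset (Finset X)} :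
    Function.Injective (Trans.toProd : Trans A Q C → _) := by
  rintro ⟨q₁, w₁, l₁, r₁⟩ ⟨q₂, w₂, l₂, r₂⟩ h
  simp only [Trans.toProd, Prod.mk.injEq] at h
  obtain ⟨rfl, rfl, rfl, h⟩ := h
  congr 1
  cases l₁ <;> cases l₂ <;> simp_all

/-- Distinct transitions are counted, with distributivity ignored: a transfer is one of at most `2 ^
(|C| * |C|)` relations on counters. -/
theorem length_trans_le {a s n : ℕ} {C : Finset (Finset (Fin n))}
    {ts : List (Trans (Fin a) (Fin s) C)} (h : ts.Nodup) :
    ts.length ≤ s * (s * ((a + 1) * (C.card + (C.card + 2 ^ (C.card * C.card))))) := by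
  have h1 := (h.map Trans.toProd_injective).length_le_card
  simpa [Fintype.card_prod, Fintype.card_option, ← pow_mul] using h1

theorem length_encodeInstr_le {n : ℕ} {C : Finset (Finset (Fin n))} (cs : List C) (l : Instr C) :
    (encodeInstr cs l).length ≤ n + 2 + cs.length * (cs.length + 1) := by
  cases l with
  | inc c => simp only [encodeInstr, List.length_cons, length_encodeSet]; omega
  | dec c => simp only [encodeInstr, List.length_cons, length_encodeSet]; omega
  | transf f hf =>
    simp [encodeInstr, List.length_flatMap]

theorem length_encodeTrans_le {a s n : ℕ} {C : Finset (Finset (Fin n))} (cs : List C)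
    (t : Trans (Fin a) (Fin s) C) : (encodeTrans cs t).length ≤
      2 * s.size + a.size + n + cs.length * (cs.length + 1) + 7 := by
  have h1 := length_encodeInstr_le cs t.instr
  have h2 : (t.src : ℕ).size ≤ s.size := Nat.size_le_size t.src.2.le
  have h3 : (t.tgt : ℕ).size ≤ s.size := Nat.size_le_size t.tgt.2.le
  have h4 : (encodeLabel t.label).length ≤ a.size + 2 := by
    cases t.label with
    | none => simp [encodeLabel]
    | some y =>
      have := Nat.size_le_size y.2.le
      simp only [encodeLabel, List.length_cons, length_encodeNat]; omega
  simp only [encodeTrans, List.length_cons, List.length_append, length_encodeNat]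
  omega

theorem size_le_log (a : ℕ) : a.size ≤ Nat.log 2 a + 1 := by
  rw [Nat.size_le]
  exact Nat.lt_pow_succ_log_self (by norm_num) a

/-- Positions in the input must be stored, so the logarithm of its length counts. There are at most
`2 ^ (6 Z)` transitions, each written with at most `2 ^ (12 Z)` symbols; the other parts are
absorbed by the generous constant. -/
theorem length_le {a s n q : ℕ} {C : Finset (Finset (Fin n))} {cs : List C}
    {ts : List (Trans (Fin a) (Fin s) C)} {x : List Sym} (hq : q < s) (hcs : cs.length = C.card)
    (hC : C.card + 1 ≤ 2 ^ n) (hts : ts.Nodup)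
    (hx : x = encodeNat a ++ encodeNat s ++ encodeNat n ++ encodeNat q ++
      cs.flatMap (fun c => Sym.ctr :: encodeSet c.1) ++ ts.flatMap (encodeTrans cs)) :
    x.length ≤ 2 ^ (30 * ((Nat.log 2 a + Nat.log 2 s + 1) * (2 ^ (n * n)) ^ 2)) := by
  have ha := size_le_log a
  have hs := size_le_log s
  have hq' : q.size ≤ s.size := Nat.size_le_size hq.le
  have hn' : n.size ≤ n := Nat.size_le.2 Nat.lt_two_pow_self
  have ha2 : a + 1 ≤ 2 ^ (Nat.log 2 a + 1) := Nat.lt_pow_succ_log_self (by norm_num) a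
  have hs2 : s ≤ 2 ^ (Nat.log 2 s + 1) := (Nat.lt_pow_succ_log_self (by norm_num) s).le
  have hn : n ≤ 2 ^ (n * n) := Nat.lt_two_pow_self.le.trans (two_pow_le n)
  have hmG : C.card + 1 ≤ 2 ^ (n * n) := hC.trans (two_pow_le n)
  have hG : 1 ≤ 2 ^ (n * n) := Nat.one_le_two_pow
  have hT := length_trans_le hts
  set G := 2 ^ (n * n)
  set y := Nat.log 2 a + Nat.log 2 s + 1 with hy
  set m := C.card
  have hy1 : 1 ≤ y := by omega
  set Z := y * G ^ 2 with hZ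
  have hyZ : y ≤ Z := Nat.le_mul_of_pos_right _ (pow_pos hG _)
  have hGZ : G ^ 2 ≤ Z := Nat.le_mul_of_pos_left _ hy1
  have hG1 : G ≤ G ^ 2 := Nat.le_self_pow (by omega) G
  have hGG : G * G = G ^ 2 := by ring
  have hmm : m * (m + 1) ≤ G ^ 2 := by
    rw [← hGG]; exact Nat.mul_le_mul (by omega) hmG
  have hmn : m * (n + 2) ≤ 3 * G ^ 2 := by
    calc m * (n + 2) ≤ G * (3 * G) := Nat.mul_le_mul (by omega) (by omega)
      _ = 3 * G ^ 2 := by ring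
  have htau : 2 * s.size + a.size + n + cs.length * (cs.length + 1) + 7 ≤ 2 ^ (12 * Z) := by
    refine le_trans ?_ Nat.lt_two_pow_self.le
    rw [hcs]; omega
  have htrans : ts.length ≤ 2 ^ (6 * Z) := by
    have h1 : m + (m + 2 ^ (m * m)) ≤ 2 ^ (2 * Z) := by
      have h2 : m + m ≤ 2 ^ Z := by
        have h3 : 2 * m ≤ 2 ^ (m + 1) := by
          have := (Nat.lt_two_pow_self (n := m)).le
          rw [pow_succ]; omega
        have h4 : 2 ^ (m + 1) ≤ 2 ^ Z := Nat.pow_le_pow_right (by omega) (by omega)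
        omega
      have h5 : 2 ^ (m * m) ≤ 2 ^ Z := Nat.pow_le_pow_right (by omega) (by
        have : m * m ≤ m * (m + 1) := Nat.mul_le_mul_left _ (by omega)
        omega)
      have h6 : 2 ^ Z * 2 ≤ 2 ^ (2 * Z) := by
        rw [← pow_succ]; exact Nat.pow_le_pow_right (by omega) (by omega)
      omega
    have hs3 : s ≤ 2 ^ Z := hs2.trans (Nat.pow_le_pow_right (by omega) (by omega))
    have ha3 : a + 1 ≤ 2 ^ Z := ha2.trans (Nat.pow_le_pow_right (by omega) (by omega))
    calc ts.length ≤ _ := hT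
      _ ≤ 2 ^ Z * (2 ^ Z * (2 ^ Z * 2 ^ (2 * Z))) := by gcongr
      _ = 2 ^ (5 * Z) := by rw [← pow_add, ← pow_add, ← pow_add]; congr 1; ring
      _ ≤ 2 ^ (6 * Z) := Nat.pow_le_pow_right (by omega) (by omega)
  have hflat : (ts.flatMap (encodeTrans cs)).length ≤ 2 ^ (18 * Z) := by
    rw [List.length_flatMap]
    refine (List.sum_le_card_nsmul _ (2 ^ (12 * Z)) ?_).trans ?_
    · intro r hr
      obtain ⟨t, -, rfl⟩ := List.mem_map.1 hr
      exact (length_encodeTrans_le cs t).trans htau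
    · rw [List.length_map, smul_eq_mul, show 18 * Z = 6 * Z + 12 * Z by ring, pow_add]
      exact Nat.mul_le_mul_right _ htrans
  have hctr : (cs.flatMap (fun c => Sym.ctr :: encodeSet c.1)).length = m * (n + 2) := by
    simp [List.length_flatMap, length_encodeSet, hcs, m]
  have hrest : a.size + 1 + (s.size + 1) + (n.size + 1) + (q.size + 1) + m * (n + 2) ≤
      2 ^ (18 * Z) := by
    refine le_trans ?_ (Nat.lt_two_pow_self (n := 18 * Z)).le
    omega
  rw [hx]
  simp only [List.length_append, length_encodeNat, hctr]
  have h2 : 2 ^ (18 * Z) * 2 ≤ 2 ^ (30 * Z) := by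
    rw [← pow_succ]; exact Nat.pow_le_pow_right (by omega) (by omega)
  omega

/-- The numbers that occur have few digits. -/
theorem size_bound_le {a s n len : ℕ}
    (hlen : len ≤ 2 ^ (30 * ((Nat.log 2 a + Nat.log 2 s + 1) * (2 ^ (n * n)) ^ 2))) :
    (len + 2 ^ exponent s n + 1).size + 2 ≤
      2400 * 2 ^ (2400 * n ^ 2) * (Nat.log 2 a + Nat.log 2 s + 1) ^ 2 := by
  have hE := exponent_eq s n
  have hsz := size_le_log s
  have hG : 1 ≤ 2 ^ (n * n) := Nat.one_le_two_pow
  have h9 : (2 ^ (n * n)) ^ 8 ≤ 2 ^ (2400 * n ^ 2) := by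
    rw [← pow_mul, ← sq]
    exact Nat.pow_le_pow_right (by omega) (by omega)
  generalize 2 ^ (2400 * n ^ 2) = R at h9
  set G := 2 ^ (n * n)
  set y := Nat.log 2 a + Nat.log 2 s + 1 with hy
  set E := exponent s n
  have hy1 : 1 ≤ y := by omega
  have h1 : (s.size + 2) ^ 2 ≤ (3 * y) ^ 2 := Nat.pow_le_pow_left (by omega) 2
  have h2 : E ≤ 2304 * (y ^ 2 * G ^ 8) := by
    rw [hE]
    calc 256 * ((s.size + 2) ^ 2 * G ^ 8) ≤ 256 * ((3 * y) ^ 2 * G ^ 8) := by gcongr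
      _ = 2304 * (y ^ 2 * G ^ 8) := by ring
  have h3 : y * G ^ 2 ≤ y ^ 2 * G ^ 8 :=
    Nat.mul_le_mul (Nat.le_self_pow (by omega) y) (Nat.pow_le_pow_right hG (by omega))
  have h4 : 1 ≤ y ^ 2 * G ^ 8 := Nat.mul_pos (pow_pos hy1 _) (pow_pos hG _)
  have h5 : (len + 2 ^ E + 1).size ≤ 30 * (y * G ^ 2) + E + 2 := by
    rw [Nat.size_le]
    have h6 : 2 ^ (30 * (y * G ^ 2)) ≤ 2 ^ (30 * (y * G ^ 2) + E) :=
      Nat.pow_le_pow_right (by omega) (by omega)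
    have h7 : 2 ^ E ≤ 2 ^ (30 * (y * G ^ 2) + E) := Nat.pow_le_pow_right (by omega) (by omega)
    have h8 : 2 ≤ 2 ^ (30 * (y * G ^ 2) + E) := by
      calc 2 = 2 ^ 1 := rfl
        _ ≤ _ := Nat.pow_le_pow_right (by omega) (by
          have : 1 ≤ y * G ^ 2 := Nat.mul_pos hy1 (pow_pos hG _)
          omega)
    rw [pow_add 2 _ 2]
    omega
  -- In total `30 + 2304 + 4 ≤ 2400` times `y ^ 2 * R`.
  have h10 : y ^ 2 * G ^ 8 ≤ y ^ 2 * R := Nat.mul_le_mul_left _ h9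
  have h11 : 2400 * R * y ^ 2 = 2400 * (y ^ 2 * R) := by ring
  omega

end IPCANT


/-! ## The decision procedure -/

namespace SpaceTM

namespace Fn

open IPCANT

variable {k B : ℕ} {ρ : Fin k → ℕ} {a s n q : ℕ} {C : Finset (Finset (Fin n))} {cs : List C}
  {ts : List (Trans (Fin a) (Fin s) C)} {x : List Sym}

/-- Saturation is compatible with the arithmetic used, so the bound can be evaluated under caps that
are still too small. -/
theorem eval_add_sat {e f : Fn k} {u v : ℕ} (he : e.eval symCode x B ρ = min u B)
    (hf : f.eval symCode x B ρ = min v B) :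
    (add e f).eval symCode x B ρ = min (u + v) B := by
  rw [eval_add_min (by omega), he, hf]
  omega

theorem eval_mul_sat {e f : Fn k} {u v : ℕ} (he : e.eval symCode x B ρ = min u B)
    (hf : f.eval symCode x B ρ = min v B) :
    (mul e f).eval symCode x B ρ = min (u * v) B := by
  rw [eval_mul_min, he, hf, min_min_mul, Nat.mul_comm u, min_min_mul, Nat.mul_comm]

theorem eval_two_pow_sat (hB : 2 ≤ B) {f : Fn k} {v : ℕ}
    (hf : f.eval symCode x B ρ = min v B) :
    (pow (num 2) f).eval symCode x B ρ = min (2 ^ v) B := by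
  rw [eval_pow_min, eval_num_eq hB, hf]
  rcases le_total v B with h | h
  · rw [min_eq_left h]
  · rw [min_eq_right h, min_eq_right Nat.lt_two_pow_self.le,
      min_eq_right (Nat.lt_two_pow_self.le.trans (Nat.pow_le_pow_right (by omega) h))]

/-- A number that exceeds everything that occurs in the computation, if there is one. -/
def boundFn : Fn 0 :=
  ifEq length cap cap (add length (pow (num 2)
    (mul (mul (add sizeStates (num 2)) (add sizeStates (num 2)))
      (pow (num 2) (add (mul (num 8) (mul sizeBasis sizeBasis)) (num 8))))))

/-- While the input is too long for the cap, its parts cannot be located and the cap is returned,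
which is the correct saturated value. Once it fits, positions are exact and the rest is saturating
arithmetic. -/
theorem eval_boundFn (hL : Layout a s n q C cs ts x) (hB : 16 ≤ B) :
    boundFn.eval symCode x B ![] = min (x.length + 2 ^ exponent s n) B := by
  by_cases h : B ≤ x.length
  · rw [boundFn, eval_ifEq_pos (by rw [eval_length, min_eq_right h]; rfl),
      min_eq_right (h.trans (Nat.le_add_right _ _))]
    rfl
  · rw [boundFn, eval_ifEq_neg (by
      rw [eval_length]; show _ ≠ B; omega)]
    have h1 := eval_sizeStates hL (by omega) (show x.length < B by omega)
    have h2 := eval_sizeBasis_min hL (by omega) (show x.length < B by omega)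
    have h3 := hL.states.add_le_length (by simp [encodeNat])
    rw [length_encodeNat] at h3
    have h4 := eval_add_sat (h1.trans (min_eq_left (show s.size ≤ B by omega)).symm)
      (eval_num (code := symCode) (x := x) (B := B) (ρ := ![]) 2)
    exact eval_add_sat eval_length (eval_two_pow_sat (by omega) (eval_mul_sat (eval_mul_sat h4 h4)
      (eval_two_pow_sat (by omega) (eval_add_sat (eval_mul_sat (eval_num 8) (eval_mul_sat h2 h2))
        (eval_num 8)))))

/-- Whether there is a long lazy run. -/
def runFn : Fn 0 :=
  ex numCodes (app₂ (Bisection.pathFn numCodes heightFn edgeFn) (app₀ initState) (var 0))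

theorem eval_runFn {M : SafetyIPCANT (Fin a) (Fin s) (Fin n)} {cs : List M.counters}
    {ts : List (Trans (Fin a) (Fin s) M.counters)} (hts : ∀ t, t ∈ ts ↔ t ∈ M.trans)
    (hL : Layout a s n M.init M.counters cs ts x) (hA : Ample x.length s n cs.length B)
    (e : Fin cs.length ≃ M.counters) (he : ∀ i, e i = cs[i]) :
    runFn.eval symCode x B ![] = truth (M.HasLazyRun (2 ^ height s n)) := by
  have hs := M.init.pos
  have hV : 0 < s * base s n ^ cs.length := Nat.mul_pos hs (pow_pos (base_pos _ _) _)
  rw [truth_congr (SafetyIPCANT.hasLazyRun_iff_exists_path (e := e) (D := base s n)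
    (Nat.lt_succ_self _))]
  refine eval_ex hA.one_le _ (eval_numCodes hL hA hs) fun v hv => ?_
  rw [eval_app₂, eval_app₀, eval_initState hL hA M.init.2]
  refine Bisection.eval_pathFn (eval_numCodes hL hA hs) (eval_heightFn hL hA) hV hA.path_le
    (fun u hu v hv => eval_edgeFn hts hL hA e he hu hv) ?_ hv
  exact lt_of_lt_of_le M.init.2 (Nat.le_mul_of_pos_right _ (pow_pos (base_pos _ _) _))

end Fn

end SpaceTM

/-! ### Correctness and space of the decision procedure -/

namespace SafetyIPCANT

open IPCANT SpaceTM

/-- `3 * s ≤ 2 ^ (s.size + 2)` turns the bound on the run into a power of two; `height` is chosen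
accordingly. -/
theorem runBound_le_two_pow_height {s n m : ℕ} (hs : 0 < s) (hm : m + 1 ≤ 2 ^ n) :
    runBound s n m ≤ 2 ^ height s n := by
  refine (runBound_lt s n m hs hm).le.trans ?_
  have h3 : 3 * s ≤ 2 ^ (s.size + 2) := by
    have := Nat.lt_size_self s
    rw [pow_add]; omega
  calc (3 * s) ^ 2 ^ (2 * n ^ 2 + n) ≤ (2 ^ (s.size + 2)) ^ 2 ^ (2 * n ^ 2 + n) :=
        Nat.pow_le_pow_left h3 _
    _ = 2 ^ height s n := by rw [← pow_mul, height, sq]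

/-- Nonemptiness is decidable in space exponential in the size of the basis and polylogarithmic in
the sizes of the alphabet and of the set of states. -/
theorem decider_nonempty {a s n : ℕ} (M : SafetyIPCANT (Fin a) (Fin s) (Fin n)) {x : List Sym}
    (hx : IsEncoding M x) :
    (Fn.decider symCode Fn.boundFn Fn.runFn).HaltsWith x
      (@decide M.language.Nonempty (Classical.dec _)) ∧
    (Fn.decider symCode Fn.boundFn Fn.runFn).UsesSpace x
      (2400 * 2 ^ (2400 * n ^ 2) * (Nat.log 2 a + Nat.log 2 s + 1) ^ 2) := by
  obtain ⟨cs, ts, hcs, hall, hnd, hts, hx⟩ := hx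
  have hs := M.init.pos
  have hL := Layout.of_eq hx
  let e : Fin cs.length ≃ M.counters := hcs.getEquivOfForallMemList cs hall
  have hcard : cs.length = M.counters.card := by
    simpa using Fintype.card_congr e
  have hm : M.counters.card + 1 ≤ 2 ^ n := by simpa using M.card_counters_lt
  have h0 : (Fin.elim0 : Fin 0 → ℕ) = ![] := Subsingleton.elim _ _
  have h16 : 16 ≤ x.length + 2 ^ exponent s n + 1 := by
    have h1 : 4 ≤ exponent s n := by
      have : 1 ≤ (s.size + 2) ^ 2 * (2 ^ (n * n)) ^ 8 := Nat.mul_pos (by positivity) (by positivity)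
      rw [exponent_eq]; omega
    have h2 : 2 ^ 4 ≤ 2 ^ exponent s n := Nat.pow_le_pow_right (by omega) h1
    omega
  -- One more than the bound is a cap that `boundFn` does not reach, so the search stops there at
  -- the latest. Wherever it stops, the cap exceeds the bound and is therefore ample.
  obtain ⟨B, hB, -, hreq, hhalt, hspace⟩ := Fn.decider_spec symCode symCode_le Fn.boundFn
    Fn.runFn x h16 (by rw [h0, Fn.eval_boundFn hL h16]; omega)
  rw [h0, Fn.eval_boundFn hL hB] at hreq
  have hA : Ample x.length s n cs.length B := Ample.of_lt hs (by omega) (by omega)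
  have hrun : M.language.Nonempty ↔ M.HasLazyRun (2 ^ height s n) :=
    nonempty_language_iff_hasLazyRun (by simpa using runBound_le_two_pow_height hs hm)
  rw [h0, Fn.eval_runFn hts hL hA e fun _ => rfl] at hhalt
  refine ⟨?_, fun t i => (hspace t i).trans_le
    (size_bound_le (length_le M.init.2 hcard hm hnd hx))⟩
  convert hhalt using 2
  rw [hrun, Fn.truth_eq_one]

end SafetyIPCANT

theorem mainTheorem3 :
    -- one deterministic machine decides nonemptiness in space `2^{O(n²)} · O(log² (|Σ| |Q|))`
    (∃ (T : SpaceTM.Machine IPCANT.Sym) (k : ℕ),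
      ∀ (a s n : ℕ) (M : SafetyIPCANT (Fin a) (Fin s) (Fin n)) (x : List IPCANT.Sym),
        IPCANT.IsEncoding M x →
          (M.language.Nonempty → T.HaltsWith x true) ∧
          (¬ M.language.Nonempty → T.HaltsWith x false) ∧
          T.UsesSpace x (k * 2 ^ (k * n ^ 2) * (Nat.log 2 a + Nat.log 2 s + 1) ^ 2)) ∧
    -- a lazy run of the doubly exponential length `m - 1` yields an infinite run
    (∀ (A Q X : Type*) [Fintype A] [Fintype Q] [Fintype X] [DecidableEq X]
      (M : SafetyIPCANT A Q X),
        IPCANT.runBound (Fintype.card Q) (Fintype.card X) M.counters.card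
            < (3 * Fintype.card Q) ^ 2 ^ (2 * Fintype.card X ^ 2 + Fintype.card X) ∧
        (M.HasLazyRun
            (IPCANT.runBound (Fintype.card Q) (Fintype.card X) M.counters.card - 1) →
          M.HasInfiniteLazyRun ∧ M.language.Nonempty)) := by
  refine ⟨?_, fun A Q X _ _ _ _ M => ⟨SafetyIPCANT.runBound_lt _ _ _
    (Fintype.card_pos_iff.2 ⟨M.init⟩) M.card_counters_lt, fun h => ?_⟩⟩
  · refine ⟨SpaceTM.Fn.decider IPCANT.symCode SpaceTM.Fn.boundFn SpaceTM.Fn.runFn, 2400,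
      fun a s n M x hx => ?_⟩
    obtain ⟨hhalt, hspace⟩ := M.decider_nonempty hx
    exact ⟨fun h => by simpa [h] using hhalt, fun h => by simpa [h] using hhalt, hspace⟩
  · have h' := SafetyIPCANT.hasInfiniteLazyRun_of_hasLazyRun h
    exact ⟨h', SafetyIPCANT.nonempty_language_of_hasInfiniteLazyRun h'⟩
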